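/- **Definitions.** *Restriction semigroups.* A restriction semigroup $(S,E,\lambda,\rho)$ is a semigroup $S$ with a non-empty commutative subsemigroup $E\subseteq S$ consisting of idempotents (the projections) and maps $\lambda,\rho:S\to E$ such that, for all $s,t\in S$ and $f\in E$: $\lambda(f)=f=\rho(f)$, $s\lambda(s)=s=\rho(s)s$, $\lambda(st)=\lambda(\lambda(s)t)$, $\rho(st)=\rho(s\rho(t))$, $fs=s\lambda(fs)$ and $sf=\rho(sf)s$. A representation of $S$ on a Hilbert space $H$ is a semigroup homomorphism $\sigma:S\to B(H)$ with $\|\sigma_s\|\le 1$ for all $s\in S$ and $\sigma_e^*=\sigma_e^2=\sigma_e$ for all $e\in E$. The operator algebra $\mathcal A(S)$ is the Hausdorff completion of the semigroup algebra $\mathbb C[S]=\{\sum_s a_s\delta_s\}$ with respect to the seminorm $\|\sum_s a_s\delta_s\|_0=\sup_\sigma\|\sum_s a_s\sigma_s\|$, where $\sigma$ runs over all representations of $S$. *Étale categories.* An étale category $\mathcal C$ is a small category whose set of objects $\mathcal C^{(0)}$ is a locally compact Hausdorff space, whose set of morphisms (also denoted $\mathcal C$, and not necessarily Hausdorff) is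 a topological space, and whose structure maps (source $\mathbf d$, range $\mathbf r$, unit, composition) are continuous, such that $\mathbf d$ and $\mathbf r$ are local homeomorphisms and the unit map is a topological embedding; $\mathcal C^{(0)}$ is identified with its image in $\mathcal C$, which is open. A bisection is an open set of morphisms on which $\mathbf d$ and $\mathbf r$ are injective. For $V\subseteq \mathcal C$ open, $C_c(V)$ is the set of functions $f:\mathcal C\to\mathbb C$ that vanish outside $V$ and whose restriction to $V$ is continuous with compact support. Let $\mathcal A_0(\mathcal C)$ be the linear span of all $C_c(V)$, for $V\subseteq\mathcal C$ open and Hausdorff; it is an algebra under the convolution $(f*g)(z)=\sum_{xy=z}f(x)g(y)$. A representation of $\mathcal A_0(\mathcal C)$ on a Hilbert space $H$ is an algebra homomorphism $\pi:\mathcal A_0(\mathcal C)\to B(H)$ such that $\|\pi(f)\|\le\|f\|_\infty$ for each bisection $U$ and each $f\in C_c(U)$, and $\pi(\bar f)=\pi(f)^*$ for each $f\in C_c(\mathcal C^{(0)})$. The operator algebra $\mathcal A(\mathcal C)$ is the Hausdorff completion of $\mathcal A_0(\mathcal C)$ with respect to $\|f\|_0=\sup_\pi\|\pi(f)\|$,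 where $\pi$ runs over all representations of $\mathcal A_0(\mathcal C)$. *The canonical action and its category of germs.* Let $\widehat E$ be the set of all non-zero maps $\varphi:E\to\{0,1\}$ with $\varphi(ef)=\varphi(e)\varphi(f)$ for all $e,f\in E$, with the topology of pointwise convergence, and let $D_e=\{\varphi\in\widehat E:\varphi(e)=1\}$ for $e\in E$. The canonical action $\theta$ of $S$ on $\widehat E$ consists of the homeomorphisms $\theta_s:D_{\lambda(s)}\to D_{\rho(s)}$, $\theta_s(\varphi)(f)=\varphi(\lambda(fs))$, for $s\in S$. Its category of germs $\mathcal C(\theta,S,\widehat E)$ is the étale category with space of objects $\widehat E$ whose morphisms are the germs $[s,\varphi]$ with $s\in S$ and $\varphi\in D_{\lambda(s)}$, where $[s,\varphi]=[t,\psi]$ if and only if $\varphi=\psi$ and $sf=tf$ for some $f\in E$ with $\varphi(f)=1$. The structure maps are $\mathbf d[s,\varphi]=\varphi$, $\mathbf r[s,\varphi]=\theta_s(\varphi)$, $[s,\theta_t(\varphi)][t,\varphi]=[st,\varphi]$, the unit at $\varphi$ being $[e,\varphi]$ for any $e\in E$ with $\varphi(e)=1$. The space of germs has the topology with basis the sets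 $\{[s,\varphi]:\varphi\in U\}$, for $s\in S$ and $U\subseteq D_{\lambda(s)}$ open. For $s\in S$ let $\Theta_s=\{[s,\varphi]:\varphi\in D_{\lambda(s)}\}$, a compact open bisection, so that its characteristic function $1_{\Theta_s}$ belongs to $\mathcal A_0(\mathcal C(\theta,S,\widehat E))$. **Statement.** Let $(S,E,\lambda,\rho)$ be a restriction semigroup such that $\widehat E$ is second countable, and let $\theta$ be the canonical action of $S$ on $\widehat E$. Then there is an isometric algebra isomorphism $\Phi$ from $\mathcal A(S)$ onto $\mathcal A(\mathcal C(\theta,S,\widehat E))$ which takes the image of $\delta_s$ in $\mathcal A(S)$ to the image of $1_{\Theta_s}$ in $\mathcal A(\mathcal C(\theta,S,\widehat E))$, for each $s\in S$. It is the only continuous algebra homomorphism from $\mathcal A(S)$ to $\mathcal A(\mathcal C(\theta,S,\widehat E))$ with this property. -/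

import Mathlib

universe u v w

/-! ### Hausdorff completion of an algebra with respect to a submultiplicative seminorm -/

/-- A submultiplicative seminorm on a (not necessarily unital) complex algebra. -/
structure AlgSeminorm (A : Type u) [NonUnitalRing A] [Module ℂ A] extends Seminorm ℂ A where
  mul_le' : ∀ x y : A, toFun (x * y) ≤ toFun x * toFun y

section HausdorffCompletion

variable {A : Type u} [NonUnitalRing A] [Module ℂ A]

/-- The algebra `A`, regarded as a seminormed algebra through `p`. -/
def AlgSeminorm.Space (_p : AlgSeminorm A) : Type u := A

noncomputable instance (p : AlgSeminorm A) : NonUnitalSeminormedRing p.Space :=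
  { (inferInstanceAs (NonUnitalRing A) : NonUnitalRing p.Space),
    (p.toSeminorm.toAddGroupSeminorm.toSeminormedAddCommGroup : SeminormedAddCommGroup A) with
    norm_mul_le := p.mul_le' }

noncomputable instance (p : AlgSeminorm A) : NormedSpace ℂ p.Space :=
  { (inferInstanceAs (Module ℂ A) : Module ℂ p.Space) with
    norm_smul_le := fun c x => le_of_eq (map_smul_eq_mul p.toSeminorm c x) }

/-- The Hausdorff completion of `(A, p)`: the completion of the normed algebra obtained from `A` by
dividing by the ideal on which `p` vanishes. -/
def AlgSeminorm.HausdorffCompletion (p : AlgSeminorm A) : Type u :=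
  UniformSpace.Completion p.Space

namespace AlgSeminorm

variable (p : AlgSeminorm A)

noncomputable instance : NormedAddCommGroup p.HausdorffCompletion :=
  inferInstanceAs (NormedAddCommGroup (UniformSpace.Completion p.Space))

noncomputable instance : NormedSpace ℂ p.HausdorffCompletion :=
  inferInstanceAs (NormedSpace ℂ (UniformSpace.Completion p.Space))

instance : CompleteSpace p.HausdorffCompletion :=
  inferInstanceAs (CompleteSpace (UniformSpace.Completion p.Space))

/-- The canonical map from `A` to the Hausdorff completion of `(A, p)`. -/
noncomputable def toCompletion (a : A) : p.HausdorffCompletion :=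
  ((show p.Space from a : p.Space) : UniformSpace.Completion p.Space)

theorem norm_toCompletion (a : A) : ‖p.toCompletion a‖ = p.toSeminorm a :=
  UniformSpace.Completion.norm_coe (E := p.Space) a

theorem toCompletion_add (a b : A) : p.toCompletion (a + b) = p.toCompletion a + p.toCompletion b :=
  UniformSpace.Completion.coe_add (α := p.Space) a b

theorem toCompletion_smul (c : ℂ) (a : A) : p.toCompletion (c • a) = c • p.toCompletion a :=
  UniformSpace.Completion.coe_smul (X := p.Space) c a

theorem toCompletion_zero : p.toCompletion 0 = 0 :=
  UniformSpace.Completion.coe_zero (α := p.Space)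

theorem denseRange_toCompletion : DenseRange p.toCompletion :=
  UniformSpace.Completion.denseRange_coe (α := p.Space)

theorem isDenseInducing_mk :
    IsDenseInducing ((↑) : p.Space → UniformSpace.Completion p.Space) :=
  UniformSpace.Completion.isDenseInducing_coe

/-- The product of the Hausdorff completion is the continuous extension of the product of `A`. -/
noncomputable instance : Mul p.HausdorffCompletion where
  mul x y := (p.isDenseInducing_mk.prodMap p.isDenseInducing_mk).extend
    (fun q : p.Space × p.Space => ((q.1 * q.2 : p.Space) : UniformSpace.Completion p.Space)) (x, y)

theorem toCompletion_mul (a b : A) : p.toCompletion (a * b) = p.toCompletion a * p.toCompletion b :=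
  ((p.isDenseInducing_mk.prodMap p.isDenseInducing_mk).extend_eq
    ((UniformSpace.Completion.continuous_coe p.Space).comp continuous_mul)
      ((a, b) : p.Space × p.Space)).symm

instance : ContinuousMul p.HausdorffCompletion where
  continuous_mul := by
    let m := (AddMonoidHom.mul : p.Space →+ p.Space →+ p.Space).compr₂
      UniformSpace.Completion.toCompl
    have : Continuous fun q : p.Space × p.Space => m q.1 q.2 :=
      (UniformSpace.Completion.continuous_coe p.Space).comp continuous_mul
    have di : IsDenseInducing
        (UniformSpace.Completion.toCompl : p.Space → UniformSpace.Completion p.Space) :=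
      UniformSpace.Completion.isDenseInducing_coe
    exact (di.extend_Z_bilin di this :)

noncomputable instance : NonUnitalNormedRing p.HausdorffCompletion :=
  { (inferInstance : NormedAddCommGroup p.HausdorffCompletion),
    (inferInstance : Mul p.HausdorffCompletion) with
    zero_mul := fun x => by
      refine p.denseRange_toCompletion.induction_on (p := fun x => 0 * x = 0) x
        (isClosed_eq (continuous_const.mul continuous_id) continuous_const) (fun a => ?_)
      rw [← toCompletion_zero, ← toCompletion_mul, zero_mul]
    mul_zero := fun x => by
      refine p.denseRange_toCompletion.induction_on (p := fun x => x * 0 = 0) x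
        (isClosed_eq (continuous_id.mul continuous_const) continuous_const) (fun a => ?_)
      rw [← toCompletion_zero, ← toCompletion_mul, mul_zero]
    mul_assoc := fun x y z => by
      refine p.denseRange_toCompletion.induction_on₃ (p := fun x y z => x * y * z = x * (y * z))
        (isClosed_eq
          ((continuous_fst.mul (continuous_fst.comp continuous_snd)).mul
            (continuous_snd.comp continuous_snd))
          (continuous_fst.mul ((continuous_fst.comp continuous_snd).mul
            (continuous_snd.comp continuous_snd)))) (fun a b c => ?_) x y z
      rw [← toCompletion_mul, ← toCompletion_mul, ← toCompletion_mul, ← toCompletion_mul,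
        mul_assoc]
    left_distrib := fun x y z => by
      refine p.denseRange_toCompletion.induction_on₃
        (p := fun x y z => x * (y + z) = x * y + x * z)
        (isClosed_eq
          (continuous_fst.mul ((continuous_fst.comp continuous_snd).add
            (continuous_snd.comp continuous_snd)))
          ((continuous_fst.mul (continuous_fst.comp continuous_snd)).add
            (continuous_fst.mul (continuous_snd.comp continuous_snd)))) (fun a b c => ?_) x y z
      rw [← toCompletion_add, ← toCompletion_mul, ← toCompletion_mul, ← toCompletion_mul,
        ← toCompletion_add, mul_add]
    right_distrib := fun x y z => by
      refine p.denseRange_toCompletion.induction_on₃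
        (p := fun x y z => (x + y) * z = x * z + y * z)
        (isClosed_eq
          ((continuous_fst.add (continuous_fst.comp continuous_snd)).mul
            (continuous_snd.comp continuous_snd))
          ((continuous_fst.mul (continuous_snd.comp continuous_snd)).add
            ((continuous_fst.comp continuous_snd).mul (continuous_snd.comp continuous_snd))))
        (fun a b c => ?_) x y z
      rw [← toCompletion_add, ← toCompletion_mul, ← toCompletion_mul, ← toCompletion_mul,
        ← toCompletion_add, add_mul]
    norm_mul_le := fun x y => by
      refine p.denseRange_toCompletion.induction_on₂ (p := fun x y => ‖x * y‖ ≤ ‖x‖ * ‖y‖)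
        (isClosed_le (continuous_fst.mul continuous_snd).norm
          (continuous_fst.norm.mul continuous_snd.norm)) (fun a b => ?_) x y
      rw [← toCompletion_mul, norm_toCompletion, norm_toCompletion, norm_toCompletion]
      exact p.mul_le' a b }

instance [IsScalarTower ℂ A A] : IsScalarTower ℂ p.HausdorffCompletion p.HausdorffCompletion where
  smul_assoc c x y := by
    refine p.denseRange_toCompletion.induction_on₂ (p := fun x y => (c • x) * y = c • (x * y))
      (isClosed_eq ((continuous_fst.const_smul c).mul continuous_snd)
        ((continuous_fst.mul continuous_snd).const_smul c)) (fun a b => ?_) x y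
    rw [← toCompletion_smul, ← toCompletion_mul, ← toCompletion_mul, ← toCompletion_smul,
      smul_mul_assoc]

instance [SMulCommClass ℂ A A] : SMulCommClass ℂ p.HausdorffCompletion p.HausdorffCompletion where
  smul_comm c x y := by
    refine p.denseRange_toCompletion.induction_on₂ (p := fun x y => c • (x * y) = x * (c • y))
      (isClosed_eq ((continuous_fst.mul continuous_snd).const_smul c)
        (continuous_fst.mul (continuous_snd.const_smul c))) (fun a b => ?_) x y
    rw [← toCompletion_smul, ← toCompletion_mul, ← toCompletion_mul, ← toCompletion_smul,
      mul_smul_comm]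

end AlgSeminorm

end HausdorffCompletion

/-! ### The seminorm induced by a class of representations -/

section UniversalSeminorm

open scoped Pointwise

variable {A : Type u} [NonUnitalRing A] [Module ℂ A]

/-- A class of algebra homomorphisms from `A` into the algebras of bounded operators on Hilbert
spaces. Hilbert spaces range over one universe. -/
abbrev RepClass (A : Type u) [NonUnitalRing A] [Module ℂ A] : Type (max u (w + 1)) :=
  ∀ (H : Type w) [NormedAddCommGroup H] [InnerProductSpace ℂ H] [CompleteSpace H],
    (A →ₙₐ[ℂ] (H →L[ℂ] H)) → Prop

/-- The set of all norms `‖π a‖`, where `π` ranges over the given class of representations. -/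
def RepClass.norms (R : RepClass.{u, w} A) (a : A) : Set ℝ :=
  {c | ∃ (H : Type w) (_ : NormedAddCommGroup H) (_ : InnerProductSpace ℂ H) (_ : CompleteSpace H)
    (π : A →ₙₐ[ℂ] (H →L[ℂ] H)), R H π ∧ c = ‖π a‖}

/-- The class is bounded at every element of `A`, so that the supremum below is a real number. -/
def RepClass.Bounded (R : RepClass.{u, w} A) : Prop := ∀ a, BddAbove (R.norms a)

/-- The seminorm `‖a‖₀ = sup ‖π a‖`, the supremum being over all `π` in the class. -/
noncomputable def RepClass.seminorm (R : RepClass.{u, w} A) (hR : R.Bounded) : AlgSeminorm A where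
  toFun a := sSup (R.norms a)
  map_zero' := by
    apply le_antisymm
    · apply Real.sSup_le _ le_rfl
      rintro c ⟨H, _, _, _, π, -, rfl⟩
      simp
    · apply Real.sSup_nonneg
      rintro c ⟨H, _, _, _, π, -, rfl⟩
      exact norm_nonneg _
  add_le' x y := by
    have hn : ∀ a, 0 ≤ sSup (R.norms a) := fun a => by
      apply Real.sSup_nonneg
      rintro c ⟨H, _, _, _, π, -, rfl⟩
      exact norm_nonneg _
    apply Real.sSup_le _ (add_nonneg (hn x) (hn y))
    rintro c ⟨H, _, _, _, π, hπ, rfl⟩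
    rw [map_add]
    exact (norm_add_le _ _).trans (add_le_add
      (le_csSup (hR x) ⟨H, _, _, _, π, hπ, rfl⟩) (le_csSup (hR y) ⟨H, _, _, _, π, hπ, rfl⟩))
  neg' x := by
    congr 1
    ext c
    simp only [RepClass.norms, map_neg, norm_neg]
  smul' k x := by
    have : R.norms (k • x) = ‖k‖ • R.norms x := by
      ext c
      constructor
      · rintro ⟨H, _, _, _, π, hπ, rfl⟩
        exact ⟨‖π x‖, ⟨H, _, _, _, π, hπ, rfl⟩, by simp [norm_smul]⟩
      · rintro ⟨_, ⟨H, _, _, _, π, hπ, rfl⟩, rfl⟩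
        exact ⟨H, _, _, _, π, hπ, by simp [norm_smul]⟩
    rw [this, Real.sSup_smul_of_nonneg (norm_nonneg k), smul_eq_mul]
  mul_le' x y := by
    have hn : ∀ a, 0 ≤ sSup (R.norms a) := fun a => by
      apply Real.sSup_nonneg
      rintro c ⟨H, _, _, _, π, -, rfl⟩
      exact norm_nonneg _
    apply Real.sSup_le _ (mul_nonneg (hn x) (hn y))
    rintro c ⟨H, _, _, _, π, hπ, rfl⟩
    rw [map_mul]
    exact (norm_mul_le _ _).trans (mul_le_mul
      (le_csSup (hR x) ⟨H, _, _, _, π, hπ, rfl⟩) (le_csSup (hR y) ⟨H, _, _, _, π, hπ, rfl⟩)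
      (norm_nonneg _) (hn x))

end UniversalSeminorm
/-! ### Restriction semigroups and their operator algebras -/

/-- A restriction semigroup `(S, E, lam, rho)`: here `E = proj` is a non-empty commutative
subsemigroup of `S` consisting of idempotents. -/
class RestrictionSemigroup (S : Type u) extends Semigroup S where
  proj : Subsemigroup S
  proj_nonempty : Nonempty proj
  proj_idem : ∀ e : proj, e * e = e
  proj_comm : ∀ e f : proj, e * f = f * e
  lam : S → proj
  rho : S → proj
  lam_proj : ∀ f : proj, lam f = f
  rho_proj : ∀ f : proj, rho f = f
  mul_lam : ∀ s, s * lam s = s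
  rho_mul : ∀ s, rho s * s = s
  lam_mul : ∀ s t, lam (s * t) = lam (lam s * t)
  mul_rho : ∀ s t, rho (s * t) = rho (s * rho t)
  proj_mul : ∀ (f : proj) (s : S), f * s = s * lam (f * s)
  mul_proj : ∀ (s : S) (f : proj), s * f = rho (s * f) * s

namespace RestrictionSemigroup

/-- The semilattice `E` of projections of a restriction semigroup. -/
abbrev Proj (S : Type u) [RestrictionSemigroup S] : Type u := ↥(proj : Subsemigroup S)

/-- A representation of a restriction semigroup on a Hilbert space: a semigroup homomorphism by
contractions, which takes projections to orthogonal projections. -/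
structure IsRepresentation {S : Type u} [RestrictionSemigroup S] {H : Type w}
    [NormedAddCommGroup H] [InnerProductSpace ℂ H] [CompleteSpace H]
    (σ : S →ₙ* (H →L[ℂ] H)) : Prop where
  norm_le_one : ∀ s, ‖σ s‖ ≤ 1
  adjoint_eq : ∀ e : Proj S, ContinuousLinearMap.adjoint (σ e) = σ e
  sq_eq : ∀ e : Proj S, σ e ^ 2 = σ e

/-- The class of all extensions to `ℂ[S]` of representations of `S`, on Hilbert spaces in the
  universe of `S`. Representations on larger Hilbert spaces give no other norms, because norms are
detected on closed invariant subspaces which are generated by one vector. -/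
def repClass (S : Type u) [RestrictionSemigroup S] : RepClass.{u, u} (MonoidAlgebra ℂ S) :=
  fun H _ _ _ π => ∃ σ : S →ₙ* (H →L[ℂ] H), IsRepresentation σ ∧ π = MonoidAlgebra.liftMagma ℂ σ

theorem repClass_bounded (S : Type u) [RestrictionSemigroup S] : (repClass S).Bounded := by
  intro a
  refine ⟨∑ s ∈ a.coeff.support, ‖a.coeff s‖, ?_⟩
  rintro c ⟨H, _, _, _, π, ⟨σ, hσ, rfl⟩, rfl⟩
  have h : MonoidAlgebra.liftMagma ℂ σ a = ∑ s ∈ a.coeff.support, a.coeff s • σ s := by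
    simp [MonoidAlgebra.liftMagma_apply_apply, Finsupp.sum]
  rw [h]
  refine norm_sum_le_of_le _ fun s _ => ?_
  rw [norm_smul]
  exact mul_le_of_le_one_right (norm_nonneg _) (hσ.norm_le_one s)

/-- The operator algebra `𝒜(S)` of a restriction semigroup `S`. -/
abbrev OperatorAlgebra (S : Type u) [RestrictionSemigroup S] : Type u :=
  ((repClass S).seminorm (repClass_bounded S)).HausdorffCompletion

/-- The image in `𝒜(S)` of an element of `ℂ[S]`. -/
noncomputable def toOperatorAlgebra {S : Type u} [RestrictionSemigroup S]
    (x : MonoidAlgebra ℂ S) : OperatorAlgebra S :=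
  ((repClass S).seminorm (repClass_bounded S)).toCompletion x

end RestrictionSemigroup
/-! ### Étale categories and their operator algebras -/

/-- `f ∈ C_c(V)` for a function `f` on the whole space: the restriction of `f` to `V` is continuous
with compact support, and `f` vanishes outside `V`. -/
def IsCc {M : Type v} [TopologicalSpace M] (V : Set M) (f : M → ℂ) : Prop :=
  (Continuous fun x : V => f x) ∧ (HasCompactSupport fun x : V => f x) ∧ ∀ x, x ∉ V → f x = 0

theorem isCc_iff {M : Type v} [TopologicalSpace M] {V : Set M} [T2Space V] {f : M → ℂ} :
    IsCc V f ↔ ContinuousOn f V ∧ ∃ K, K ⊆ V ∧ IsCompact K ∧ ∀ x, x ∉ K → f x = 0 := by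
  rw [continuousOn_iff_continuous_domRestrict]
  refine and_congr_right fun _ => ⟨fun ⟨h1, h2⟩ => ?_, fun ⟨K, hKV, hK, h⟩ => ⟨?_, ?_⟩⟩
  · refine ⟨Subtype.val '' tsupport (fun x : V => f x), by simp, h1.isCompact.image
      continuous_subtype_val, fun x hx => ?_⟩
    by_cases hxV : x ∈ V
    · by_contra h
      exact hx ⟨⟨x, hxV⟩, subset_tsupport _ h, rfl⟩
    · exact h2 x hxV
  · refine HasCompactSupport.intro (K := Subtype.val ⁻¹' K) ?_ fun x hx => h x hx
    rw [Topology.IsEmbedding.subtypeVal.isCompact_iff, Subtype.image_preimage_coe,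
      Set.inter_eq_right.2 hKV]
    exact hK
  · exact fun x hx => h x fun hxK => hx (hKV hxK)

/-- An étale category with space of objects `X` and space of morphisms `M`. The morphisms `x` and
`y` are composable if `d x = r y`, and then `comp x y _` is the composition `xy`. -/
structure EtaleCategory (X : Type u) (M : Type v) [TopologicalSpace X] [TopologicalSpace M] where
  d : M → X
  r : M → X
  unit : X → M
  comp : ∀ x y : M, d x = r y → M
  d_unit : ∀ x, d (unit x) = x
  r_unit : ∀ x, r (unit x) = x
  d_comp : ∀ x y h, d (comp x y h) = d y
  r_comp : ∀ x y h, r (comp x y h) = r x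
  unit_comp : ∀ x, comp (unit (r x)) x (d_unit (r x)) = x
  comp_unit : ∀ x, comp x (unit (d x)) (r_unit (d x)).symm = x
  assoc : ∀ x y z (h : d x = r y) (h' : d y = r z),
    comp (comp x y h) z ((d_comp x y h).trans h') = comp x (comp y z h') (h.trans (r_comp y z h').symm)
  locallyCompactSpace : LocallyCompactSpace X
  t2Space : T2Space X
  isLocalHomeomorph_d : IsLocalHomeomorph d
  isLocalHomeomorph_r : IsLocalHomeomorph r
  isEmbedding_unit : Topology.IsEmbedding unit
  continuous_comp : Continuous fun p : {p : M × M // d p.1 = r p.2} => comp p.1.1 p.1.2 p.2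

namespace EtaleCategory

variable {X : Type u} {M : Type v} [TopologicalSpace X] [TopologicalSpace M]
  (C : EtaleCategory X M)

/-- Bisections: open sets of morphisms on which the source and the range map are injective. -/
structure IsBisection (U : Set M) : Prop where
  isOpen : IsOpen U
  injOn_d : Set.InjOn C.d U
  injOn_r : Set.InjOn C.r U

/-- The vector space `𝒜₀(C)` spanned by the spaces `C_c(V)`, for `V` open and Hausdorff. -/
def A0 (_C : EtaleCategory X M) : Submodule ℂ (M → ℂ) :=
  Submodule.span ℂ {f | ∃ V : Set M, IsOpen V ∧ T2Space V ∧ IsCc V f}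

/-- The convolution product: the sum of `f x * g y` over all composable pairs with `xy = z`. -/
noncomputable def conv (f g : M → ℂ) (z : M) : ℂ :=
  ∑ᶠ p : {p : M × M // ∃ h : C.d p.1 = C.r p.2, C.comp p.1 p.2 h = z}, f p.1.1 * g p.1.2

/-- The product of two sets of morphisms. -/
def setMul (U V : Set M) : Set M :=
  {z | ∃ x ∈ U, ∃ y ∈ V, ∃ h : C.d x = C.r y, C.comp x y h = z}

theorem locallyCompactSpace_mor (C : EtaleCategory X M) : LocallyCompactSpace M := by
  have := C.locallyCompactSpace
  let _ : ChartedSpace X M :=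
    { atlas := Set.univ
      chartAt := fun x => (C.isLocalHomeomorph_d x).choose
      mem_chart_source := fun x => (C.isLocalHomeomorph_d x).choose_spec.1
      chart_mem_atlas := fun x => trivial }
  exact ChartedSpace.locallyCompactSpace X M

theorem IsBisection.mono {C : EtaleCategory X M} {U V : Set M} (hU : C.IsBisection U)
    (hV : IsOpen V) (hVU : V ⊆ U) : C.IsBisection V :=
  ⟨hV, hU.injOn_d.mono hVU, hU.injOn_r.mono hVU⟩

theorem IsBisection.t2Space {C : EtaleCategory X M} {U : Set M} (hU : C.IsBisection U) :
    T2Space U := by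
  have := C.t2Space
  exact T2Space.of_injective_continuous (f := fun x : U => C.d x) hU.injOn_d.injective
    (C.isLocalHomeomorph_d.continuous.comp continuous_subtype_val)

theorem IsBisection.isOpenEmbedding_d {C : EtaleCategory X M} {U : Set M} (hU : C.IsBisection U) :
    Topology.IsOpenEmbedding (fun x : U => C.d x) :=
  (C.isLocalHomeomorph_d.comp
    hU.isOpen.isOpenEmbedding_subtypeVal.isLocalHomeomorph).isOpenEmbedding_of_injective
      hU.injOn_d.injective

theorem exists_isBisection (x : M) {W : Set M} (hW : IsOpen W) (hx : x ∈ W) :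
    ∃ U, C.IsBisection U ∧ x ∈ U ∧ U ⊆ W := by
  obtain ⟨e, hxe, he⟩ := C.isLocalHomeomorph_d x
  obtain ⟨e', hxe', he'⟩ := C.isLocalHomeomorph_r x
  refine ⟨e.source ∩ e'.source ∩ W, ⟨(e.open_source.inter e'.open_source).inter hW, ?_, ?_⟩,
    ⟨⟨hxe, hxe'⟩, hx⟩, fun y hy => hy.2⟩
  · rw [he]
    exact e.injOn.mono fun y hy => hy.1.1
  · rw [he']
    exact e'.injOn.mono fun y hy => hy.1.2

theorem IsBisection.isCc_mem_A0 {C : EtaleCategory X M} {U : Set M} (hU : C.IsBisection U)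
    {f : M → ℂ} (hf : IsCc U f) : f ∈ C.A0 :=
  Submodule.subset_span ⟨U, hU.isOpen, hU.t2Space, hf⟩

/-- `𝒜₀(C)` is spanned by the functions in `C_c(U)`, where `U` is a bisection. -/
theorem A0_eq_span_bisection :
    C.A0 = Submodule.span ℂ {f | ∃ U : Set M, C.IsBisection U ∧ IsCc U f} := by
  apply le_antisymm
  · refine Submodule.span_le.2 ?_
    rintro f ⟨V, hV, hT2, hf⟩
    obtain ⟨hcont, K, hKV, hK, hzero⟩ := isCc_iff.1 hf
    have := C.locallyCompactSpace_mor
    have : LocallyCompactSpace V := hV.locallyCompactSpace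
    choose! U hU hxU hUV using fun x (hx : x ∈ V) => C.exists_isBisection x hV hx
    have hK' : IsCompact ((↑) ⁻¹' K : Set V) := by
      rw [Topology.IsEmbedding.subtypeVal.isCompact_iff, Subtype.image_preimage_coe,
        Set.inter_eq_right.2 hKV]
      exact hK
    obtain ⟨t, ht⟩ := hK'.elim_finite_subcover (fun x : V => (Subtype.val ⁻¹' U x : Set V))
      (fun x => (hU x x.2).isOpen.preimage continuous_subtype_val)
      (fun x _ => Set.mem_iUnion.2 ⟨x, show (x : M) ∈ U x from hxU x x.2⟩)
    let s : Fin t.card → Set V := fun i => (↑) ⁻¹' (U (t.equivFin.symm i : V))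
    have hts : ((↑) ⁻¹' K : Set V) ⊆ ⋃ i, s i := by
      intro x hx
      obtain ⟨y, hy, hxy⟩ := Set.mem_iUnion₂.1 (ht hx)
      refine Set.mem_iUnion.2 ⟨t.equivFin ⟨y, hy⟩, ?_⟩
      simpa [s] using hxy
    obtain ⟨η, hη1, hη2, -, hη4⟩ := exists_continuous_sum_one_of_isOpen_isCompact
      (fun i => (hU _ (t.equivFin.symm i : V).2).isOpen.preimage continuous_subtype_val) hK' hts
    classical
    let F : Fin t.card → M → ℂ := fun i x => if h : x ∈ V then (η i ⟨x, h⟩ : ℂ) * f x else 0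
    have hsum : f = ∑ i, F i := by
      ext x
      rw [Finset.sum_apply]
      by_cases h : x ∈ V
      · simp only [F, h, dif_pos, ← Finset.sum_mul]
        by_cases hx : x ∈ K
        · have h1 := hη2 (show (⟨x, h⟩ : V) ∈ ((↑) ⁻¹' K : Set V) from hx)
          simp only [Finset.sum_apply, Pi.one_apply] at h1
          rw [← Complex.ofReal_sum, h1]
          simp
        · simp [hzero x hx]
      · simp [F, h, hf.2.2 x h]
    rw [hsum]
    refine Submodule.sum_mem _ fun i _ => Submodule.subset_span
      ⟨U (t.equivFin.symm i : V), hU _ (t.equivFin.symm i : V).2, ?_⟩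
    have := (hU _ (t.equivFin.symm i : V).2).t2Space
    refine isCc_iff.2 ⟨?_, Subtype.val '' tsupport (η i), ?_, (hη4 i).isCompact.image
      continuous_subtype_val, ?_⟩
    · refine ContinuousOn.mono ?_ (hUV _ (t.equivFin.symm i : V).2)
      rw [continuousOn_iff_continuous_domRestrict]
      have h1 : Continuous fun x : V => (η i x : ℂ) * f x :=
        (Complex.continuous_ofReal.comp (η i).continuous).mul hf.1
      refine h1.congr fun x => ?_
      simp [F]
    · rintro _ ⟨x, hx, rfl⟩
      exact hη1 i hx
    · intro x hx
      by_cases h : x ∈ V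
      · have : η i ⟨x, h⟩ = 0 := by
          by_contra h0
          exact hx ⟨⟨x, h⟩, subset_tsupport _ h0, rfl⟩
        simp [F, this]
      · simp [F, h]
  · refine Submodule.span_le.2 ?_
    rintro f ⟨U, hU, hf⟩
    exact hU.isCc_mem_A0 hf

theorem A0_induction {P : ∀ f : M → ℂ, f ∈ C.A0 → Prop}
    (hb : ∀ U f (hU : C.IsBisection U) (hf : IsCc U f), P f (hU.isCc_mem_A0 hf))
    (h0 : P 0 (zero_mem _))
    (hadd : ∀ f g (hf : f ∈ C.A0) (hg : g ∈ C.A0), P f hf → P g hg → P (f + g) (add_mem hf hg))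
    (hsmul : ∀ (c : ℂ) f (hf : f ∈ C.A0), P f hf → P (c • f) (Submodule.smul_mem _ c hf))
    {f : M → ℂ} (hf : f ∈ C.A0) : P f hf := by
  have e := C.A0_eq_span_bisection
  have hf' := hf
  rw [e] at hf'
  induction hf' using Submodule.span_induction with
  | mem f hf' =>
    obtain ⟨U, hU, hf'⟩ := hf'
    exact hb U f hU hf'
  | zero => exact h0
  | add f g hf1 hg1 h1 h2 =>
    exact hadd f g (e ▸ hf1) (e ▸ hg1) (h1 (e ▸ hf1)) (h2 (e ▸ hg1))
  | smul c f hf1 h1 => exact hsmul c f (e ▸ hf1) (h1 (e ▸ hf1))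

/-- The product of two bisections is a bisection. -/
theorem injOn_setMul {U V : Set M} (hU : C.IsBisection U) (hV : C.IsBisection V) :
    Set.InjOn C.d (C.setMul U V) ∧ Set.InjOn C.r (C.setMul U V) := by
  constructor
  · rintro _ ⟨x, hx, y, hy, h, rfl⟩ _ ⟨x', hx', y', hy', h', rfl⟩ e
    rw [C.d_comp, C.d_comp] at e
    obtain rfl := hV.injOn_d hy hy' e
    obtain rfl := hU.injOn_d hx hx' (h.trans h'.symm)
    rfl
  · rintro _ ⟨x, hx, y, hy, h, rfl⟩ _ ⟨x', hx', y', hy', h', rfl⟩ e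
    rw [C.r_comp, C.r_comp] at e
    obtain rfl := hU.injOn_r hx hx' e
    obtain rfl := hV.injOn_r hy hy' (h.symm.trans h')
    rfl

theorem conv_comp {U V : Set M} (hU : Set.InjOn C.r U) (hV : Set.InjOn C.d V) {f g : M → ℂ}
    (hf : ∀ x, x ∉ U → f x = 0) (hg : ∀ x, x ∉ V → g x = 0) {x y : M} (hx : x ∈ U) (hy : y ∈ V)
    (h : C.d x = C.r y) : C.conv f g (C.comp x y h) = f x * g y := by
  unfold conv
  rw [finsum_eq_single _ ⟨(x, y), h, rfl⟩]
  rintro ⟨⟨x', y'⟩, h', e⟩ hne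
  by_contra h0
  have hx' : x' ∈ U := by
    by_contra hc
    exact h0 (by simp [hf x' hc])
  have hy' : y' ∈ V := by
    by_contra hc
    exact h0 (by simp [hg y' hc])
  have e1 := congrArg C.r e
  have e2 := congrArg C.d e
  simp only [C.r_comp, C.d_comp] at e1 e2
  apply hne
  obtain rfl := hU hx' hx e1
  obtain rfl := hV hy' hy e2
  rfl

theorem conv_eq_zero {U V : Set M} {f g : M → ℂ}
    (hf : ∀ x, x ∉ U → f x = 0) (hg : ∀ x, x ∉ V → g x = 0) {z : M} (hz : z ∉ C.setMul U V) :
    C.conv f g z = 0 := by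
  unfold conv
  rw [← finsum_zero (α := {p : M × M // ∃ h : C.d p.1 = C.r p.2, C.comp p.1 p.2 h = z})]
  congr 1
  ext ⟨⟨x, y⟩, h, e⟩
  by_cases hx : x ∈ U
  · by_cases hy : y ∈ V
    · exact absurd ⟨x, hx, y, hy, h, e⟩ hz
    · simp [hg y hy]
  · simp [hf x hx]

theorem conv_isCc {U V : Set M} (hU : C.IsBisection U) (hV : C.IsBisection V) {f g : M → ℂ}
    (hf : IsCc U f) (hg : IsCc V g) :
    C.IsBisection (C.setMul U V) ∧ IsCc (C.setMul U V) (C.conv f g) := by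
  have := C.t2Space
  have := hU.t2Space
  have := hV.t2Space
  obtain ⟨hfc, K, hKU, hK, hfK⟩ := isCc_iff.1 hf
  obtain ⟨hgc, L, hLV, hL, hgL⟩ := isCc_iff.1 hg
  let φ := hU.isOpenEmbedding_d.isEmbedding.toHomeomorph
  let T : Set M := V ∩ C.r ⁻¹' Set.range (fun x : U => C.d x)
  have hT : IsOpen T := hV.isOpen.inter
    (hU.isOpenEmbedding_d.isOpen_range.preimage C.isLocalHomeomorph_r.continuous)
  let a : T → U := fun y => φ.symm ⟨C.r y, y.2.2⟩
  have ha : Continuous a := φ.symm.continuous.comp (Continuous.subtype_mk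
    (C.isLocalHomeomorph_r.continuous.comp continuous_subtype_val) _)
  have hda : ∀ y, C.d (a y) = C.r y := fun y =>
    congrArg Subtype.val (φ.apply_symm_apply ⟨C.r y, y.2.2⟩)
  let c : T → M := fun y => C.comp (a y) y (hda y)
  have hc : Continuous c := C.continuous_comp.comp (Continuous.subtype_mk
    ((continuous_subtype_val.comp ha).prodMk continuous_subtype_val) hda)
  have hdc : C.d ∘ c = fun y : T => C.d y := by
    ext y
    exact C.d_comp _ _ _
  have hce : Topology.IsOpenEmbedding c := by
    refine C.isLocalHomeomorph_d.isOpenEmbedding_of_comp ?_ hc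
    rw [hdc]
    exact (hV.mono hT Set.inter_subset_left).isOpenEmbedding_d
  have hrange : Set.range c = C.setMul U V := by
    ext z
    constructor
    · rintro ⟨y, rfl⟩
      exact ⟨a y, (a y).2, y, y.2.1, hda y, rfl⟩
    · rintro ⟨x, hx, y, hy, h, rfl⟩
      have hyT : y ∈ T := ⟨hy, ⟨x, hx⟩, h⟩
      refine ⟨⟨y, hyT⟩, ?_⟩
      have : (a ⟨y, hyT⟩ : M) = x := hU.injOn_d (a _).2 hx ((hda ⟨y, hyT⟩).trans h.symm)
      simp only [c, this]
  have hb : C.IsBisection (C.setMul U V) :=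
    ⟨hrange ▸ hce.isOpen_range, (C.injOn_setMul hU hV).1, (C.injOn_setMul hU hV).2⟩
  refine ⟨hb, ?_⟩
  have := hb.t2Space
  refine isCc_iff.2 ⟨?_, C.setMul K L, ?_, ?_, ?_⟩
  · rw [← hrange]
    rintro _ ⟨y, rfl⟩
    refine ContinuousAt.continuousWithinAt ?_
    rw [← hce.continuousAt_iff]
    have h1 : C.conv f g ∘ c = fun y : T => f (a y) * g y := by
      ext y
      exact C.conv_comp hU.injOn_r hV.injOn_d hf.2.2 hg.2.2 (a y).2 y.2.1 (hda y)
    rw [h1]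
    refine Continuous.continuousAt ((hf.1.comp ha).mul ?_)
    exact hgc.comp_continuous continuous_subtype_val fun y => y.2.1
  · rintro _ ⟨x, hx, y, hy, h, rfl⟩
    exact ⟨x, hKU hx, y, hLV hy, h, rfl⟩
  · have hcl : IsClosed {p : M × M | C.d p.1 = C.r p.2} :=
      isClosed_eq (C.isLocalHomeomorph_d.continuous.comp continuous_fst)
        (C.isLocalHomeomorph_r.continuous.comp continuous_snd)
    have h1 : IsCompact ((↑) ⁻¹' (K ×ˢ L) : Set {p : M × M // C.d p.1 = C.r p.2}) :=
      hcl.isClosedEmbedding_subtypeVal.isCompact_preimage (hK.prod hL)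
    convert h1.image C.continuous_comp using 1
    ext z
    constructor
    · rintro ⟨x, hx, y, hy, h, rfl⟩
      exact ⟨⟨(x, y), h⟩, ⟨hx, hy⟩, rfl⟩
    · rintro ⟨⟨⟨x, y⟩, h⟩, ⟨hx, hy⟩, rfl⟩
      exact ⟨x, hx, y, hy, h, rfl⟩
  · intro z hz
    exact C.conv_eq_zero hfK hgL hz
theorem finite_fiber {f : M → ℂ} (hf : f ∈ C.A0) (u : X) :
    {x | C.r x = u ∧ f x ≠ 0}.Finite ∧ {x | C.d x = u ∧ f x ≠ 0}.Finite := by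
  induction hf using C.A0_induction with
  | hb U f hU hf =>
    constructor
    · refine Set.Subsingleton.finite fun x hx y hy => ?_
      exact hU.injOn_r (not_imp_comm.1 (hf.2.2 x) hx.2) (not_imp_comm.1 (hf.2.2 y) hy.2)
        (hx.1.trans hy.1.symm)
    · refine Set.Subsingleton.finite fun x hx y hy => ?_
      exact hU.injOn_d (not_imp_comm.1 (hf.2.2 x) hx.2) (not_imp_comm.1 (hf.2.2 y) hy.2)
        (hx.1.trans hy.1.symm)
  | h0 => simp
  | hadd f g hf hg h1 h2 =>
    constructor
    · refine (h1.1.union h2.1).subset ?_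
      rintro x ⟨hx, hx'⟩
      by_contra hc
      simp_all
    · refine (h1.2.union h2.2).subset ?_
      rintro x ⟨hx, hx'⟩
      by_contra hc
      simp_all
  | hsmul c f hf h1 =>
    constructor
    · refine h1.1.subset ?_
      rintro x ⟨hx, hx'⟩
      exact ⟨hx, right_ne_zero_of_mul hx'⟩
    · refine h1.2.subset ?_
      rintro x ⟨hx, hx'⟩
      exact ⟨hx, right_ne_zero_of_mul hx'⟩

theorem finite_support {f g : M → ℂ} (hf : f ∈ C.A0) (hg : g ∈ C.A0) (z : M) :
    (Function.support fun p : {p : M × M // ∃ h : C.d p.1 = C.r p.2, C.comp p.1 p.2 h = z} =>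
      f p.1.1 * g p.1.2).Finite := by
  refine Set.Finite.of_finite_image (f := Subtype.val) ?_ Subtype.val_injective.injOn
  refine ((C.finite_fiber hf (C.r z)).1.prod (C.finite_fiber hg (C.d z)).2).subset ?_
  rintro _ ⟨⟨⟨x, y⟩, h, rfl⟩, hp, rfl⟩
  exact ⟨⟨(C.r_comp _ _ _).symm, left_ne_zero_of_mul hp⟩,
    ⟨(C.d_comp _ _ _).symm, right_ne_zero_of_mul hp⟩⟩

theorem conv_add_left {f f' g : M → ℂ} (hf : f ∈ C.A0) (hf' : f' ∈ C.A0) (hg : g ∈ C.A0) :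
    C.conv (f + f') g = C.conv f g + C.conv f' g := by
  ext z
  rw [Pi.add_apply]
  unfold conv
  rw [← finsum_add_distrib (C.finite_support hf hg z) (C.finite_support hf' hg z)]
  simp only [Pi.add_apply, add_mul]

theorem conv_add_right {f g g' : M → ℂ} (hf : f ∈ C.A0) (hg : g ∈ C.A0) (hg' : g' ∈ C.A0) :
    C.conv f (g + g') = C.conv f g + C.conv f g' := by
  ext z
  rw [Pi.add_apply]
  unfold conv
  rw [← finsum_add_distrib (C.finite_support hf hg z) (C.finite_support hf hg' z)]
  simp only [Pi.add_apply, mul_add]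

theorem conv_smul_left (c : ℂ) (f g : M → ℂ) : C.conv (c • f) g = c • C.conv f g := by
  ext z
  rw [Pi.smul_apply]
  unfold conv
  rw [smul_finsum]
  simp only [Pi.smul_apply, smul_mul_assoc]

theorem conv_smul_right (c : ℂ) (f g : M → ℂ) : C.conv f (c • g) = c • C.conv f g := by
  ext z
  rw [Pi.smul_apply]
  unfold conv
  rw [smul_finsum]
  simp only [Pi.smul_apply, mul_smul_comm]

theorem conv_zero_left (g : M → ℂ) : C.conv 0 g = 0 := by
  ext z
  simp [conv]

theorem conv_zero_right (f : M → ℂ) : C.conv f 0 = 0 := by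
  ext z
  simp [conv]

theorem conv_mem_A0 {f g : M → ℂ} (hf : f ∈ C.A0) (hg : g ∈ C.A0) : C.conv f g ∈ C.A0 := by
  induction hf using C.A0_induction with
  | hb U f hU hf =>
    induction hg using C.A0_induction with
    | hb V g hV hg =>
      have h := C.conv_isCc hU hV hf hg
      exact h.1.isCc_mem_A0 h.2
    | h0 => rw [conv_zero_right]; exact zero_mem _
    | hadd g g' hg hg' h1 h2 =>
      rw [C.conv_add_right (hU.isCc_mem_A0 hf) hg hg']
      exact add_mem h1 h2
    | hsmul c g hg h1 => rw [conv_smul_right]; exact Submodule.smul_mem _ _ h1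
  | h0 => rw [conv_zero_left]; exact zero_mem _
  | hadd f f' hf hf' h1 h2 => rw [C.conv_add_left hf hf' hg]; exact add_mem h1 h2
  | hsmul c f hf h1 => rw [conv_smul_left]; exact Submodule.smul_mem _ _ h1

theorem conv_assoc_bisection {U V W : Set M} (hU : C.IsBisection U) (hV : C.IsBisection V)
    (hW : C.IsBisection W) {f g h : M → ℂ} (hf : ∀ x, x ∉ U → f x = 0)
    (hg : ∀ x, x ∉ V → g x = 0) (hh : ∀ x, x ∉ W → h x = 0) :
    C.conv (C.conv f g) h = C.conv f (C.conv g h) := by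
  have hUV := C.injOn_setMul hU hV
  have hVW := C.injOn_setMul hV hW
  have hfg : ∀ x, x ∉ C.setMul U V → C.conv f g x = 0 := fun x hx => C.conv_eq_zero hf hg hx
  have hgh : ∀ x, x ∉ C.setMul V W → C.conv g h x = 0 := fun x hx => C.conv_eq_zero hg hh hx
  ext z
  by_cases hz : z ∈ C.setMul (C.setMul U V) W
  · obtain ⟨_, ⟨x, hx, y, hy, e, rfl⟩, w, hw, e', rfl⟩ := hz
    have e'' : C.d y = C.r w := (C.d_comp x y e).symm.trans e'
    rw [C.conv_comp hUV.2 hW.injOn_d hfg hh ⟨x, hx, y, hy, e, rfl⟩ hw,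
      C.conv_comp hU.injOn_r hV.injOn_d hf hg hx hy, C.assoc x y w e e'',
      C.conv_comp hU.injOn_r hVW.1 hf hgh hx ⟨y, hy, w, hw, e'', rfl⟩,
      C.conv_comp hV.injOn_r hW.injOn_d hg hh hy hw, mul_assoc]
  · rw [C.conv_eq_zero hfg hh hz, C.conv_eq_zero hf hgh]
    rintro ⟨x, hx, _, ⟨y, hy, w, hw, e', rfl⟩, e, rfl⟩
    have e'' : C.d x = C.r y := e.trans (C.r_comp _ _ _)
    exact hz ⟨_, ⟨x, hx, y, hy, e'', rfl⟩, w, hw, (C.d_comp _ _ _).trans e', C.assoc x y w e'' e'⟩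

theorem conv_assoc {f g h : M → ℂ} (hf : f ∈ C.A0) (hg : g ∈ C.A0) (hh : h ∈ C.A0) :
    C.conv (C.conv f g) h = C.conv f (C.conv g h) := by
  induction hf using C.A0_induction with
  | hb U f hU hf =>
    have hf' := hU.isCc_mem_A0 hf
    induction hg using C.A0_induction with
    | hb V g hV hg =>
      have hg' := hV.isCc_mem_A0 hg
      induction hh using C.A0_induction with
      | hb W h hW hh => exact C.conv_assoc_bisection hU hV hW hf.2.2 hg.2.2 hh.2.2
      | h0 => simp only [conv_zero_right]
      | hadd h h' hh hh' h1 h2 =>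
        rw [C.conv_add_right (C.conv_mem_A0 hf' hg') hh hh', C.conv_add_right hg' hh hh',
          C.conv_add_right hf' (C.conv_mem_A0 hg' hh) (C.conv_mem_A0 hg' hh'), h1, h2]
      | hsmul c h hh h1 => simp only [conv_smul_right, h1]
    | h0 => simp only [conv_zero_right, conv_zero_left]
    | hadd g g' hg hg' h1 h2 =>
      rw [C.conv_add_right hf' hg hg', C.conv_add_left hg hg' hh,
        C.conv_add_left (C.conv_mem_A0 hf' hg) (C.conv_mem_A0 hf' hg') hh,
        C.conv_add_right hf' (C.conv_mem_A0 hg hh) (C.conv_mem_A0 hg' hh), h1, h2]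
    | hsmul c g hg h1 => simp only [conv_smul_right, conv_smul_left, h1]
  | h0 => simp only [conv_zero_left]
  | hadd f f' hf hf' h1 h2 =>
    rw [C.conv_add_left hf hf' hg, C.conv_add_left hf hf' (C.conv_mem_A0 hg hh),
      C.conv_add_left (C.conv_mem_A0 hf hg) (C.conv_mem_A0 hf' hg) hh, h1, h2]
  | hsmul c f hf h1 => simp only [conv_smul_left, h1]

/-- `𝒜₀(C)` is an algebra under convolution. -/
noncomputable instance : Mul C.A0 := ⟨fun f g => ⟨C.conv f g, C.conv_mem_A0 f.2 g.2⟩⟩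

noncomputable instance : NonUnitalRing C.A0 :=
  { (inferInstance : AddCommGroup C.A0), (inferInstance : Mul C.A0) with
    zero_mul := fun f => Subtype.ext (C.conv_zero_left f)
    mul_zero := fun f => Subtype.ext (C.conv_zero_right f)
    mul_assoc := fun f g h => Subtype.ext (C.conv_assoc f.2 g.2 h.2)
    left_distrib := fun f g h => Subtype.ext (C.conv_add_right f.2 g.2 h.2)
    right_distrib := fun f g h => Subtype.ext (C.conv_add_left f.2 g.2 h.2) }

instance : IsScalarTower ℂ C.A0 C.A0 :=
  ⟨fun c f g => Subtype.ext (C.conv_smul_left c f g)⟩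

instance : SMulCommClass ℂ C.A0 C.A0 :=
  ⟨fun c f g => Subtype.ext (C.conv_smul_right c f g).symm⟩

/-- A representation of `𝒜₀(C)` on a Hilbert space: an algebra homomorphism which is contractive
for the supremum norm on `C_c(U)` for each bisection `U`, and which takes complex conjugates to
adjoints on `C_c` of the (open) set of units. -/
structure IsRepresentation {H : Type w} [NormedAddCommGroup H] [InnerProductSpace ℂ H]
    [CompleteSpace H] (π : C.A0 →ₙₐ[ℂ] (H →L[ℂ] H)) : Prop where
  norm_le : ∀ U : Set M, C.IsBisection U → ∀ f : C.A0, IsCc U f.1 → ‖π f‖ ≤ ⨆ x, ‖f.1 x‖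
  map_conj : ∀ f g : C.A0, IsCc (Set.range C.unit) f.1 → (∀ x, g.1 x = starRingEnd ℂ (f.1 x)) →
    π g = ContinuousLinearMap.adjoint (π f)

/-- The class of all representations of `𝒜₀(C)`, on Hilbert spaces in the universe of the space of
morphisms. Representations on larger Hilbert spaces give no other norms, because norms are
detected on closed invariant subspaces which are generated by one vector. -/
def repClass : RepClass.{v, v} C.A0 := fun _ _ _ _ π => C.IsRepresentation π

theorem repClass_bounded : C.repClass.Bounded := by
  rintro ⟨f, hf⟩
  have key : ∃ B : ℝ, ∀ (H : Type v) [NormedAddCommGroup H] [InnerProductSpace ℂ H]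
      [CompleteSpace H] (π : C.A0 →ₙₐ[ℂ] (H →L[ℂ] H)), C.IsRepresentation π →
      ∀ g : C.A0, g.1 = f → ‖π g‖ ≤ B := by
    induction hf using C.A0_induction with
    | hb U f hU hf =>
      refine ⟨⨆ x, ‖f x‖, ?_⟩
      rintro H _ _ _ π hπ g rfl
      exact hπ.norm_le U hU g hf
    | h0 =>
      refine ⟨0, ?_⟩
      rintro H _ _ _ π hπ g hg
      obtain rfl : g = 0 := Subtype.ext hg
      simp
    | hadd f f' hf hf' h1 h2 =>
      obtain ⟨B, hB⟩ := h1
      obtain ⟨B', hB'⟩ := h2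
      refine ⟨B + B', ?_⟩
      rintro H _ _ _ π hπ g hg
      obtain rfl : g = ⟨f, hf⟩ + ⟨f', hf'⟩ := Subtype.ext hg
      rw [map_add]
      exact (norm_add_le _ _).trans (add_le_add (hB H π hπ _ rfl) (hB' H π hπ _ rfl))
    | hsmul c f hf h1 =>
      obtain ⟨B, hB⟩ := h1
      refine ⟨‖c‖ * B, ?_⟩
      rintro H _ _ _ π hπ g hg
      obtain rfl : g = c • ⟨f, hf⟩ := Subtype.ext hg
      rw [map_smul, norm_smul]
      exact mul_le_mul_of_nonneg_left (hB H π hπ _ rfl) (norm_nonneg c)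
  obtain ⟨B, hB⟩ := key
  refine ⟨B, ?_⟩
  rintro c ⟨H, _, _, _, π, hπ, rfl⟩
  exact hB H π hπ _ rfl

/-- The operator algebra `𝒜(C)` of an étale category `C`. -/
abbrev OperatorAlgebra : Type v := (C.repClass.seminorm C.repClass_bounded).HausdorffCompletion

/-- The image in `𝒜(C)` of an element of `𝒜₀(C)`. -/
noncomputable def toOperatorAlgebra (f : C.A0) : C.OperatorAlgebra :=
  (C.repClass.seminorm C.repClass_bounded).toCompletion f

end EtaleCategory
/-! ### Étale actions and their categories of germs -/

/-- An étale action of a restriction semigroup `S` on a space `X`: a homomorphism of restriction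
semigroups from `S` to the partial bijections of `X`, such that each `θ_s` is a homeomorphism
between open sets and the domains `D_e` of the projections cover `X`. The relation `≈` says that
two partial maps have the same domain and agree on it, and `f.trans g` is `f` followed by `g`. -/
structure EtaleAction (S : Type u) [RestrictionSemigroup S] (X : Type v) [TopologicalSpace X] where
  map : S → OpenPartialHomeomorph X X
  map_mul : ∀ s t, map (s * t) ≈ (map t).trans (map s)
  map_lam : ∀ s, map (RestrictionSemigroup.lam s) ≈ (map s).trans (map s).symm
  map_rho : ∀ s, map (RestrictionSemigroup.rho s) ≈ (map s).symm.trans (map s)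
  cover : ∀ x, ∃ e : RestrictionSemigroup.Proj S, x ∈ (map e).source

namespace EtaleAction

open RestrictionSemigroup

variable {S : Type u} [RestrictionSemigroup S] {X : Type v} [TopologicalSpace X]
  (θ : EtaleAction S X)

/-- The domain `D_s` of `θ_s`, which is also the domain of `θ_{lam s}`. -/
def dom (s : S) : Set X := (θ.map s).source

theorem dom_lam (s : S) : θ.dom (lam s) = θ.dom s := by
  have h := (θ.map_lam s).1
  rw [OpenPartialHomeomorph.trans_source] at h
  refine h.trans (Set.inter_eq_left.2 fun x hx => ?_)
  exact (θ.map s).map_source hx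

theorem mem_dom_mul {s t : S} {x : X} :
    x ∈ θ.dom (s * t) ↔ x ∈ θ.dom t ∧ θ.map t x ∈ θ.dom s := by
  have h := (θ.map_mul s t).1
  simp [dom, h]

theorem map_mul_apply {s t : S} {x : X} (hx : x ∈ θ.dom (s * t)) :
    θ.map (s * t) x = θ.map s (θ.map t x) :=
  (θ.map_mul s t).2 hx

theorem map_proj_apply (e : Proj S) {x : X} (hx : x ∈ θ.dom e) : θ.map e x = x := by
  have h := θ.map_lam (e : S)
  rw [lam_proj] at h
  have h2 := h.2 hx
  rw [h2]
  exact (θ.map e).left_inv hx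

theorem mem_dom_mul_proj {s : S} {e : Proj S} {x : X} :
    x ∈ θ.dom (s * e) ↔ x ∈ θ.dom e ∧ x ∈ θ.dom s := by
  rw [mem_dom_mul]
  exact and_congr_right fun h => by rw [θ.map_proj_apply e h]

theorem map_mul_proj_apply {s : S} {e : Proj S} {x : X} (hs : x ∈ θ.dom s) (he : x ∈ θ.dom e) :
    θ.map (s * e) x = θ.map s x := by
  rw [θ.map_mul_apply (θ.mem_dom_mul_proj.2 ⟨he, hs⟩), θ.map_proj_apply e he]

/-- The set of all pairs `(s, x)` with `x ∈ D_s`. -/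
def PreGerm : Type (max u v) := {p : S × X // p.2 ∈ θ.dom p.1}

/-- `(s, x) ∼ (t, y)` if `x = y` and `s f = t f` for a projection `f` with `x ∈ D_f`. -/
def germSetoid : Setoid θ.PreGerm where
  r p q := p.1.2 = q.1.2 ∧ ∃ f : Proj S, p.1.2 ∈ θ.dom f ∧ p.1.1 * (f : S) = q.1.1 * (f : S)
  iseqv :=
    { refl := fun p => ⟨rfl, (θ.cover p.1.2).imp fun _ h => ⟨h, rfl⟩⟩
      symm := fun ⟨h, f, hf, e⟩ => ⟨h.symm, f, h ▸ hf, e.symm⟩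
      trans := by
        rintro p q r ⟨h, e, he, h1⟩ ⟨h', f, hf, h2⟩
        refine ⟨h.trans h', e * f, ?_, ?_⟩
        · rw [MulMemClass.coe_mul, mem_dom_mul_proj]
          exact ⟨h ▸ hf, he⟩
        · rw [MulMemClass.coe_mul, ← mul_assoc, h1, mul_assoc, ← MulMemClass.coe_mul,
            proj_comm e f, MulMemClass.coe_mul, ← mul_assoc, h2, mul_assoc] }

/-- The set of germs of the action `θ`: the morphisms of the category of germs. -/
def Germ : Type (max u v) := Quotient θ.germSetoid

variable {θ}

/-- The germ `[s, x]` of `s` at the point `x ∈ D_s`. -/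
def germ (s : S) (x : X) (h : x ∈ θ.dom s) : θ.Germ := Quotient.mk θ.germSetoid ⟨(s, x), h⟩

theorem germ_eq {s t : S} {x y : X} {hx : x ∈ θ.dom s} {hy : y ∈ θ.dom t} :
    germ s x hx = germ t y hy ↔
      x = y ∧ ∃ f : Proj S, x ∈ θ.dom f ∧ s * (f : S) = t * (f : S) :=
  ⟨fun h => Quotient.exact h, fun h => Quotient.sound (s := θ.germSetoid) h⟩

theorem exists_germ (q : θ.Germ) : ∃ s x h, q = germ s x h := by
  induction q using Quotient.inductionOn with
  | h p => exact ⟨p.1.1, p.1.2, p.2, rfl⟩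

/-- The source of a germ: `d [s, x] = x`. -/
def germSource : θ.Germ → X := Quotient.lift (fun p => p.1.2) fun _ _ h => h.1

/-- The range of a germ: `r [s, x] = θ_s(x)`. -/
def germRange : θ.Germ → X := Quotient.lift (fun p => θ.map p.1.1 p.1.2) (by
  rintro ⟨⟨s, x⟩, hs⟩ ⟨⟨t, y⟩, ht⟩ ⟨h, f, hf, e⟩
  obtain rfl : x = y := h
  change θ.map s x = θ.map t x
  rw [← θ.map_mul_proj_apply hs hf, ← θ.map_mul_proj_apply ht hf]
  exact congrArg (fun z => θ.map z x) e)

theorem germSource_germ (s : S) (x : X) (h : x ∈ θ.dom s) : germSource (germ s x h) = x := rfl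

theorem germRange_germ (s : S) (x : X) (h : x ∈ θ.dom s) : germRange (germ s x h) = θ.map s x := rfl

theorem germ_mul_eq {s s' t t' : S} {x y : X} (hs : x ∈ θ.dom s) (hs' : x ∈ θ.dom s')
    (ht : y ∈ θ.dom t) (ht' : y ∈ θ.dom t') (hx : x = θ.map t y)
    (e1 : germ s x hs = germ s' x hs') (e2 : germ t y ht = germ t' y ht')
    (h : y ∈ θ.dom (s * t)) (h' : y ∈ θ.dom (s' * t')) :
    germ (s * t) y h = germ (s' * t') y h' := by
  obtain ⟨-, f, hf, ef⟩ := germ_eq.1 e1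
  obtain ⟨-, e, he, ee⟩ := germ_eq.1 e2
  have a1 : (rho (t * e) : S) * t = t * e := (mul_proj t e).symm
  have a2 : (rho (t * e) : S) * t' = t * e := by
    rw [ee]
    exact (mul_proj t' e).symm
  have b1 : (f : S) * (t * e) = (f : S) * t * e := (mul_assoc _ _ _).symm
  have c1 : s * t * (lam ((f : S) * t) : S) * e = s' * t' * (lam ((f : S) * t') : S) * e := by
    rw [mul_assoc s, mul_assoc s', ← proj_mul, ← proj_mul, mul_assoc s, mul_assoc s',
      mul_assoc (f : S), mul_assoc (f : S), ← ee, ← mul_assoc s, ← mul_assoc s', ef]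
  have c2 : (lam ((f : S) * t) : S) * e = (lam ((f : S) * t') : S) * e := by
    have k : ∀ z : S, ((lam ((f : S) * z) : S) * e) = lam ((f : S) * (z * e)) := by
      intro z
      rw [← mul_assoc, lam_mul (_ * z) (e : S), ← MulMemClass.coe_mul, lam_proj]
    rw [k, k, ee]
  refine germ_eq.2 ⟨rfl, lam ((f : S) * t) * e, ?_, ?_⟩
  · rw [MulMemClass.coe_mul, mem_dom_mul_proj, dom_lam, mem_dom_mul]
    exact ⟨he, ht, hx ▸ hf⟩
  · rw [MulMemClass.coe_mul]
    conv_rhs => rw [c2]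
    rw [← mul_assoc, ← mul_assoc, c1]

theorem germComp_aux (q q' : θ.Germ) (h : germSource q = germRange q') :
    q'.out.1.2 ∈ θ.dom (q.out.1.1 * q'.out.1.1) := by
  rw [mem_dom_mul]
  refine ⟨q'.out.2, ?_⟩
  have h1 : germSource q = q.out.1.2 := by
    conv_lhs => rw [← Quotient.out_eq q]
    rfl
  have h2 : germRange q' = θ.map q'.out.1.1 q'.out.1.2 := by
    conv_lhs => rw [← Quotient.out_eq q']
    rfl
  rw [← h2, ← h, h1]
  exact q.out.2

/-- The composition of germs, `[s, θ_t(y)] [t, y] = [s t, y]`. It is computed here from chosen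
representatives; `germComp_germ` shows that the formula holds for all representatives. -/
noncomputable def germComp (q q' : θ.Germ) (h : germSource q = germRange q') : θ.Germ :=
  germ (q.out.1.1 * q'.out.1.1) q'.out.1.2 (germComp_aux q q' h)

theorem germComp_germ (s t : S) (x y : X) (hs : x ∈ θ.dom s) (ht : y ∈ θ.dom t)
    (h : x = θ.map t y) :
    germComp (germ s x hs) (germ t y ht) h =
      germ (s * t) y (θ.mem_dom_mul.2 ⟨ht, h ▸ hs⟩) := by
  have key : ∀ (a b : θ.PreGerm) (haux : b.1.2 ∈ θ.dom (a.1.1 * b.1.1)),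
      germ a.1.1 a.1.2 a.2 = germ s x hs → germ b.1.1 b.1.2 b.2 = germ t y ht →
        germ (a.1.1 * b.1.1) b.1.2 haux = germ (s * t) y (θ.mem_dom_mul.2 ⟨ht, h ▸ hs⟩) := by
    rintro ⟨⟨s', x'⟩, hs'⟩ ⟨⟨t', y'⟩, ht'⟩ haux o1 o2
    obtain rfl : x' = x := (germ_eq.1 o1).1
    obtain rfl : y' = y := (germ_eq.1 o2).1
    refine germ_mul_eq hs' hs ht' ht ?_ o1 o2 _ _
    exact h.trans (congrArg germRange o2).symm
  exact key _ _ _ (Quotient.out_eq (germ s x hs)) (Quotient.out_eq (germ t y ht))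

/-- The unit map: `x ↦ [e, x]`, where `e` is any projection with `x ∈ D_e`. -/
noncomputable def germUnit (x : X) : θ.Germ :=
  germ ((θ.cover x).choose : S) x (θ.cover x).choose_spec

theorem germUnit_eq (e : Proj S) {x : X} (h : x ∈ θ.dom e) : germUnit x = germ (e : S) x h := by
  have h' : x ∈ θ.dom ((θ.cover x).choose : S) := (θ.cover x).choose_spec
  refine germ_eq.2 ⟨rfl, (θ.cover x).choose * e, ?_, ?_⟩
  · rw [MulMemClass.coe_mul, mem_dom_mul_proj]
    exact ⟨h, h'⟩
  · rw [← MulMemClass.coe_mul, ← MulMemClass.coe_mul, ← mul_assoc, proj_idem,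
      proj_comm (θ.cover x).choose e, ← mul_assoc, proj_idem]

/-- The set `Θ(s, U)` of all germs `[s, x]` with `x ∈ U`. -/
def germSet (s : S) (U : Set X) : Set θ.Germ := {q | ∃ x h, x ∈ U ∧ q = germ s x h}

/-- The topology on the set of germs is generated by the sets `Θ(s, U)`, for `U ⊆ D_s` open. -/
instance : TopologicalSpace θ.Germ :=
  TopologicalSpace.generateFrom {W | ∃ s U, IsOpen U ∧ U ⊆ θ.dom s ∧ W = germSet s U}

theorem isOpen_dom (s : S) : IsOpen (θ.dom s) := (θ.map s).open_source

/-- The local section `x ↦ [s, x]` on `D_s`. -/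
def germSection (s : S) (x : θ.dom s) : θ.Germ := germ s x x.2

theorem germSection_injective (s : S) : Function.Injective (germSection (θ := θ) s) :=
  fun _ _ h => Subtype.ext (germ_eq.1 h).1

theorem isOpenEmbedding_germSection (s : S) :
    Topology.IsOpenEmbedding (germSection (θ := θ) s) := by
  refine Topology.IsOpenEmbedding.of_continuous_injective_isOpenMap ?_ (germSection_injective s) ?_
  · refine continuous_generateFrom_iff.2 ?_
    rintro _ ⟨t, U, hU, hUt, rfl⟩
    have : germSection (θ := θ) s ⁻¹' germSet t U = Subtype.val ⁻¹'
        ⋃ (f : Proj S) (_ : s * (f : S) = t * (f : S)), θ.dom (f : S) ∩ U := by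
      ext x
      simp only [Set.mem_preimage, Set.mem_iUnion, germSet, Set.mem_ofPred_eq, germSection]
      constructor
      · rintro ⟨y, hy, hyU, e⟩
        obtain ⟨e1, f, hf, ef⟩ := germ_eq.1 e
        exact ⟨f, ef, hf, e1 ▸ hyU⟩
      · rintro ⟨f, ef, hf, hxU⟩
        exact ⟨x, hUt hxU, hxU, germ_eq.2 ⟨rfl, f, hf, ef⟩⟩
    rw [this]
    refine IsOpen.preimage continuous_subtype_val ?_
    exact isOpen_iUnion fun f => isOpen_iUnion fun _ => (isOpen_dom _).inter hU
  · intro U hU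
    have : germSection s '' U = germSet (θ := θ) s (Subtype.val '' U) := by
      ext q
      constructor
      · rintro ⟨x, hx, rfl⟩
        exact ⟨x, x.2, ⟨x, hx, rfl⟩, rfl⟩
      · rintro ⟨_, h, ⟨x, hx, rfl⟩, rfl⟩
        exact ⟨x, hx, rfl⟩
    rw [this]
    refine TopologicalSpace.isOpen_generateFrom_of_mem ⟨s, _, ?_, ?_, rfl⟩
    · exact (isOpen_dom s).isOpenMap_subtype_val U hU
    · rintro _ ⟨x, -, rfl⟩
      exact x.2

theorem isLocalHomeomorph_of_germSection {f : θ.Germ → X}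
    (hf : ∀ s, IsLocalHomeomorph (f ∘ germSection s)) : IsLocalHomeomorph f := by
  refine IsLocalHomeomorph.mk f fun q => ?_
  obtain ⟨s, x, hx, rfl⟩ := exists_germ q
  have : Nonempty (θ.dom s) := ⟨⟨x, hx⟩⟩
  obtain ⟨e, hxe, he⟩ := hf s ⟨x, hx⟩
  let ι := (isOpenEmbedding_germSection (θ := θ) s).toOpenPartialHomeomorph
  have hι : ∀ z, ι.symm (germSection s z) = z := fun z =>
    ι.left_inv (show z ∈ ι.source from trivial)
  refine ⟨ι.symm.trans e, ?_, ?_⟩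
  · rw [OpenPartialHomeomorph.trans_source]
    refine ⟨?_, ?_⟩
    · change germ s x hx ∈ ι.target
      exact ι.map_source (x := ⟨x, hx⟩) trivial
    · change ι.symm (germSection s ⟨x, hx⟩) ∈ e.source
      rw [hι]
      exact hxe
  · intro q hq
    rw [OpenPartialHomeomorph.trans_source] at hq
    have hq1 : q ∈ ι.target := hq.1
    have : q = germSection s (ι.symm q) := (ι.right_inv hq1).symm
    change f q = e (ι.symm q)
    rw [← he]
    exact congrArg f this

theorem isLocalHomeomorph_germSource : IsLocalHomeomorph (germSource (θ := θ)) :=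
  isLocalHomeomorph_of_germSection fun s =>
    (isOpen_dom s).isOpenEmbedding_subtypeVal.isLocalHomeomorph

theorem isLocalHomeomorph_germRange : IsLocalHomeomorph (germRange (θ := θ)) := by
  refine isLocalHomeomorph_of_germSection fun s => ?_
  exact (θ.map s).isOpenEmbedding_restrict.isLocalHomeomorph

theorem isEmbedding_germUnit : Topology.IsEmbedding (germUnit (θ := θ)) := by
  refine Topology.IsEmbedding.of_leftInverse (f := germSource) (fun x => rfl)
    isLocalHomeomorph_germSource.continuous ?_
  refine continuous_iff_continuousAt.2 fun x => ?_
  obtain ⟨e, he⟩ := θ.cover x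
  refine ContinuousOn.continuousAt (s := θ.dom (e : S)) ?_ ((isOpen_dom (e : S)).mem_nhds he)
  rw [continuousOn_iff_continuous_domRestrict]
  refine (isOpenEmbedding_germSection (θ := θ) (e : S)).continuous.congr fun y => ?_
  exact (germUnit_eq e y.2).symm

theorem continuous_germComp :
    Continuous fun p : {p : θ.Germ × θ.Germ // germSource p.1 = germRange p.2} =>
      germComp p.1.1 p.1.2 p.2 := by
  refine continuous_iff_continuousAt.2 ?_
  rintro ⟨⟨q, q'⟩, h⟩
  obtain ⟨s, x, hx, rfl⟩ := exists_germ q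
  obtain ⟨t, y, hy, rfl⟩ := exists_germ q'
  let N : Set {p : θ.Germ × θ.Germ // germSource p.1 = germRange p.2} :=
    {p | p.1.1 ∈ Set.range (germSection (θ := θ) s) ∧ p.1.2 ∈ Set.range (germSection (θ := θ) t)}
  have hN : IsOpen N :=
    ((isOpenEmbedding_germSection s).isOpen_range.preimage
      (continuous_fst.comp continuous_subtype_val)).inter
    ((isOpenEmbedding_germSection t).isOpen_range.preimage
      (continuous_snd.comp continuous_subtype_val))
  refine ContinuousOn.continuousAt (s := N) ?_
    (hN.mem_nhds ⟨⟨⟨x, hx⟩, rfl⟩, ⟨⟨y, hy⟩, rfl⟩⟩)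
  rw [continuousOn_iff_continuous_domRestrict]
  have hmem : ∀ p : N, germSource p.1.1.2 ∈ θ.dom (s * t) := by
    rintro ⟨⟨⟨q, q'⟩, h⟩, ⟨a, ha⟩, ⟨b, hb⟩⟩
    obtain rfl : germSection s a = q := ha
    obtain rfl : germSection t b = q' := hb
    refine θ.mem_dom_mul.2 ⟨b.2, ?_⟩
    have h' : (a : X) = θ.map t b := h
    exact h' ▸ a.2
  have hc : Continuous fun p : N => germSection (θ := θ) (s * t) ⟨germSource p.1.1.2, hmem p⟩ :=
    (isOpenEmbedding_germSection (s * t)).continuous.comp (Continuous.subtype_mk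
      (isLocalHomeomorph_germSource.continuous.comp (continuous_snd.comp
        (continuous_subtype_val.comp continuous_subtype_val))) hmem)
  refine hc.congr ?_
  rintro ⟨⟨⟨q, q'⟩, h⟩, ⟨a, ha⟩, ⟨b, hb⟩⟩
  obtain rfl : germSection s a = q := ha
  obtain rfl : germSection t b = q' := hb
  exact (germComp_germ s t (a : X) (b : X) a.2 b.2 h).symm

variable (θ)

/-- The category of germs `C(θ, S, X)` of an étale action of `S` on a locally compact Hausdorff
space `X`. -/
noncomputable def germCategory [LocallyCompactSpace X] [T2Space X] : EtaleCategory X θ.Germ where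
  d := germSource
  r := germRange
  unit := germUnit
  comp := germComp
  d_unit _ := rfl
  r_unit x := θ.map_proj_apply _ (θ.cover x).choose_spec
  d_comp q q' h := by
    obtain ⟨s, x, hx, rfl⟩ := exists_germ q
    obtain ⟨t, y, hy, rfl⟩ := exists_germ q'
    rw [germComp_germ s t x y hx hy h]
    rfl
  r_comp q q' h := by
    obtain ⟨s, x, hx, rfl⟩ := exists_germ q
    obtain ⟨t, y, hy, rfl⟩ := exists_germ q'
    have h' : x = θ.map t y := h
    rw [germComp_germ s t x y hx hy h, germRange_germ, germRange_germ,
      θ.map_mul_apply (θ.mem_dom_mul.2 ⟨hy, h' ▸ hx⟩), h']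
  unit_comp q := by
    obtain ⟨s, x, hx, rfl⟩ := exists_germ q
    have hr : θ.map s x ∈ θ.dom ((rho s : Proj S) : S) := by
      have h := (θ.map_rho s).1
      rw [OpenPartialHomeomorph.trans_source] at h
      rw [dom, h]
      refine ⟨(θ.map s).map_source hx, ?_⟩
      rw [Set.mem_preimage, OpenPartialHomeomorph.left_inv _ hx]
      exact hx
    have key : ∀ (q : θ.Germ) (hq : germSource q = germRange (germ s x hx)),
        q = germ (rho s : S) (θ.map s x) hr → germComp q (germ s x hx) hq = germ s x hx := by
      rintro _ hq rfl
      rw [germComp_germ _ s _ x hr hx rfl]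
      refine germ_eq.2 ⟨rfl, lam s, ?_, ?_⟩
      · rw [dom_lam]
        exact hx
      · rw [rho_mul]
    exact key _ _ (germUnit_eq (rho s) hr)
  comp_unit q := by
    obtain ⟨s, x, hx, rfl⟩ := exists_germ q
    have hl : x ∈ θ.dom ((lam s : Proj S) : S) := by
      rw [dom_lam]
      exact hx
    have key : ∀ (q : θ.Germ) (hq : germSource (germ s x hx) = germRange q),
        q = germ (lam s : S) x hl → germComp (germ s x hx) q hq = germ s x hx := by
      rintro _ hq rfl
      rw [germComp_germ s _ x x hx hl hq]
      refine germ_eq.2 ⟨rfl, lam s, hl, ?_⟩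
      rw [mul_lam, mul_lam]
    exact key _ _ (germUnit_eq (lam s) hl)
  assoc q q' q'' h h' := by
    obtain ⟨s, x, hx, rfl⟩ := exists_germ q
    obtain ⟨t, y, hy, rfl⟩ := exists_germ q'
    obtain ⟨w, z, hz, rfl⟩ := exists_germ q''
    have e1 := germComp_germ s t x y hx hy h
    have e2 := germComp_germ t w y z hy hz h'
    have h1 : x = θ.map t y := h
    have h2 : y = θ.map w z := h'
    have hst : y ∈ θ.dom (s * t) := θ.mem_dom_mul.2 ⟨hy, h1 ▸ hx⟩
    have htw : z ∈ θ.dom (t * w) := θ.mem_dom_mul.2 ⟨hz, h2 ▸ hy⟩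
    have k1 : ∀ (q : θ.Germ) (hq : germSource q = germRange (germ w z hz)),
        q = germ (s * t) y hst → germComp q (germ w z hz) hq =
          germ (s * t * w) z (θ.mem_dom_mul.2 ⟨hz, h2 ▸ hst⟩) := by
      rintro _ hq rfl
      exact germComp_germ _ _ _ _ _ _ hq
    have hx' : x = θ.map (t * w) z := by rw [θ.map_mul_apply htw, ← h2, ← h1]
    have k2 : ∀ (q : θ.Germ) (hq : germSource (germ s x hx) = germRange q),
        q = germ (t * w) z htw → germComp (germ s x hx) q hq =
          germ (s * (t * w)) z (θ.mem_dom_mul.2 ⟨htw, hx' ▸ hx⟩) := by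
      rintro _ hq rfl
      exact germComp_germ _ _ _ _ _ _ hq
    rw [k1 _ _ e1, k2 _ _ e2]
    exact germ_eq.2 ⟨rfl, lam w, by rw [dom_lam]; exact hz, by rw [mul_assoc s t w]⟩
  locallyCompactSpace := inferInstance
  t2Space := inferInstance
  isLocalHomeomorph_d := isLocalHomeomorph_germSource
  isLocalHomeomorph_r := isLocalHomeomorph_germRange
  isEmbedding_unit := isEmbedding_germUnit
  continuous_comp := continuous_germComp

theorem indicator_mem_A0 [LocallyCompactSpace X] [T2Space X] {s : S} (hs : IsCompact (θ.dom s)) :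
    Set.indicator (germSet (θ := θ) s (θ.dom s)) 1 ∈ θ.germCategory.A0 := by
  have hrange : germSet (θ := θ) s (θ.dom s) = Set.range (germSection (θ := θ) s) := by
    ext q
    constructor
    · rintro ⟨x, h, -, rfl⟩
      exact ⟨⟨x, h⟩, rfl⟩
    · rintro ⟨x, rfl⟩
      exact ⟨x, x.2, x.2, rfl⟩
  have ho : IsOpen (germSet (θ := θ) s (θ.dom s)) := hrange ▸ (isOpenEmbedding_germSection s).isOpen_range
  have hT2 : T2Space (germSet (θ := θ) s (θ.dom s)) := by
    refine T2Space.of_injective_continuous (f := fun q : germSet (θ := θ) s (θ.dom s) => germSource q.1) ?_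
      (isLocalHomeomorph_germSource.continuous.comp continuous_subtype_val)
    intro a b e
    obtain ⟨x, hx, -, ha⟩ := a.2
    obtain ⟨y, hy, -, hb⟩ := b.2
    have e' : germSource a.1 = germSource b.1 := e
    rw [ha, hb] at e'
    obtain rfl : x = y := e'
    exact Subtype.ext (ha.trans hb.symm)
  refine Submodule.subset_span ⟨_, ho, hT2, isCc_iff.2 ⟨?_, _, subset_rfl, ?_, ?_⟩⟩
  · exact continuousOn_const.congr fun q hq => Set.indicator_of_mem hq _
  · rw [hrange]
    have := isCompact_iff_compactSpace.1 hs
    exact isCompact_range (isOpenEmbedding_germSection s).continuous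
  · exact fun q hq => Set.indicator_of_notMem hq _

end EtaleAction
/-! ### The spectrum of the projections and the canonical action -/

/-- The spectrum `Ê` of a semilattice `E`: the space of all non-zero multiplicative maps from `E`
to `{0, 1}`, with the topology of pointwise convergence. -/
abbrev SemilatticeSpectrum (E : Type u) [Mul E] : Type u :=
  {φ : E → Bool // (∀ e f, φ (e * f) = (φ e && φ f)) ∧ ∃ e, φ e = true}

namespace SemilatticeSpectrum

variable {E : Type u} [Mul E]

instance : CoeFun (SemilatticeSpectrum E) fun _ => E → Bool := ⟨Subtype.val⟩

theorem continuous_eval (e : E) : Continuous fun φ : SemilatticeSpectrum E => φ e :=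
  (continuous_apply e).comp continuous_subtype_val

theorem isOpen_eval (e : E) : IsOpen {φ : SemilatticeSpectrum E | φ e = true} :=
  (isOpen_discrete {true}).preimage (continuous_eval e)

theorem isCompact_eval (e : E) : IsCompact {φ : SemilatticeSpectrum E | φ e = true} := by
  refine Topology.IsEmbedding.subtypeVal.isCompact_iff.2 ?_
  have : (Subtype.val '' {φ : SemilatticeSpectrum E | φ e = true}) =
      {φ : E → Bool | ∀ a b, φ (a * b) = (φ a && φ b)} ∩ {φ | φ e = true} := by
    ext φ
    constructor
    · rintro ⟨ψ, h, rfl⟩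
      exact ⟨ψ.2.1, h⟩
    · rintro ⟨h, h'⟩
      exact ⟨⟨φ, h, e, h'⟩, h', rfl⟩
  rw [this]
  refine IsClosed.isCompact (IsClosed.inter ?_ ?_)
  · have : {φ : E → Bool | ∀ a b, φ (a * b) = (φ a && φ b)} =
        ⋂ a, ⋂ b, {φ : E → Bool | φ (a * b) = (φ a && φ b)} := by
      ext φ
      simp
    rw [this]
    refine isClosed_iInter fun a => isClosed_iInter fun b => isClosed_eq (continuous_apply _) ?_
    have h : Continuous fun p : Bool × Bool => (p.1 && p.2) := continuous_of_discreteTopology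
    have h' : Continuous fun φ : E → Bool => (φ a, φ b) :=
      (continuous_apply a).prodMk (continuous_apply b)
    exact h.comp h'
  · exact isClosed_eq (continuous_apply e) continuous_const

instance : LocallyCompactSpace (SemilatticeSpectrum E) := by
  have : WeaklyLocallyCompactSpace (SemilatticeSpectrum E) :=
    ⟨fun φ => φ.2.2.elim fun e he => ⟨_, isCompact_eval e, (isOpen_eval e).mem_nhds he⟩⟩
  infer_instance

end SemilatticeSpectrum

namespace RestrictionSemigroup

variable {S : Type u} [RestrictionSemigroup S]

theorem lam_mul_proj (s : S) (e : Proj S) : lam (s * (e : S)) = lam s * e := by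
  rw [lam_mul, ← MulMemClass.coe_mul, lam_proj]

theorem rho_proj_mul (s : S) (e : Proj S) : rho ((e : S) * s) = e * rho s := by
  rw [mul_rho, ← MulMemClass.coe_mul, rho_proj]

theorem lam_proj_mul_mul (s : S) (e f : Proj S) :
    lam (((e * f : Proj S) : S) * s) = lam ((e : S) * s) * lam ((f : S) * s) := by
  rw [MulMemClass.coe_mul, mul_assoc, proj_mul f s, ← mul_assoc, lam_mul_proj,
    ← proj_mul]

theorem rho_mul_proj_mul (s : S) (e f : Proj S) :
    rho (s * ((e * f : Proj S) : S)) = rho (s * (e : S)) * rho (s * (f : S)) := by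
  rw [proj_comm e f, MulMemClass.coe_mul, ← mul_assoc, mul_proj s f, mul_assoc, rho_proj_mul,
    proj_comm, ← mul_proj]

theorem lam_proj_mul_mul_lam (s : S) (e : Proj S) :
    lam ((e : S) * s) * lam s = lam ((e : S) * s) := by
  rw [← lam_mul_proj, mul_assoc, mul_lam]

theorem rho_mul_proj_mul_rho (s : S) (e : Proj S) :
    rho (s * (e : S)) * rho s = rho (s * (e : S)) := by
  rw [proj_comm, ← rho_proj_mul, ← mul_assoc, rho_mul]

theorem lam_rho_mul (s : S) (e : Proj S) :
    lam ((rho (s * (e : S)) : S) * s) = lam s * e := by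
  rw [← mul_proj, lam_mul_proj]

theorem rho_mul_lam (s : S) (e : Proj S) :
    rho (s * (lam ((e : S) * s) : S)) = e * rho s := by
  rw [← proj_mul, rho_proj_mul]

/-- The semicharacter `θ_s(φ) : f ↦ φ(lam (f s))`, for `φ(lam s) = 1`. -/
def pushChar (s : S) (φ : SemilatticeSpectrum (Proj S)) (h : φ (lam s) = true) :
    SemilatticeSpectrum (Proj S) :=
  ⟨fun f => φ (lam ((f : S) * s)),
    fun e f => by simp only [lam_proj_mul_mul, φ.2.1], rho s, by simp only [rho_mul, h]⟩

/-- The semicharacter `θ_s⁻¹(φ) : f ↦ φ(rho (s f))`, for `φ(rho s) = 1`. -/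
def pullChar (s : S) (φ : SemilatticeSpectrum (Proj S)) (h : φ (rho s) = true) :
    SemilatticeSpectrum (Proj S) :=
  ⟨fun f => φ (rho (s * (f : S))),
    fun e f => by simp only [rho_mul_proj_mul, φ.2.1], lam s, by simp only [mul_lam, h]⟩

open Classical in
/-- The homeomorphism `θ_s` from `{φ | φ(lam s) = 1}` to `{φ | φ(rho s) = 1}` which is given by
`θ_s(φ)(f) = φ(lam (f s))`. Its values outside of its domain are immaterial. -/
noncomputable def canonicalMap (s : S) :
    OpenPartialHomeomorph (SemilatticeSpectrum (Proj S)) (SemilatticeSpectrum (Proj S)) where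
  toFun φ := if h : φ (lam s) = true then pushChar s φ h else φ
  invFun φ := if h : φ (rho s) = true then pullChar s φ h else φ
  source := {φ | φ (lam s) = true}
  target := {φ | φ (rho s) = true}
  map_source' φ h := by
    have h : φ (lam s) = true := h
    rw [dif_pos h]
    change φ (lam ((rho s : S) * s)) = true
    rw [rho_mul, h]
  map_target' φ h := by
    have h : φ (rho s) = true := h
    rw [dif_pos h]
    change φ (rho (s * (lam s : S))) = true
    rw [mul_lam, h]
  left_inv' φ h := by
    have h : φ (lam s) = true := h
    have h' : pushChar s φ h (rho s) = true := by
      change φ (lam ((rho s : S) * s)) = true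
      rw [rho_mul, h]
    simp only [dif_pos h]
    rw [dif_pos h']
    refine Subtype.ext (funext fun e => ?_)
    change φ (lam ((rho (s * (e : S)) : S) * s)) = φ e
    rw [lam_rho_mul, φ.2.1, h, Bool.true_and]
  right_inv' φ h := by
    have h : φ (rho s) = true := h
    have h' : pullChar s φ h (lam s) = true := by
      change φ (rho (s * (lam s : S))) = true
      rw [mul_lam, h]
    simp only [dif_pos h]
    rw [dif_pos h']
    refine Subtype.ext (funext fun e => ?_)
    change φ (rho (s * (lam ((e : S) * s) : S))) = φ e
    rw [rho_mul_lam, φ.2.1, h, Bool.and_true]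
  open_source := SemilatticeSpectrum.isOpen_eval _
  open_target := SemilatticeSpectrum.isOpen_eval _
  continuousOn_toFun := by
    rw [continuousOn_iff_continuous_domRestrict]
    have h : Continuous fun φ : {φ : SemilatticeSpectrum (Proj S) | φ (lam s) = true} =>
        pushChar s φ.1 φ.2 :=
      Continuous.subtype_mk (continuous_pi fun f =>
        (SemilatticeSpectrum.continuous_eval _).comp continuous_subtype_val) _
    exact h.congr fun φ => (dif_pos φ.2).symm
  continuousOn_invFun := by
    rw [continuousOn_iff_continuous_domRestrict]
    have h : Continuous fun φ : {φ : SemilatticeSpectrum (Proj S) | φ (rho s) = true} =>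
        pullChar s φ.1 φ.2 :=
      Continuous.subtype_mk (continuous_pi fun f =>
        (SemilatticeSpectrum.continuous_eval _).comp continuous_subtype_val) _
    exact h.congr fun φ => (dif_pos φ.2).symm

theorem mem_canonicalMap_source {s : S} {φ : SemilatticeSpectrum (Proj S)} :
    φ ∈ (canonicalMap s).source ↔ φ (lam s) = true := Iff.rfl

theorem canonicalMap_apply {s : S} {φ : SemilatticeSpectrum (Proj S)} (h : φ (lam s) = true)
    (f : Proj S) : canonicalMap s φ f = φ (lam ((f : S) * s)) := by
  have : canonicalMap s φ = pushChar s φ h := dif_pos h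
  rw [this]
  rfl

theorem canonicalMap_proj_apply {e : Proj S} {φ : SemilatticeSpectrum (Proj S)}
    (h : φ e = true) : canonicalMap (e : S) φ = φ := by
  refine Subtype.ext (funext fun f => ?_)
  rw [canonicalMap_apply (by rw [lam_proj, h]), ← MulMemClass.coe_mul, lam_proj, φ.2.1, h,
    Bool.and_true]

variable (S)

/-- The canonical action of a restriction semigroup on the spectrum of its projections. -/
noncomputable def canonicalAction : EtaleAction S (SemilatticeSpectrum (Proj S)) where
  map := canonicalMap
  map_mul s t := by
    have key : ∀ φ : SemilatticeSpectrum (Proj S), φ (lam t) = true →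
        canonicalMap t φ (lam s) = φ (lam (s * t)) := fun φ h => by
      rw [canonicalMap_apply h, ← lam_mul]
    have key2 : ∀ φ : SemilatticeSpectrum (Proj S), φ (lam (s * t)) = true →
        φ (lam t) = true := fun φ h => by
      have e : lam (s * t) * lam t = lam (s * t) := by rw [← lam_mul_proj, mul_assoc, mul_lam]
      rw [← e, φ.2.1, Bool.and_eq_true] at h
      exact h.2
    refine ⟨?_, fun φ h => ?_⟩
    · ext φ
      rw [OpenPartialHomeomorph.trans_source]
      simp only [Set.mem_inter_iff, Set.mem_preimage, mem_canonicalMap_source]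
      exact ⟨fun h => ⟨key2 φ h, (key φ (key2 φ h)).trans h⟩, fun h => (key φ h.1).symm.trans h.2⟩
    · have h : φ (lam (s * t)) = true := h
      have h1 := key2 φ h
      refine Subtype.ext (funext fun f => ?_)
      rw [OpenPartialHomeomorph.trans_apply, canonicalMap_apply h,
        canonicalMap_apply ((key φ h1).trans h), canonicalMap_apply h1, ← lam_mul, mul_assoc]
  map_lam s := by
    refine Setoid.trans (b := OpenPartialHomeomorph.ofSet _ (canonicalMap s).open_source) ?_
      (Setoid.symm (OpenPartialHomeomorph.self_trans_symm _))
    refine ⟨?_, fun φ h => ?_⟩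
    · ext φ
      change φ (lam (lam s : S)) = true ↔ φ (lam s) = true
      rw [lam_proj]
    · have h : φ (lam (lam s : S)) = true := h
      rw [lam_proj] at h
      exact canonicalMap_proj_apply h
  map_rho s := by
    refine Setoid.trans (b := OpenPartialHomeomorph.ofSet _ (canonicalMap s).open_target) ?_
      (Setoid.symm (OpenPartialHomeomorph.symm_trans_self _))
    refine ⟨?_, fun φ h => ?_⟩
    · ext φ
      change φ (lam (rho s : S)) = true ↔ φ (rho s) = true
      rw [lam_proj]
    · have h : φ (lam (rho s : S)) = true := h
      rw [lam_proj] at h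
      exact canonicalMap_proj_apply h
  cover φ := by
    obtain ⟨e, he⟩ := φ.2.2
    refine ⟨e, ?_⟩
    change φ (lam (e : S)) = true
    rw [lam_proj, he]

variable {S}

theorem isCompact_canonicalAction_dom (s : S) : IsCompact ((canonicalAction S).dom s) :=
  SemilatticeSpectrum.isCompact_eval (lam s)

/-- The characteristic function `1_{Θ_s}` of the set `Θ_s` of all germs `[s, φ]` of the canonical
action, where `φ(lam s) = 1`. -/
noncomputable def germIndicator (s : S) : (canonicalAction S).germCategory.A0 :=
  ⟨Set.indicator (EtaleAction.germSet s ((canonicalAction S).dom s)) 1,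
    (canonicalAction S).indicator_mem_A0 (isCompact_canonicalAction_dom s)⟩

end RestrictionSemigroup

/-! ### Principal characters and the commutative algebra of a semilattice of projections -/

namespace RestrictionSemigroup

open EtaleAction hiding map_mul

variable {S : Type u} [RestrictionSemigroup S]

-- The map `δ_s ↦ 1_{Θ_s}` extends to a homomorphism `germHom` from `ℂ[S]` to the convolution
-- algebra, because `Θ_s Θ_t = Θ_{st}`. The theorem follows once this map preserves the seminorms
-- and has dense image. A representation of the convolution algebra restricts to one of `S`, so the
-- work lies in extending a representation `σ` of `S`.
--
-- The extension is a limit of Riemann sums. A finite set `F` of projections cuts the spectrum into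
-- cells, one for each `F' ⊆ F`: the characters that are `1` on `F'` and `0` on `F \ F'`. The cell
-- of `F'` corresponds to the projection `P_{F'} = ∏ g ∏ (1 - g)`, the image of `atom F F'`. If `F'`
-- is non-empty with meet `e`, a function `f` is sampled over the principal character of `e`, which
-- lies in the cell unless the atom is zero. The germs there correspond bijectively to the `t` with
-- `lam t = e`. Hence `valueOp σ F f = ∑_{F'} (∑_{lam t = e} f [t, φ_e] σ_t) P_{F'}`. For `f =
-- 1_{Θ_s}` this is exactly `σ_s` as soon as `lam s ∈ F` (`valueOp_germIndicator`).
--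
-- The decisive estimate is `eventually_norm_valueOp_le`: if `f` is in `C_c(U)` for a bisection `U`
-- and is bounded by `M`, then the Riemann sums have norm at most `M` for all large `F`. Each inner
-- sum then has at most one term `f [t, φ_e] σ_t`, of norm at most `M`. The `P_{F'}` are mutually
-- orthogonal projections. Although `σ_t` need not be a partial isometry, `σ_t g = σ_{rho (t g)}
-- σ_t` puts the range of `σ_t P_{F'}` under the projection of the image of the cell. For fine `F`
-- the germs of `t` over the whole cell lie in `U` (`exists_finset_saturated`), so injectivity of
-- the range map on `U` makes these images disjoint and the ranges orthogonal. Pythagoras on both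
-- sides gives the bound (`norm_sum_mul_atom_le`).
--
-- Functions in `C_c(U)` are uniform limits of functions in `C_c(U)` coming from `ℂ[S]`
-- (`exists_norm_sub_germHom_le`). With the estimate, this makes the Riemann sums converge. The
-- limit is multiplicative by approximation and respects adjoints on units, so it is a
-- representation extending `σ`. The same approximation gives density of the image.

scoped instance : CommSemigroup (Proj S) :=
  { (inferInstance : Semigroup (Proj S)) with mul_comm := proj_comm }

open Classical in
/-- The principal character `f ↦ [e ≤ f]` of a projection `e`. -/
noncomputable def principalChar (e : Proj S) : SemilatticeSpectrum (Proj S) :=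
  ⟨fun f => decide (e * f = e), fun f g => by
    rw [← Bool.decide_and, decide_eq_decide]
    constructor
    · intro h
      constructor
      · rw [← h, mul_assoc, mul_comm (f * g) f, ← mul_assoc f f g, proj_idem]
      · rw [← h, mul_assoc, mul_assoc f g g, proj_idem]
    · rintro ⟨h1, h2⟩
      rw [← mul_assoc, h1, h2], e, by simp [proj_idem]⟩

theorem principalChar_apply {e f : Proj S} : principalChar e f = true ↔ e * f = e := by
  simp [principalChar]

theorem principalChar_self (e : Proj S) : principalChar e e = true :=
  principalChar_apply.2 (proj_idem e)

theorem char_of_le {φ : SemilatticeSpectrum (Proj S)} {e f : Proj S} (he : φ e = true)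
    (h : e * f = e) : φ f = true := by
  have := φ.2.1 e f
  rw [h, he] at this
  simpa using this.symm

theorem mem_canonicalAction_dom {s : S} {φ : SemilatticeSpectrum (Proj S)} :
    φ ∈ (canonicalAction S).dom s ↔ φ (lam s) = true := Iff.rfl

theorem mem_canonicalAction_dom_proj {e : Proj S} {φ : SemilatticeSpectrum (Proj S)} :
    φ ∈ (canonicalAction S).dom (e : S) ↔ φ e = true := by
  rw [mem_canonicalAction_dom, lam_proj]

/-- The germ of `t` at the principal character of `lam t`. -/
noncomputable def principalGerm (t : S) : (canonicalAction S).Germ :=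
  germ t (principalChar (lam t)) (mem_canonicalAction_dom.2 (principalChar_self _))

/-- Every projection at which the principal character of `lam t` is `1` lies above `lam t`.
Multiplication by `lam t` therefore absorbs any witness for equality of germs, and germs over a
principal character become a matter of equality in `S`. -/
theorem principalGerm_eq_germ {s t : S}
    (h : principalChar (lam t) ∈ (canonicalAction S).dom s) :
    principalGerm t = germ s (principalChar (lam t)) h ↔ s * lam t = t := by
  unfold principalGerm
  rw [germ_eq]
  constructor
  · rintro ⟨-, f, hf, e⟩
    rw [mem_canonicalAction_dom_proj, principalChar_apply, mul_comm] at hf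
    rw [← hf, MulMemClass.coe_mul, ← mul_assoc, ← e, mul_assoc, ← MulMemClass.coe_mul, hf, mul_lam]
  · intro e
    refine ⟨rfl, lam t, ?_, by rw [e, mul_lam]⟩
    exact principalChar_self _ |> mem_canonicalAction_dom_proj.2

theorem lam_mul_proj_of_le {s : S} {e : Proj S} (h : e * lam s = e) : lam (s * (e : S)) = e := by
  rw [lam_mul_proj, mul_comm, h]

/-! ### The unitized semilattice algebra and its atoms -/

/-- The element of the algebra of the semilattice with adjoined unit given by a projection. -/
noncomputable abbrev ofProj (e : Proj S) : MonoidAlgebra ℂ (WithOne (Proj S)) :=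
  MonoidAlgebra.of ℂ (WithOne (Proj S)) (e : WithOne (Proj S))

theorem ofProj_mul (e f : Proj S) : ofProj (e * f) = ofProj e * ofProj f := by
  rw [ofProj, WithOne.coe_mul, map_mul]

theorem ofProj_mul_one_sub {e f : Proj S} (h : e * f = e) : ofProj e * (1 - ofProj f) = 0 := by
  rw [mul_sub, mul_one, ← ofProj_mul, h, sub_self]

open Classical in
/-- The product of all `g` in `F'` and all `1 - f` for `f` in `F \ F'`. -/
noncomputable def atom (F F' : Finset (Proj S)) : MonoidAlgebra ℂ (WithOne (Proj S)) :=
  (∏ g ∈ F', ofProj g) * ∏ g ∈ F \ F', (1 - ofProj g)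

/-- The product of all `g + (1 - g)`, for `g ∈ F`, is `1`; expanding it gives one atom for each
subset of `F`. -/
theorem sum_atom (F : Finset (Proj S)) : ∑ F' ∈ F.powerset, atom F F' = 1 := by
  classical
  have h := Finset.prod_add (fun g : Proj S => ofProj g) (fun g => 1 - ofProj g) F
  simp only [add_sub_cancel, Finset.prod_const_one] at h
  rw [h]
  refine Finset.sum_congr rfl fun F' _ => ?_
  unfold atom
  congr!

/-- The meet of a finite set of projections. -/
noncomputable def meet (F : Finset (Proj S)) : WithOne (Proj S) := ∏ g ∈ F, (g : WithOne (Proj S))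

theorem meet_mul_of_mem {F : Finset (Proj S)} {g : Proj S} (hg : g ∈ F) :
    meet F * (g : WithOne (Proj S)) = meet F := by
  classical
  rw [meet, ← Finset.mul_prod_erase _ _ hg, mul_right_comm, ← WithOne.coe_mul, proj_idem]

theorem le_of_meet_eq {F : Finset (Proj S)} {e g : Proj S} (he : (e : WithOne (Proj S)) = meet F)
    (hg : g ∈ F) : e * g = e := by
  have := meet_mul_of_mem hg
  rwa [← he, ← WithOne.coe_mul, WithOne.coe_inj] at this

theorem prod_ofProj (F : Finset (Proj S)) :
    ∏ g ∈ F, ofProj g = MonoidAlgebra.of ℂ (WithOne (Proj S)) (meet F) := by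
  rw [meet, map_prod]

theorem prod_ofProj_mul_prod_one_sub {F G : Finset (Proj S)} {g : Proj S} (hF : g ∈ F)
    (hG : g ∈ G) : (∏ g ∈ F, ofProj g) * ∏ g ∈ G, (1 - ofProj g) = 0 := by
  classical
  rw [← Finset.prod_erase_mul _ _ hF, ← Finset.mul_prod_erase _ _ hG, mul_assoc,
    ← mul_assoc (ofProj g), ofProj_mul_one_sub (proj_idem g), zero_mul, mul_zero]

/-- Some `g` belongs to exactly one of the two subsets, so the product has the factor `g (1 - g) =
0`. -/
theorem atom_mul_atom {F F₁ F₂ : Finset (Proj S)} (h₁ : F₁ ⊆ F) (h₂ : F₂ ⊆ F) (h : F₁ ≠ F₂) :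
    atom F F₁ * atom F F₂ = 0 := by
  classical
  have key : ∀ {F₁ F₂ : Finset (Proj S)}, F₁ ⊆ F → ¬ F₁ ⊆ F₂ → atom F F₁ * atom F F₂ = 0 := by
    intro F₁ F₂ h₁ h
    obtain ⟨g, hg, hg'⟩ := Finset.not_subset.1 h
    unfold atom
    rw [mul_comm (∏ g ∈ F₂, ofProj g), mul_mul_mul_comm, mul_comm (∏ g ∈ F \ F₁, (1 - ofProj g)),
      prod_ofProj_mul_prod_one_sub hg (Finset.mem_sdiff.2 ⟨h₁ hg, hg'⟩), zero_mul]
  by_cases h' : F₁ ⊆ F₂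
  · rw [mul_comm]
    exact key h₂ fun h'' => h (h'.antisymm h'')
  · exact key h₁ h'

/-! ### The projections of a representation -/

section Representation

variable {H : Type w} [NormedAddCommGroup H] [InnerProductSpace ℂ H]
  (σ : S →ₙ* (H →L[ℂ] H))

/-- The representation of the algebra of the semilattice with adjoined unit which is given by the
restriction of `σ` to the projections. -/
noncomputable def projRep : MonoidAlgebra ℂ (WithOne (Proj S)) →ₐ[ℂ] (H →L[ℂ] H) :=
  MonoidAlgebra.lift ℂ _ _ (WithOne.lift (σ.comp (MulMemClass.subtype proj)))

theorem projRep_ofProj (e : Proj S) : projRep σ (ofProj e) = σ e := by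
  rw [projRep, ofProj, MonoidAlgebra.lift_of]
  rfl

variable {σ}

/-- The axiom `t g = rho (t g) t` moves each factor `1 - g` to the other side of `σ t`. It replaces
conjugation by `σ t`, which is not available because `σ t` need not be a partial isometry. -/
theorem mul_projRep_prod_one_sub [DecidableEq (Proj S)] (t : S) (G : Finset (Proj S)) :
    σ t * projRep σ (∏ g ∈ G, (1 - ofProj g)) =
      projRep σ (∏ g ∈ G, (1 - ofProj (rho (t * (g : S))))) * σ t := by
  induction G using Finset.induction_on with
  | empty => simp
  | insert g G hg ih =>
    have h : σ t * projRep σ (1 - ofProj g) =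
        projRep σ (1 - ofProj (rho (t * (g : S)))) * σ t := by
      rw [map_sub, map_sub, projRep_ofProj, projRep_ofProj, map_one, mul_sub, sub_mul, mul_one,
        one_mul, ← map_mul, ← map_mul, ← mul_proj]
    rw [Finset.prod_insert hg, Finset.prod_insert hg, map_mul, ← mul_assoc, h, mul_assoc, ih,
      ← mul_assoc, ← map_mul]

-- Since `ψ (rho (t g)) = θ_t⁻¹(ψ)(g)`, the factor to the left of `σ t` corresponds to the image
-- under `θ_t` of the cell of `F'`. It confines the range of `σ t` times the atom.
open Classical in
theorem mul_projRep_atom {F F' : Finset (Proj S)} {t : S}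
    (h : (lam t : WithOne (Proj S)) = meet F') :
    σ t * projRep σ (atom F F') = projRep σ (ofProj (rho t) *
      ∏ g ∈ F \ F', (1 - ofProj (rho (t * (g : S))))) * σ t := by
  rw [atom, prod_ofProj, ← h, map_mul, map_mul, projRep_ofProj, ← mul_assoc]
  rw [← map_mul, mul_lam]
  have h1 : σ t = σ (rho t) * σ t := by rw [← map_mul, rho_mul]
  conv_lhs => rw [h1]
  rw [projRep_ofProj, mul_assoc, mul_assoc, mul_projRep_prod_one_sub]

variable [CompleteSpace H]

theorem isSelfAdjoint_projRep_mul {a b : MonoidAlgebra ℂ (WithOne (Proj S))}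
    (ha : IsSelfAdjoint (projRep σ a)) (hb : IsSelfAdjoint (projRep σ b)) :
    IsSelfAdjoint (projRep σ (a * b)) := by
  rw [IsSelfAdjoint, map_mul, star_mul, ha.star_eq, hb.star_eq, ← map_mul, ← map_mul, mul_comm]

theorem isSelfAdjoint_projRep_ofProj (hσ : IsRepresentation σ) (e : Proj S) :
    IsSelfAdjoint (projRep σ (ofProj e)) := by
  rw [projRep_ofProj]
  exact hσ.adjoint_eq e

theorem isSelfAdjoint_projRep_prod_ofProj (hσ : IsRepresentation σ) (F : Finset (Proj S)) :
    IsSelfAdjoint (projRep σ (∏ g ∈ F, ofProj g)) := by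
  classical
  induction F using Finset.induction_on with
  | empty => rw [Finset.prod_empty, map_one]; exact .one _
  | insert g F hg ih =>
    rw [Finset.prod_insert hg]
    exact isSelfAdjoint_projRep_mul (isSelfAdjoint_projRep_ofProj hσ g) ih

theorem isSelfAdjoint_projRep_prod_one_sub (hσ : IsRepresentation σ) (F : Finset (Proj S)) :
    IsSelfAdjoint (projRep σ (∏ g ∈ F, (1 - ofProj g))) := by
  classical
  induction F using Finset.induction_on with
  | empty => rw [Finset.prod_empty, map_one]; exact .one _
  | insert g F hg ih =>
    rw [Finset.prod_insert hg]
    refine isSelfAdjoint_projRep_mul ?_ ih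
    rw [map_sub, map_one]
    exact (IsSelfAdjoint.one _).sub (isSelfAdjoint_projRep_ofProj hσ g)

theorem isSelfAdjoint_projRep_atom (hσ : IsRepresentation σ) (F F' : Finset (Proj S)) :
    IsSelfAdjoint (projRep σ (atom F F')) :=
  isSelfAdjoint_projRep_mul (isSelfAdjoint_projRep_prod_ofProj hσ F')
    (isSelfAdjoint_projRep_prod_one_sub hσ _)

theorem isSelfAdjoint_projRep_range (hσ : IsRepresentation σ) (t : S) (G : Finset (Proj S)) :
    IsSelfAdjoint (projRep σ (ofProj (rho t) * ∏ g ∈ G, (1 - ofProj (rho (t * (g : S)))))) := by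
  classical
  refine isSelfAdjoint_projRep_mul (isSelfAdjoint_projRep_ofProj hσ _) ?_
  induction G using Finset.induction_on with
  | empty => rw [Finset.prod_empty, map_one]; exact .one _
  | insert g F hg ih =>
    rw [Finset.prod_insert hg]
    refine isSelfAdjoint_projRep_mul ?_ ih
    rw [map_sub, map_one]
    exact (IsSelfAdjoint.one _).sub (isSelfAdjoint_projRep_ofProj hσ _)

/-! ### Orthogonality of ranges and the Pythagorean bound -/

open Classical in
/-- The operators `σ t P` and `σ t' P'`, where `P` and `P'` are given by atoms, have orthogonal
ranges if the images of the atoms under `t` and `t'` are disjoint. -/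
theorem inner_mul_atom_eq_zero (hσ : IsRepresentation σ)
    {F F₁ F₂ : Finset (Proj S)} {t₁ t₂ : S}
    (h₁ : (lam t₁ : WithOne (Proj S)) = meet F₁) (h₂ : (lam t₂ : WithOne (Proj S)) = meet F₂)
    (h : ∀ ψ : SemilatticeSpectrum (Proj S), ψ (rho t₁) = true → ψ (rho t₂) = true →
      (∀ g ∈ F \ F₁, ψ (rho (t₁ * (g : S))) = false) →
      (∀ g ∈ F \ F₂, ψ (rho (t₂ * (g : S))) = false) → False) (x y : H) :
    inner ℂ ((σ t₁ * projRep σ (atom F F₁)) x) ((σ t₂ * projRep σ (atom F F₂)) y) = 0 := by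
  rw [mul_projRep_atom h₁, mul_projRep_atom h₂, mul_apply_eq_comp,
    mul_apply_eq_comp]
  have hs := isSelfAdjoint_projRep_range hσ t₁ (F \ F₁)
  rw [← hs.star_eq, ContinuousLinearMap.star_eq_adjoint, ContinuousLinearMap.adjoint_inner_left,
    ← mul_apply_eq_comp, ← map_mul, mul_mul_mul_comm, ← ofProj_mul]
  -- It suffices to test `h` on the principal character of `rho t₁ * rho t₂`. As it is not in both
  -- images, `rho t₁ * rho t₂` lies below some removed projection, and the corresponding factor `1 -
  -- ofProj _` annihilates the product.
  have hz : ofProj (rho t₁ * rho t₂) * ((∏ g ∈ F \ F₁, (1 - ofProj (rho (t₁ * (g : S))))) *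
      ∏ g ∈ F \ F₂, (1 - ofProj (rho (t₂ * (g : S))))) = 0 := by
    have h0 := principalChar_self (rho t₁ * rho t₂)
    have hψ : (∃ g ∈ F \ F₁, principalChar (rho t₁ * rho t₂) (rho (t₁ * (g : S))) = true) ∨
        ∃ g ∈ F \ F₂, principalChar (rho t₁ * rho t₂) (rho (t₂ * (g : S))) = true := by
      by_contra! hc
      refine h (principalChar (rho t₁ * rho t₂)) ?_ ?_ ?_ ?_
      · rw [(principalChar _).2.1, Bool.and_eq_true] at h0
        exact h0.1
      · rw [(principalChar _).2.1, Bool.and_eq_true] at h0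
        exact h0.2
      · exact fun g hg => Bool.eq_false_of_not_eq_true (hc.1 g hg)
      · exact fun g hg => Bool.eq_false_of_not_eq_true (hc.2 g hg)
    obtain ⟨g, hg, hg'⟩ | ⟨g, hg, hg'⟩ := hψ
    · rw [← Finset.mul_prod_erase _ _ hg, ← mul_assoc, ← mul_assoc,
        ofProj_mul_one_sub (principalChar_apply.1 hg'), zero_mul, zero_mul]
    · rw [mul_comm (∏ g ∈ F \ F₁, _), ← Finset.mul_prod_erase _ _ hg, ← mul_assoc, ← mul_assoc,
        ofProj_mul_one_sub (principalChar_apply.1 hg'), zero_mul, zero_mul]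
  rw [hz, map_zero, zero_apply, inner_zero_right]

/-- A sum of operators with orthogonal ranges, which vanish on the complements of orthogonal
projections, is bounded by the supremum of the norms. -/
theorem norm_sum_mul_atom_le (hσ : IsRepresentation σ) {F : Finset (Proj S)}
    {T : Finset (Proj S) → (H →L[ℂ] H)} {M : ℝ} (hM : 0 ≤ M) (hT : ∀ F' ⊆ F, ‖T F'‖ ≤ M)
    (h : ∀ F₁ ⊆ F, ∀ F₂ ⊆ F, F₁ ≠ F₂ → ∀ x y, inner ℂ ((T F₁ * projRep σ (atom F F₁)) x)
      ((T F₂ * projRep σ (atom F F₂)) y) = 0) :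
    ‖∑ F' ∈ F.powerset, T F' * projRep σ (atom F F')‖ ≤ M := by
  have pyth : ∀ v : Finset (Proj S) → H, (∀ F₁ ∈ F.powerset, ∀ F₂ ∈ F.powerset, F₁ ≠ F₂ →
      inner ℂ (v F₁) (v F₂) = 0) →
      ‖∑ F' ∈ F.powerset, v F'‖ ^ 2 = ∑ F' ∈ F.powerset, ‖v F'‖ ^ 2 := by
    intro v hv
    have : (inner ℂ (∑ F' ∈ F.powerset, v F') (∑ F' ∈ F.powerset, v F') : ℂ) =
        ∑ F' ∈ F.powerset, inner ℂ (v F') (v F') := by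
      rw [sum_inner]
      refine Finset.sum_congr rfl fun F₁ h₁ => ?_
      rw [inner_sum]
      exact Finset.sum_eq_single _ (fun F₂ h₂ hne => hv _ h₁ _ h₂ hne.symm) (absurd h₁)
    simp only [inner_self_eq_norm_sq_to_K] at this
    exact_mod_cast this
  refine ContinuousLinearMap.opNorm_le_bound _ hM fun x => ?_
  refine le_of_sq_le_sq ?_ (by positivity)
  rw [sum_apply, pyth _ fun F₁ h₁ F₂ h₂ hne =>
    h _ (Finset.mem_powerset.1 h₁) _ (Finset.mem_powerset.1 h₂) hne x x]
  -- The atoms are orthogonal projections with sum `1`, so Pythagoras applies to the input vector as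
  -- well as to the output.
  have hx : ‖x‖ ^ 2 = ∑ F' ∈ F.powerset, ‖projRep σ (atom F F') x‖ ^ 2 := by
    rw [← pyth]
    · rw [← sum_apply, ← map_sum, sum_atom, map_one]
      rfl
    · intro F₁ h₁ F₂ h₂ hne
      rw [← (isSelfAdjoint_projRep_atom hσ F F₁).star_eq, ContinuousLinearMap.star_eq_adjoint,
        ContinuousLinearMap.adjoint_inner_left, ← mul_apply_eq_comp, ← map_mul,
        atom_mul_atom (Finset.mem_powerset.1 h₁) (Finset.mem_powerset.1 h₂) hne, map_zero,
        zero_apply, inner_zero_right]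
  rw [mul_pow, hx, Finset.mul_sum]
  refine Finset.sum_le_sum fun F' h' => ?_
  rw [← mul_pow]
  refine pow_le_pow_left₀ (norm_nonneg _) ?_ 2
  rw [mul_apply_eq_comp]
  exact (T F').le_of_opNorm_le (hT _ (Finset.mem_powerset.1 h')) _

end Representation

end RestrictionSemigroup

/-! ### The homomorphism from the semigroup algebra to the convolution algebra -/

namespace RestrictionSemigroup

open EtaleAction hiding map_mul

variable {S : Type u} [RestrictionSemigroup S]

theorem germ_mem_germSet {X : Type v} [TopologicalSpace X] {θ : EtaleAction S X} {s t : S} {x : X}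
    {U : Set X} {h : x ∈ θ.dom t} :
    germ t x h ∈ germSet (θ := θ) s U ↔ ∃ h', x ∈ U ∧ germ t x h = germ s x h' := by
  constructor
  · rintro ⟨y, hy, hyU, e⟩
    obtain rfl := (germ_eq.1 e).1
    exact ⟨hy, hyU, e⟩
  · rintro ⟨h', hU, e⟩
    exact ⟨x, h', hU, e⟩

theorem germSet_eq_image {X : Type v} [TopologicalSpace X] {θ : EtaleAction S X} (s : S)
    (U : Set X) : germSet (θ := θ) s U = germSection s '' (Subtype.val ⁻¹' U) := by
  ext q
  constructor
  · rintro ⟨x, h, hx, rfl⟩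
    exact ⟨⟨x, h⟩, hx, rfl⟩
  · rintro ⟨x, hx, rfl⟩
    exact ⟨x, x.2, hx, rfl⟩

theorem isOpen_germSet {X : Type v} [TopologicalSpace X] {θ : EtaleAction S X} (s : S)
    {U : Set X} (hU : IsOpen U) : IsOpen (germSet (θ := θ) s U) := by
  rw [germSet_eq_image]
  exact (isOpenEmbedding_germSection s).isOpenMap _ (hU.preimage continuous_subtype_val)

theorem isBisection_germSet {X : Type v} [TopologicalSpace X] [LocallyCompactSpace X] [T2Space X]
    (θ : EtaleAction S X) (s : S) {U : Set X} (hU : IsOpen U) :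
    θ.germCategory.IsBisection (germSet s U) where
  isOpen := isOpen_germSet s hU
  injOn_d := by
    rintro _ ⟨x, hx, -, rfl⟩ _ ⟨y, hy, -, rfl⟩ e
    obtain rfl : x = y := e
    rfl
  injOn_r := by
    rintro _ ⟨x, hx, -, rfl⟩ _ ⟨y, hy, -, rfl⟩ e
    obtain rfl : x = y := (θ.map s).injOn hx hy e
    rfl

theorem isCompact_germSet_dom (s : S) :
    IsCompact (germSet (θ := canonicalAction S) s ((canonicalAction S).dom s)) := by
  rw [germSet_eq_image]
  have := isCompact_iff_compactSpace.1 (isCompact_canonicalAction_dom s)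
  rw [Subtype.coe_preimage_self, Set.image_univ]
  exact isCompact_range (isOpenEmbedding_germSection s).continuous

theorem germIndicator_isCc (s : S) :
    IsCc (germSet s ((canonicalAction S).dom s)) (germIndicator s).1 := by
  have := (isBisection_germSet (canonicalAction S) s (isOpen_dom (θ := canonicalAction S) s)).t2Space
  exact isCc_iff.2 ⟨continuousOn_const.congr fun q hq => Set.indicator_of_mem hq _, _,
    subset_rfl, isCompact_germSet_dom s, fun q hq => Set.indicator_of_notMem hq _⟩

theorem germIndicator_apply_of_mem {s : S} {q : (canonicalAction S).Germ}
    (hq : q ∈ germSet s ((canonicalAction S).dom s)) : (germIndicator s).1 q = 1 :=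
  Set.indicator_of_mem hq _

theorem germIndicator_apply_of_notMem {s : S} {q : (canonicalAction S).Germ}
    (hq : q ∉ germSet s ((canonicalAction S).dom s)) : (germIndicator s).1 q = 0 :=
  Set.indicator_of_notMem hq _

/-- The product of the bisections `Θ_s` and `Θ_t` is `Θ_{st}`. A germ in it has only one
factorization with factors in `Θ_s` and `Θ_t`, so the convolution sum there is a single `1 * 1`. -/
theorem germIndicator_mul (s t : S) :
    germIndicator (s * t) = germIndicator s * germIndicator t := by
  refine Subtype.ext (funext fun z => ?_)
  change (germIndicator (s * t)).1 z =
    (canonicalAction S).germCategory.conv (germIndicator s).1 (germIndicator t).1 z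
  have hs := isBisection_germSet (canonicalAction S) s (isOpen_dom (θ := canonicalAction S) s)
  have ht := isBisection_germSet (canonicalAction S) t (isOpen_dom (θ := canonicalAction S) t)
  by_cases hz : z ∈ germSet (s * t) ((canonicalAction S).dom (s * t))
  · rw [germIndicator_apply_of_mem hz]
    obtain ⟨y, hy, -, rfl⟩ := hz
    have hy' := (canonicalAction S).mem_dom_mul.1 hy
    rw [← germComp_germ s t _ y hy'.2 hy'.1 rfl]
    refine Eq.symm (((canonicalAction S).germCategory.conv_comp hs.injOn_r ht.injOn_d
      (fun x hx => germIndicator_apply_of_notMem hx)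
      (fun x hx => germIndicator_apply_of_notMem hx)
      (x := germ s _ hy'.2) (y := germ t y hy'.1) ?_ ?_ rfl).trans ?_)
    · exact ⟨_, hy'.2, hy'.2, rfl⟩
    · exact ⟨_, hy'.1, hy'.1, rfl⟩
    · rw [germIndicator_apply_of_mem ⟨_, hy'.2, hy'.2, rfl⟩,
        germIndicator_apply_of_mem ⟨_, hy'.1, hy'.1, rfl⟩, one_mul]
  · rw [germIndicator_apply_of_notMem hz, EtaleCategory.conv_eq_zero _
      (fun x hx => germIndicator_apply_of_notMem hx) (fun x hx => germIndicator_apply_of_notMem hx)]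
    rintro ⟨_, ⟨x, hx, -, rfl⟩, _, ⟨y, hy, -, rfl⟩, h, rfl⟩
    have h' : x = (canonicalAction S).map t y := h
    have e := germComp_germ s t x y hx hy h'
    exact hz ⟨y, _, (canonicalAction S).mem_dom_mul.2 ⟨hy, h' ▸ hx⟩, e⟩

variable (S) in
/-- The homomorphism from `ℂ[S]` to `𝒜₀(C(θ, S, Ê))` which takes `δ_s` to `1_{Θ_s}`. -/
noncomputable def germHom : MonoidAlgebra ℂ S →ₙₐ[ℂ] (canonicalAction S).germCategory.A0 :=
  MonoidAlgebra.liftMagma ℂ ⟨germIndicator, germIndicator_mul⟩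

theorem germHom_single (s : S) : germHom S (MonoidAlgebra.single s 1) = germIndicator s := by
  simp [germHom]

theorem liftMagma_single {A : Type w} [NonUnitalNonAssocSemiring A] [Module ℂ A]
    [IsScalarTower ℂ A A] [SMulCommClass ℂ A A] (σ : S →ₙ* A) (s : S) :
    MonoidAlgebra.liftMagma ℂ σ (MonoidAlgebra.single s 1) = σ s := by
  simp

/-! ### Approximate values of a representation on the convolution algebra -/

section Value

variable {H : Type w} [NormedAddCommGroup H] [InnerProductSpace ℂ H]
  (σ : S →ₙ* (H →L[ℂ] H))

/-- The sum of `f [t, φ] • σ t` over all germs `[t, φ]` at the principal character of `e`. -/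
noncomputable def fiberSum (f : (canonicalAction S).Germ → ℂ) (e : WithOne (Proj S)) : H →L[ℂ] H :=
  ∑ᶠ t : {t : S // (lam t : WithOne (Proj S)) = e}, f (principalGerm t.1) • σ t.1

/-- The value of the representation `σ` at `f` up to an error which is small if `F` is large. -/
noncomputable def valueOp (F : Finset (Proj S)) (f : (canonicalAction S).Germ → ℂ) : H →L[ℂ] H :=
  ∑ F' ∈ F.powerset, fiberSum σ f (meet F') * projRep σ (atom F F')

variable {σ}

/-- The germ of `t` at the principal character of `lam t` remembers `t * lam t = t`. Hence
`fiberSum` counts each germ over a principal character only once. -/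
theorem principalGerm_injOn {s t : S} (h : lam s = lam t)
    (e : principalGerm s = principalGerm t) : s = t := by
  have hs : principalChar (lam s) ∈ (canonicalAction S).dom t := by
    rw [h]
    exact principalChar_self _
  have : principalGerm t = germ t (principalChar (lam s)) hs := by
    refine germ_eq.2 ⟨by rw [h], lam t, ?_, rfl⟩
    exact mem_canonicalAction_dom_proj.2 (principalChar_self _)
  rw [this, principalGerm_eq_germ, h, mul_lam] at e
  exact e.symm

/-- An infinite support would give `∑ᶠ` the default value `0` and destroy additivity. Here
finiteness comes from the fibres of the source map, on which functions in `A0` have finite support.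
-/
theorem finite_support_fiberSum {f : (canonicalAction S).Germ → ℂ}
    (hf : f ∈ (canonicalAction S).germCategory.A0) (e : WithOne (Proj S)) :
    (Function.support fun t : {t : S // (lam t : WithOne (Proj S)) = e} =>
      f (principalGerm t.1) • σ t.1).Finite := by
  rcases isEmpty_or_nonempty {t : S // (lam t : WithOne (Proj S)) = e} with h | ⟨⟨t₀, h₀⟩⟩
  · exact Set.toFinite _
  have hl : ∀ t : {t : S // (lam t : WithOne (Proj S)) = e}, lam t.1 = lam t₀ :=
    fun t => WithOne.coe_inj.1 (t.2.trans h₀.symm)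
  refine Set.Finite.of_finite_image (f := fun t => principalGerm t.1) ?_ ?_
  · refine ((canonicalAction S).germCategory.finite_fiber hf
      (principalChar (lam t₀))).2.subset ?_
    rintro _ ⟨t, ht, rfl⟩
    refine ⟨?_, left_ne_zero_of_smul ht⟩
    change principalChar (lam t.1) = _
    rw [hl]
  · intro t _ t' _ ht
    exact Subtype.ext (principalGerm_injOn ((hl t).trans (hl t').symm) ht)

theorem fiberSum_add {f g : (canonicalAction S).Germ → ℂ}
    (hf : f ∈ (canonicalAction S).germCategory.A0) (hg : g ∈ (canonicalAction S).germCategory.A0)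
    (e : WithOne (Proj S)) : fiberSum σ (f + g) e = fiberSum σ f e + fiberSum σ g e := by
  unfold fiberSum
  rw [← finsum_add_distrib (finite_support_fiberSum (σ := σ) hf e)
    (finite_support_fiberSum (σ := σ) hg e)]
  simp only [Pi.add_apply, add_smul]

theorem fiberSum_smul (c : ℂ) (f : (canonicalAction S).Germ → ℂ) (e : WithOne (Proj S)) :
    fiberSum σ (c • f) e = c • fiberSum σ f e := by
  unfold fiberSum
  rw [smul_finsum]
  simp only [Pi.smul_apply, smul_assoc]

theorem valueOp_add {f g : (canonicalAction S).Germ → ℂ}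
    (hf : f ∈ (canonicalAction S).germCategory.A0) (hg : g ∈ (canonicalAction S).germCategory.A0)
    (F : Finset (Proj S)) : valueOp σ F (f + g) = valueOp σ F f + valueOp σ F g := by
  simp only [valueOp, fiberSum_add hf hg, add_mul, Finset.sum_add_distrib]

theorem valueOp_smul (c : ℂ) (f : (canonicalAction S).Germ → ℂ) (F : Finset (Proj S)) :
    valueOp σ F (c • f) = c • valueOp σ F f := by
  simp only [valueOp, fiberSum_smul, smul_mul_assoc, Finset.smul_sum]

theorem valueOp_sub {f g : (canonicalAction S).Germ → ℂ}
    (hf : f ∈ (canonicalAction S).germCategory.A0) (hg : g ∈ (canonicalAction S).germCategory.A0)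
    (F : Finset (Proj S)) : valueOp σ F (f - g) = valueOp σ F f - valueOp σ F g := by
  rw [sub_eq_add_neg, ← neg_one_smul ℂ g, valueOp_add hf (Submodule.smul_mem _ _ hg), valueOp_smul,
    neg_one_smul, ← sub_eq_add_neg]

theorem valueOp_zero (F : Finset (Proj S)) : valueOp σ F 0 = 0 := by
  rw [← zero_smul ℂ (0 : (canonicalAction S).Germ → ℂ), valueOp_smul, zero_smul]

theorem fiberSum_eq_single {f : (canonicalAction S).Germ → ℂ} {e : WithOne (Proj S)} {t : S}
    (ht : (lam t : WithOne (Proj S)) = e)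
    (h : ∀ t', (lam t' : WithOne (Proj S)) = e → f (principalGerm t') ≠ 0 → t' = t) :
    fiberSum σ f e = f (principalGerm t) • σ t := by
  unfold fiberSum
  rw [finsum_eq_single _ ⟨t, ht⟩]
  rintro ⟨t', ht'⟩ hne
  by_cases h0 : f (principalGerm t') = 0
  · rw [h0, zero_smul]
  · exact absurd (Subtype.ext (h t' ht' h0)) hne

theorem fiberSum_eq_zero {f : (canonicalAction S).Germ → ℂ} {e : WithOne (Proj S)}
    (h : ∀ t', (lam t' : WithOne (Proj S)) = e → f (principalGerm t') = 0) :
    fiberSum σ f e = 0 := by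
  unfold fiberSum
  rw [← finsum_zero (α := {t : S // (lam t : WithOne (Proj S)) = e})]
  congr 1
  ext1 t
  rw [h t.1 t.2, zero_smul]

theorem principalGerm_mem_germSet {s t : S} {U : Set (SemilatticeSpectrum (Proj S))} :
    principalGerm t ∈ germSet s U ↔
      lam t * lam s = lam t ∧ principalChar (lam t) ∈ U ∧ s * lam t = t := by
  constructor
  · intro h
    obtain ⟨h', hU, e⟩ := germ_mem_germSet.1 h
    exact ⟨principalChar_apply.1 h', hU, (principalGerm_eq_germ h').1 e⟩
  · rintro ⟨h, hU, e⟩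
    exact germ_mem_germSet.2 ⟨principalChar_apply.2 h, hU,
      (principalGerm_eq_germ (principalChar_apply.2 h)).2 e⟩

/-- Once `lam s ∈ F`, each cell lies inside or outside the domain of `θ_s`, so sampling causes no
error. Inside, the only sampled germ is that of `s e` with `e = meet F'`, and `e` is absorbed by the
atom; outside, `σ s` kills the atom. -/
theorem valueOp_germIndicator {s : S} {F : Finset (Proj S)} (hs : lam s ∈ F) :
    valueOp σ F (germIndicator s).1 = σ s := by
  classical
  have key : ∀ F' ∈ F.powerset, fiberSum σ (germIndicator s).1 (meet F') * projRep σ (atom F F') =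
      σ s * projRep σ (atom F F') := by
    intro F' hF'
    have hz : lam s ∉ F' → σ s * projRep σ (atom F F') = 0 := by
      intro h
      have h1 : σ s = σ s * projRep σ (ofProj (lam s)) := by
        rw [projRep_ofProj, ← map_mul, mul_lam]
      have h2 : ofProj (lam s) * atom F F' = 0 := by
        rw [atom, ← Finset.mul_prod_erase _ _ (Finset.mem_sdiff.2 ⟨hs, h⟩), mul_left_comm,
          ← mul_assoc (ofProj (lam s)), ofProj_mul_one_sub (proj_idem _), zero_mul, mul_zero]
      rw [h1, mul_assoc, ← map_mul, h2, map_zero, mul_zero]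
    -- This is weaker than `lam s ∈ F'`, but the comparison only needs a projection `e` equal to the
    -- meet and below `lam s`. If there is none, then `lam s ∉ F'` and both sides vanish.
    by_cases he : ∃ e : Proj S, (e : WithOne (Proj S)) = meet F' ∧ e * lam s = e
    · obtain ⟨e, he, hle⟩ := he
      have hl : lam (s * (e : S)) = e := lam_mul_proj_of_le hle
      rw [fiberSum_eq_single (t := s * (e : S)) (by rw [hl, he])]
      · rw [germIndicator_apply_of_mem, one_smul, map_mul, mul_assoc, ← projRep_ofProj, ← map_mul,
          atom, ← mul_assoc, prod_ofProj, ← he, ← ofProj_mul, proj_idem]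
        rw [principalGerm_mem_germSet, hl]
        exact ⟨hle, principalChar_apply.2 hle, rfl⟩
      · intro t' ht' h0
        have := not_imp_comm.1 germIndicator_apply_of_notMem h0
        rw [principalGerm_mem_germSet] at this
        rw [← this.2.2, WithOne.coe_inj.1 (ht'.trans he.symm)]
    · rw [hz, fiberSum_eq_zero, zero_mul]
      · intro t' ht'
        refine germIndicator_apply_of_notMem fun h => he ⟨lam t', ht', ?_⟩
        rw [principalGerm_mem_germSet] at h
        exact h.1
      · intro h
        have h1 := meet_mul_of_mem h
        -- The meet cannot be the adjoined unit, since it is absorbed by the projection `lam s`.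
        rcases hm : meet F' with _ | e
        · change meet F' = 1 at hm
          rw [hm, one_mul] at h1
          exact WithOne.coe_ne_one h1
        · exact he ⟨e, hm.symm, le_of_meet_eq hm.symm h⟩
  rw [valueOp, Finset.sum_congr rfl key, ← Finset.mul_sum, ← map_sum, sum_atom, map_one, mul_one]

/-- It is enough that `F` contains `lam s` for the finitely many `s` that occur in `a`; the net is
then constant. -/
theorem eventually_valueOp_germHom (a : MonoidAlgebra ℂ S) :
    ∀ᶠ F in Filter.atTop, valueOp σ F (germHom S a).1 = MonoidAlgebra.liftMagma ℂ σ a := by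
  induction a using MonoidAlgebra.induction_linear with
  | zero =>
    refine Filter.Eventually.of_forall fun F => ?_
    rw [map_zero, map_zero]
    exact valueOp_zero F
  | add a b ha hb =>
    filter_upwards [ha, hb] with F ha hb
    rw [map_add, map_add, ← ha, ← hb]
    exact valueOp_add (germHom S a).2 (germHom S b).2 F
  | single s c =>
    filter_upwards [Filter.eventually_ge_atTop {lam s}] with F hF
    have h : MonoidAlgebra.single s c = c • MonoidAlgebra.single s (1 : ℂ) := by simp
    rw [h, map_smul, map_smul, germHom_single, liftMagma_single]
    change valueOp σ F (c • (germIndicator s).1) = _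
    rw [valueOp_smul, valueOp_germIndicator (Finset.singleton_subset_iff.1 hF)]

end Value

end RestrictionSemigroup

/-! ### Basic sets of characters -/

theorem IsCc.add {M : Type v} [TopologicalSpace M] {V : Set M} {f g : M → ℂ} (hf : IsCc V f)
    (hg : IsCc V g) : IsCc V (f + g) :=
  ⟨hf.1.add hg.1, HasCompactSupport.add hf.2.1 hg.2.1, fun x hx => by
    rw [Pi.add_apply, hf.2.2 x hx, hg.2.2 x hx, add_zero]⟩

theorem IsCc.mul_left {M : Type v} [TopologicalSpace M] {V : Set M} {f g : M → ℂ}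
    (hf : Continuous f) (hg : IsCc V g) : IsCc V (f * g) :=
  ⟨(hf.comp continuous_subtype_val).mul hg.1, HasCompactSupport.mul_left hg.2.1, fun x hx => by
    rw [Pi.mul_apply, hg.2.2 x hx, mul_zero]⟩

theorem IsCc.sub {M : Type v} [TopologicalSpace M] {V : Set M} {f g : M → ℂ} (hf : IsCc V f)
    (hg : IsCc V g) : IsCc V (f - g) := by
  have := hf.add (hg.mul_left (continuous_const (y := (-1 : ℂ))))
  convert this using 1
  ext x
  simp [sub_eq_add_neg]

theorem IsCc.bddAbove {M : Type v} [TopologicalSpace M] {V : Set M} {f : M → ℂ} (hf : IsCc V f) :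
    BddAbove (Set.range fun x => ‖f x‖) := by
  obtain ⟨B, hB⟩ := hf.2.1.exists_bound_of_continuous hf.1
  refine ⟨max B 0, ?_⟩
  rintro _ ⟨x, rfl⟩
  by_cases hx : x ∈ V
  · exact (hB ⟨x, hx⟩).trans (le_max_left _ _)
  · simp [hf.2.2 x hx]

theorem IsCc.norm_le_iSup {M : Type v} [TopologicalSpace M] {V : Set M} {f : M → ℂ}
    (hf : IsCc V f) (x : M) : ‖f x‖ ≤ ⨆ x, ‖f x‖ :=
  le_ciSup hf.bddAbove x

namespace RestrictionSemigroup

open EtaleAction hiding map_mul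

variable {S : Type u} [RestrictionSemigroup S]

/-- The compact open set of all characters which are `1` at `e` and `0` on `G`. -/
def basicSet (e : Proj S) (G : Finset (Proj S)) : Set (SemilatticeSpectrum (Proj S)) :=
  {φ | φ e = true ∧ ∀ g ∈ G, φ g = false}

theorem isOpen_basicSet (e : Proj S) (G : Finset (Proj S)) : IsOpen (basicSet e G) := by
  have : basicSet e G = {φ | φ e = true} ∩ ⋂ g ∈ G, {φ | φ g = false} := by
    ext φ
    simp [basicSet]
  rw [this]
  refine (SemilatticeSpectrum.isOpen_eval e).inter (isOpen_biInter_finset fun g _ => ?_)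
  exact (isOpen_discrete {false}).preimage (SemilatticeSpectrum.continuous_eval g)

theorem isCompact_basicSet (e : Proj S) (G : Finset (Proj S)) : IsCompact (basicSet e G) := by
  have : basicSet e G = {φ | φ e = true} ∩ ⋂ g ∈ G, {φ | φ g = false} := by
    ext φ
    simp [basicSet]
  rw [this]
  refine (SemilatticeSpectrum.isCompact_eval e).inter_right
    (isClosed_biInter fun g _ => ?_)
  exact (isClosed_discrete {false}).preimage (SemilatticeSpectrum.continuous_eval g)

/-- The projections at which `φ` is `1` form a non-empty set closed under products. The empty case
uses that `φ` is not zero. -/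
theorem exists_proj_le (φ : SemilatticeSpectrum (Proj S)) (F : Finset (Proj S)) :
    ∃ e, φ e = true ∧ ∀ g ∈ F, φ g = true → e * g = e := by
  classical
  induction F using Finset.induction_on with
  | empty => exact φ.2.2.imp fun e he => ⟨he, by simp⟩
  | insert g F _ ih =>
    obtain ⟨e, he, h⟩ := ih
    by_cases hg : φ g = true
    · refine ⟨e * g, by rw [φ.2.1, he, hg, Bool.true_and], fun f hf hφ => ?_⟩
      rcases Finset.mem_insert.1 hf with rfl | hf
      · rw [mul_assoc, proj_idem]
      · rw [mul_right_comm, h f hf hφ]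
    · refine ⟨e, he, fun f hf hφ => ?_⟩
      rcases Finset.mem_insert.1 hf with rfl | hf
      · exact absurd hφ hg
      · exact h f hf hφ

/-- A neighbourhood in the topology of pointwise convergence prescribes finitely many values. Those
equal to `1` follow from the value at one smaller projection `e`, and those equal to `0` are
collected in `G`. -/
theorem exists_basicSet {φ : SemilatticeSpectrum (Proj S)}
    {W : Set (SemilatticeSpectrum (Proj S))} (hW : IsOpen W) (hφ : φ ∈ W) :
    ∃ e G, φ ∈ basicSet e G ∧ basicSet e G ⊆ W := by
  classical
  obtain ⟨W', hW', rfl⟩ := isOpen_induced_iff.1 hW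
  obtain ⟨I, u, hu, hI⟩ := isOpen_pi_iff.1 hW' _ hφ
  obtain ⟨e, he, h⟩ := exists_proj_le φ I
  refine ⟨e, I.filter fun g => φ g = false, ⟨he, fun g hg => (Finset.mem_filter.1 hg).2⟩, ?_⟩
  rintro ψ ⟨hψ, hψ'⟩
  refine hI fun g hg => ?_
  have : ψ g = φ g := by
    by_cases hg' : φ g = true
    · rw [hg']
      exact char_of_le hψ (h g hg hg')
    · have hf := Bool.eq_false_of_not_eq_true hg'
      rw [hf]
      exact hψ' g (Finset.mem_filter.2 ⟨hg, hf⟩)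
  change ψ g ∈ u g
  rw [this]
  exact (hu g hg).2

theorem exists_germSet_basicSet {q : (canonicalAction S).Germ} {U : Set (canonicalAction S).Germ}
    (hU : IsOpen U) (hq : q ∈ U) :
    ∃ s e G, q ∈ germSet s (basicSet e G) ∧ basicSet e G ⊆ (canonicalAction S).dom s ∧
      germSet s (basicSet e G) ⊆ U := by
  obtain ⟨s, x, hx, rfl⟩ := exists_germ q
  have h1 : IsOpen (Subtype.val '' (germSection (θ := canonicalAction S) s ⁻¹' U)) :=
    (isOpen_dom s).isOpenMap_subtype_val _
      (hU.preimage (isOpenEmbedding_germSection s).continuous)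
  obtain ⟨e, G, hxe, h⟩ := exists_basicSet h1 ⟨⟨x, hx⟩, hq, rfl⟩
  refine ⟨s, e, G, ⟨x, hx, hxe, rfl⟩, fun y hy => ?_, ?_⟩
  · obtain ⟨z, -, rfl⟩ := h hy
    exact z.2
  · rintro _ ⟨y, hy, hye, rfl⟩
    obtain ⟨z, hz, rfl⟩ := h hye
    exact hz

/-! ### The bound on functions supported in a bisection -/

/-- A compact subset `K` of an open set `U` of germs is saturated in `U` by all sufficiently fine
finite families of projections. -/
theorem exists_finset_saturated {U K : Set (canonicalAction S).Germ} (hU : IsOpen U)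
    (hK : IsCompact K) (hKU : K ⊆ U) :
    ∃ F₀ : Finset (Proj S), ∀ F, F₀ ⊆ F → ∀ F' ⊆ F, ∀ t : S,
      (lam t : WithOne (Proj S)) = meet F' → principalGerm t ∈ K →
      ∀ (x : SemilatticeSpectrum (Proj S)) (hx : x ∈ (canonicalAction S).dom t),
        (∀ g ∈ F, g ∉ F' → x g = false) → germ t x hx ∈ U := by
  classical
  suffices ∃ F₀ : Finset (Proj S), ∀ F, F₀ ⊆ F → ∀ F' ⊆ F, ∀ t : S,
      (lam t : WithOne (Proj S)) = meet F' → principalGerm t ∈ K →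
      ∀ (x : SemilatticeSpectrum (Proj S)) (hx : x ∈ (canonicalAction S).dom t),
        (∀ g ∈ F, g ∉ F' → x g = false) → germ t x hx ∈ U from this
  refine hK.induction_on (p := fun K => ∃ F₀ : Finset (Proj S), ∀ F, F₀ ⊆ F → ∀ F' ⊆ F, ∀ t : S,
      (lam t : WithOne (Proj S)) = meet F' → principalGerm t ∈ K →
      ∀ (x : SemilatticeSpectrum (Proj S)) (hx : x ∈ (canonicalAction S).dom t),
        (∀ g ∈ F, g ∉ F' → x g = false) → germ t x hx ∈ U) ?_ ?_ ?_ ?_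
  · exact ⟨∅, fun F _ F' _ t _ h => absurd h (Set.notMem_empty _)⟩
  · rintro K K' hKK' ⟨F₀, h⟩
    exact ⟨F₀, fun F hF F' hF' t ht hK => h F hF F' hF' t ht (hKK' hK)⟩
  · rintro K K' ⟨F₀, h⟩ ⟨F₁, h'⟩
    refine ⟨F₀ ∪ F₁, fun F hF F' hF' t ht hK => ?_⟩
    rcases hK with hK | hK
    · exact h F (Finset.union_subset_left hF) F' hF' t ht hK
    · exact h' F (Finset.union_subset_right hF) F' hF' t ht hK
  · intro q hq
    obtain ⟨s, e, G, hqs, -, hs⟩ := exists_germSet_basicSet hU (hKU hq)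
    -- Locally `F₀` consists of the projections that define the basic neighbourhood. A family
    -- containing them has cells fine enough to stay inside it whenever the sampled germ does.
    refine ⟨_, mem_nhdsWithin_of_mem_nhds ((isOpen_germSet s (isOpen_basicSet e G)).mem_nhds hqs),
      insert e G, fun F hF F' hF' t ht htK x hx hxF => hs ?_⟩
    obtain ⟨hle, ⟨hte, htG⟩, hst⟩ := principalGerm_mem_germSet.1 htK
    have hxl : x (lam t) = true := hx
    -- Conditions with value `1` pass from the sample to `x` because `x (lam t) = 1`. A `g ∈ G`
    -- cannot belong to `F'`: otherwise `lam t = meet F'` would lie below `g`, against the vanishing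
    -- of the sample at `g`. So `x g = 0` by the choice of the cell.
    refine germ_mem_germSet.2 ⟨char_of_le hxl hle, ⟨char_of_le hxl (principalChar_apply.1 hte),
      fun g hg => hxF g (hF (Finset.mem_insert_of_mem hg)) fun hg' => ?_⟩, ?_⟩
    · have := htG g hg
      rw [principalChar_apply.2 (le_of_meet_eq ht hg')] at this
      exact Bool.noConfusion this
    -- The relation `s * lam t = t`, read off at the sample, identifies the germs of `s` and `t` at
    -- every point of the domain of `θ_t`.
    · exact germ_eq.2 ⟨rfl, lam t, mem_canonicalAction_dom_proj.2 hx, by rw [hst, mul_lam]⟩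

theorem canonicalMap_symm_apply {t : S} {ψ : SemilatticeSpectrum (Proj S)} (h : ψ (rho t) = true)
    (g : Proj S) : (canonicalMap t).symm ψ g = ψ (rho (t * (g : S))) := by
  have : (canonicalMap t).symm ψ = pullChar t ψ h := dif_pos h
  rw [this]
  rfl

section Bound

variable {H : Type w} [NormedAddCommGroup H] [InnerProductSpace ℂ H] {σ : S →ₙ* (H →L[ℂ] H)}

/-- The source map is injective on `U`, so at most one germ over a given principal character
contributes. -/
theorem fiberSum_of_isBisection {U : Set (canonicalAction S).Germ}
    (hU : (canonicalAction S).germCategory.IsBisection U) {f : (canonicalAction S).Germ → ℂ}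
    (hf : ∀ x, x ∉ U → f x = 0) (e : WithOne (Proj S)) :
    fiberSum σ f e = 0 ∨ ∃ t, (lam t : WithOne (Proj S)) = e ∧ f (principalGerm t) ≠ 0 ∧
      fiberSum σ f e = f (principalGerm t) • σ t := by
  by_cases h : ∃ t, (lam t : WithOne (Proj S)) = e ∧ f (principalGerm t) ≠ 0
  · obtain ⟨t, ht, h0⟩ := h
    refine Or.inr ⟨t, ht, h0, fiberSum_eq_single ht fun t' ht' h' => ?_⟩
    have hl : lam t' = lam t := WithOne.coe_inj.1 (ht'.trans ht.symm)
    refine principalGerm_injOn hl (hU.injOn_d (not_imp_comm.1 (hf _) h')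
      (not_imp_comm.1 (hf _) h0) ?_)
    change principalChar (lam t') = principalChar (lam t)
    rw [hl]
  · push Not at h
    exact Or.inl (fiberSum_eq_zero h)

variable [CompleteSpace H]

/-- Each summand is a contraction times a scalar of modulus at most `M`, and for fine `F` the
summands have orthogonal ranges. The bound is thus a maximum over the cells instead of a sum. -/
theorem eventually_norm_valueOp_le (hσ : IsRepresentation σ) {U : Set (canonicalAction S).Germ}
    (hU : (canonicalAction S).germCategory.IsBisection U) {f : (canonicalAction S).Germ → ℂ}
    (hf : IsCc U f) {M : ℝ} (hM : 0 ≤ M) (hfM : ∀ x, ‖f x‖ ≤ M) :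
    ∀ᶠ F in Filter.atTop, ‖valueOp σ F f‖ ≤ M := by
  classical
  have := hU.t2Space
  obtain ⟨-, K, hKU, hK, hfK⟩ := isCc_iff.1 hf
  obtain ⟨F₀, hF₀⟩ := exists_finset_saturated hU.isOpen hK hKU
  filter_upwards [Filter.eventually_ge_atTop F₀] with F hF
  refine norm_sum_mul_atom_le hσ hM (fun F' _ => ?_) fun F₁ h₁ F₂ h₂ hne x y => ?_
  · rcases fiberSum_of_isBisection (σ := σ) hU hf.2.2 (meet F') with h | ⟨t, -, -, h⟩
    · rwa [h, norm_zero]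
    · rw [h, norm_smul]
      exact (mul_le_of_le_one_right (norm_nonneg _) (hσ.norm_le_one t)).trans (hfM _)
  · rcases fiberSum_of_isBisection (σ := σ) hU hf.2.2 (meet F₁) with h | ⟨t₁, ht₁, h0₁, e₁⟩
    · rw [h, zero_mul, zero_apply, inner_zero_left]
    rcases fiberSum_of_isBisection (σ := σ) hU hf.2.2 (meet F₂) with h | ⟨t₂, ht₂, h0₂, e₂⟩
    · rw [h, zero_mul, zero_apply, inner_zero_right]
    rw [e₁, e₂, smul_mul_assoc, smul_mul_assoc, smul_apply, smul_apply, inner_smul_left,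
      inner_smul_right, inner_mul_atom_eq_zero hσ ht₁ ht₂, mul_zero, mul_zero]
    -- A common point `ψ` of the two images is pulled back along `t₁` and `t₂`. Saturation puts both
    -- resulting germs in `U`.
    intro ψ hψ₁ hψ₂ hg₁ hg₂
    have m₁ : (canonicalMap t₁).symm ψ ∈ (canonicalAction S).dom t₁ :=
      (canonicalMap t₁).map_target hψ₁
    have m₂ : (canonicalMap t₂).symm ψ ∈ (canonicalAction S).dom t₂ :=
      (canonicalMap t₂).map_target hψ₂
    have z₁ : ∀ g ∈ F, g ∉ F₁ → (canonicalMap t₁).symm ψ g = false := fun g hg hg' => by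
      rw [canonicalMap_symm_apply hψ₁]
      exact hg₁ g (Finset.mem_sdiff.2 ⟨hg, hg'⟩)
    have z₂ : ∀ g ∈ F, g ∉ F₂ → (canonicalMap t₂).symm ψ g = false := fun g hg hg' => by
      rw [canonicalMap_symm_apply hψ₂]
      exact hg₂ g (Finset.mem_sdiff.2 ⟨hg, hg'⟩)
    have u₁ := hF₀ F hF F₁ h₁ t₁ ht₁ (not_imp_comm.1 (hfK _) h0₁) _ m₁ z₁
    have u₂ := hF₀ F hF F₂ h₂ t₂ ht₂ (not_imp_comm.1 (hfK _) h0₂) _ m₂ z₂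
    -- Both germs have range `ψ`, so they coincide, and so do their sources. This common source lies
    -- in the cells of `F₁` and of `F₂`, which forces `F₁ = F₂`.
    have hr := hU.injOn_r u₁ u₂ (((canonicalMap t₁).right_inv hψ₁).trans
      ((canonicalMap t₂).right_inv hψ₂).symm)
    have hx : (canonicalMap t₁).symm ψ = (canonicalMap t₂).symm ψ := (germ_eq.1 hr).1
    refine hne (Finset.Subset.antisymm (fun g hg => ?_) fun g hg => ?_)
    · by_contra hc
      have h1 := char_of_le (φ := (canonicalMap t₁).symm ψ) m₁ (le_of_meet_eq ht₁ hg)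
      rw [hx, z₂ g (h₁ hg) hc] at h1
      exact Bool.noConfusion h1
    · by_contra hc
      have h1 := char_of_le (φ := (canonicalMap t₂).symm ψ) m₂ (le_of_meet_eq ht₂ hg)
      rw [← hx, z₁ g (h₂ hg) hc] at h1
      exact Bool.noConfusion h1

end Bound

/-! ### Approximation by elements of the semigroup algebra -/

/-- Continuous `{0, 1}`-valued functions on the spectrum such that multiplication by them preserves
the image of the semigroup algebra. -/
structure IsMultiplier (χ : SemilatticeSpectrum (Proj S) → ℂ) : Prop where
  continuous : Continuous χ
  zero_or_one : ∀ x, χ x = 0 ∨ χ x = 1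
  mul_mem : ∀ a : MonoidAlgebra ℂ S, ∃ b : MonoidAlgebra ℂ S,
    (germHom S b).1 = (χ ∘ germSource) * (germHom S a).1

theorem germHom_add_coe (a b : MonoidAlgebra ℂ S) :
    (germHom S (a + b)).1 = (germHom S a).1 + (germHom S b).1 := by
  rw [map_add]
  rfl

theorem germHom_sub_coe (a b : MonoidAlgebra ℂ S) :
    (germHom S (a - b)).1 = (germHom S a).1 - (germHom S b).1 := by
  rw [map_sub]
  rfl

theorem germHom_smul_coe (c : ℂ) (a : MonoidAlgebra ℂ S) :
    (germHom S (c • a)).1 = c • (germHom S a).1 := by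
  rw [map_smul]
  rfl

theorem germHom_zero_coe : (germHom S (0 : MonoidAlgebra ℂ S)).1 = 0 := by
  rw [map_zero]
  rfl

theorem isMultiplier_zero : IsMultiplier (0 : SemilatticeSpectrum (Proj S) → ℂ) where
  continuous := continuous_const
  zero_or_one _ := Or.inl rfl
  mul_mem a := ⟨0, by
    rw [germHom_zero_coe]
    ext q
    simp⟩

theorem IsMultiplier.mul {χ χ' : SemilatticeSpectrum (Proj S) → ℂ} (h : IsMultiplier χ)
    (h' : IsMultiplier χ') : IsMultiplier (χ * χ') where
  continuous := h.continuous.mul h'.continuous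
  zero_or_one x := by
    rcases h.zero_or_one x with e | e <;> rcases h'.zero_or_one x with e' | e' <;> simp [e, e']
  mul_mem a := by
    obtain ⟨b, hb⟩ := h'.mul_mem a
    obtain ⟨c, hc⟩ := h.mul_mem b
    refine ⟨c, ?_⟩
    rw [hc, hb, ← mul_assoc]
    rfl

theorem IsMultiplier.one_sub_mul_mem {χ : SemilatticeSpectrum (Proj S) → ℂ} (h : IsMultiplier χ)
    (a : MonoidAlgebra ℂ S) : ∃ b : MonoidAlgebra ℂ S,
      (germHom S b).1 = (((1 : SemilatticeSpectrum (Proj S) → ℂ) - χ) ∘ germSource) *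
        (germHom S a).1 := by
  obtain ⟨b, hb⟩ := h.mul_mem a
  refine ⟨a - b, ?_⟩
  rw [germHom_sub_coe, hb]
  ext q
  simp [sub_mul]

theorem IsMultiplier.one_sub {χ : SemilatticeSpectrum (Proj S) → ℂ} (h : IsMultiplier χ) :
    IsMultiplier (1 - χ) where
  continuous := continuous_const.sub h.continuous
  zero_or_one x := by
    rcases h.zero_or_one x with e | e <;> simp [e]
  mul_mem := h.one_sub_mul_mem

/-- Restricting `Θ_s` to sources at which `e` is `1` gives `Θ_{s e}`, so multiplication corresponds
to `δ_s ↦ δ_{s e}`. -/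
theorem isMultiplier_eval (e : Proj S) :
    IsMultiplier (Set.indicator {φ : SemilatticeSpectrum (Proj S) | φ e = true} 1) where
  continuous := by
    have h : IsClopen {φ : SemilatticeSpectrum (Proj S) | φ e = true} :=
      (isClopen_discrete {true}).preimage (SemilatticeSpectrum.continuous_eval e)
    exact (IsClopen.continuous_indicator h continuous_one)
  zero_or_one x := by
    rcases Set.indicator_eq_zero_or_self {φ : SemilatticeSpectrum (Proj S) | φ e = true}
      (1 : SemilatticeSpectrum (Proj S) → ℂ) x with h | h
    · exact Or.inl h
    · exact Or.inr h
  mul_mem a := by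
    induction a using MonoidAlgebra.induction_linear with
    | zero => exact ⟨0, by rw [germHom_zero_coe, mul_zero]⟩
    | add a b ha hb =>
      obtain ⟨a', ha⟩ := ha
      obtain ⟨b', hb⟩ := hb
      exact ⟨a' + b', by rw [germHom_add_coe, germHom_add_coe, ha, hb, mul_add]⟩
    | single s c =>
      refine ⟨c • MonoidAlgebra.single (s * (e : S)) 1, ?_⟩
      have h : MonoidAlgebra.single s c = c • MonoidAlgebra.single s (1 : ℂ) := by simp
      rw [h, germHom_smul_coe, germHom_smul_coe, germHom_single, germHom_single, mul_smul_comm]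
      congr 1
      ext q
      obtain ⟨t, x, hx, rfl⟩ := exists_germ q
      rw [Pi.mul_apply, Function.comp_apply, germSource_germ]
      by_cases hxe : x e = true
      · rw [Set.indicator_of_mem (s := {φ : SemilatticeSpectrum (Proj S) | φ e = true}) hxe, Pi.one_apply, one_mul]
        have : germ t x hx ∈ germSet (θ := canonicalAction S) (s * (e : S))
            ((canonicalAction S).dom (s * (e : S))) ↔
            germ t x hx ∈ germSet s ((canonicalAction S).dom s) := by
          rw [germ_mem_germSet, germ_mem_germSet]
          have hse : ∀ (h1 : x ∈ (canonicalAction S).dom (s * (e : S)))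
              (h2 : x ∈ (canonicalAction S).dom s), germ (s * (e : S)) x h1 = germ s x h2 :=
            fun h1 h2 => germ_eq.2 ⟨rfl, e, mem_canonicalAction_dom_proj.2 hxe, by
              rw [mul_assoc, ← MulMemClass.coe_mul, proj_idem]⟩
          constructor
          · rintro ⟨h1, -, h2⟩
            have h3 := ((canonicalAction S).mem_dom_mul_proj.1 h1).2
            exact ⟨h3, h3, h2.trans (hse _ _)⟩
          · rintro ⟨h1, -, h2⟩
            have h3 := (canonicalAction S).mem_dom_mul_proj.2
              ⟨mem_canonicalAction_dom_proj.2 hxe, h1⟩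
            exact ⟨h3, h3, h2.trans (hse _ _).symm⟩
        by_cases hm : germ t x hx ∈ germSet s ((canonicalAction S).dom s)
        · rw [germIndicator_apply_of_mem hm, germIndicator_apply_of_mem (this.2 hm)]
        · rw [germIndicator_apply_of_notMem hm, germIndicator_apply_of_notMem (mt this.1 hm)]
      · rw [Set.indicator_of_notMem (s := {φ : SemilatticeSpectrum (Proj S) | φ e = true}) hxe, zero_mul, germIndicator_apply_of_notMem]
        intro hm
        obtain ⟨h1, -, -⟩ := germ_mem_germSet.1 hm
        exact hxe (mem_canonicalAction_dom_proj.1 ((canonicalAction S).mem_dom_mul_proj.1 h1).1)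

/-- The indicator is the product of the indicator of `D_e` and of the complementary indicators for
`g ∈ G`. This is how differences in `ℂ[S]` realize negative conditions. -/
theorem isMultiplier_basicSet (e : Proj S) (G : Finset (Proj S)) :
    IsMultiplier (Set.indicator (basicSet e G) 1) := by
  classical
  induction G using Finset.induction_on with
  | empty =>
    convert isMultiplier_eval e using 3
    simp [basicSet]
  | insert g G _ ih =>
    convert ((isMultiplier_eval g).one_sub).mul ih using 1
    ext x
    by_cases h1 : x g = true <;> by_cases h2 : x ∈ basicSet e G
    · have : x ∉ basicSet e (insert g G) := fun h => by
        have := h.2 g (Finset.mem_insert_self _ _)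
        rw [h1] at this
        exact Bool.noConfusion this
      simp [this, h1]
    · have : x ∉ basicSet e (insert g G) := fun h =>
        h2 ⟨h.1, fun f hf => h.2 f (Finset.mem_insert_of_mem hf)⟩
      simp [this, h2]
    · have : x ∈ basicSet e (insert g G) := ⟨h2.1, fun f hf => by
        rcases Finset.mem_insert.1 hf with rfl | hf
        · exact Bool.eq_false_of_not_eq_true h1
        · exact h2.2 f hf⟩
      simp [this, h1, h2]
    · have : x ∉ basicSet e (insert g G) := fun h =>
        h2 ⟨h.1, fun f hf => h.2 f (Finset.mem_insert_of_mem hf)⟩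
      simp [this, h2]

theorem continuous_germSource : Continuous (germSource (θ := canonicalAction S)) :=
  isLocalHomeomorph_germSource.continuous

/-- Functions in `C_c(U)`, for a bisection `U`, are approximated uniformly by functions in `C_c(U)`
which come from the semigroup algebra. -/
theorem exists_norm_sub_germHom_le {U : Set (canonicalAction S).Germ}
    (hU : (canonicalAction S).germCategory.IsBisection U) {f : (canonicalAction S).Germ → ℂ}
    (hf : IsCc U f) {ε : ℝ} (hε : 0 < ε) :
    ∃ a : MonoidAlgebra ℂ S, IsCc U (germHom S a).1 ∧ ∀ q, ‖(f - (germHom S a).1) q‖ ≤ ε := by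
  have := hU.t2Space
  obtain ⟨hfc, K, hKU, hK, hfK⟩ := isCc_iff.1 hf
  -- The multiplier `χ` marks the sources of the region already treated: there the error is at most
  -- `ε`, elsewhere in `U` the approximant is zero. Carrying `χ` along allows disjointification in
  -- the compactness induction.
  have key : ∃ (χ : SemilatticeSpectrum (Proj S) → ℂ) (a : MonoidAlgebra ℂ S), IsMultiplier χ ∧
      IsCc U (germHom S a).1 ∧ (∀ q ∈ K, q ∈ U → χ (germSource q) = 1) ∧
      (∀ q ∈ U, χ (germSource q) = 1 → ‖(f - (germHom S a).1) q‖ ≤ ε) ∧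
      ∀ q ∈ U, χ (germSource q) = 0 → (germHom S a).1 q = 0 := by
    refine hK.induction_on (p := fun K => ∃ (χ : SemilatticeSpectrum (Proj S) → ℂ)
      (a : MonoidAlgebra ℂ S), IsMultiplier χ ∧
      IsCc U (germHom S a).1 ∧ (∀ q ∈ K, q ∈ U → χ (germSource q) = 1) ∧
      (∀ q ∈ U, χ (germSource q) = 1 → ‖(f - (germHom S a).1) q‖ ≤ ε) ∧
      ∀ q ∈ U, χ (germSource q) = 0 → (germHom S a).1 q = 0) ?_ ?_ ?_ ?_
    · refine ⟨0, 0, isMultiplier_zero, ?_, fun q hq => absurd hq (Set.notMem_empty _), ?_, ?_⟩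
      · rw [germHom_zero_coe]
        exact ⟨continuous_const, HasCompactSupport.zero, fun _ _ => rfl⟩
      · intro q _ h
        exact absurd h zero_ne_one
      · intro q _ _
        rw [germHom_zero_coe]
        rfl
    · rintro K K' hKK' ⟨χ, a, h1, h2, h3, h4⟩
      exact ⟨χ, a, h1, h2, fun q hq => h3 q (hKK' hq), h4⟩
    -- The second approximant is used only where `χ = 0`, so the errors do not add. The new region
    -- is the union of the two, with indicator `1 - (1 - χ) (1 - χ')`.
    · rintro K K' ⟨χ, a, h1, h2, h3, h4, h5⟩ ⟨χ', a', h1', h2', h3', h4', h5'⟩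
      obtain ⟨b, hb⟩ := h1.one_sub.mul_mem a'
      have hval : ∀ q, (germHom S (a + b)).1 q =
          (germHom S a).1 q + (1 - χ (germSource q)) * (germHom S a').1 q := fun q => by
        rw [germHom_add_coe, hb]
        rfl
      refine ⟨1 - (1 - χ) * (1 - χ'), a + b, (h1.one_sub.mul h1'.one_sub).one_sub, ?_, ?_, ?_, ?_⟩
      · rw [germHom_add_coe, hb]
        exact h2.add (h2'.mul_left (h1.one_sub.continuous.comp continuous_germSource))
      · rintro q (hq | hq) hqU
        · simp [h3 q hq hqU]
        · simp [h3' q hq hqU]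
      · intro q hq hχ
        rw [Pi.sub_apply, hval]
        rcases h1.zero_or_one (germSource q) with h | h
        · have h' : χ' (germSource q) = 1 := by simpa [h] using hχ
          rw [h, h5 q hq h, sub_zero, one_mul, zero_add]
          exact h4' q hq h'
        · rw [h, sub_self, zero_mul, add_zero]
          exact h4 q hq h
      · intro q hq hχ
        rw [hval]
        rcases h1.zero_or_one (germSource q) with h | h
        · have h' : χ' (germSource q) = 0 := by simpa [h] using hχ
          rw [h5 q hq h, h5' q hq h', mul_zero, zero_add]
        · simp [h] at hχ
    · intro q hq
      -- On this neighbourhood the constant `f q` approximates `f` within `ε`, so a multiple of a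
      -- restricted `1_{Θ_s}` suffices.
      have hW : IsOpen (U ∩ f ⁻¹' Metric.ball (f q) ε) :=
        hfc.isOpen_inter_preimage hU.isOpen Metric.isOpen_ball
      obtain ⟨s, e, G, hqs, hdom, hs⟩ :=
        exists_germSet_basicSet hW ⟨hKU hq, Metric.mem_ball_self hε⟩
      obtain ⟨b, hb⟩ := (isMultiplier_basicSet e G).mul_mem (f q • MonoidAlgebra.single s 1)
      have hχ := isMultiplier_basicSet e G
      -- Injectivity of the source map on `U` lets the multiplier, which sees only sources, decide
      -- membership in the set of germs.
      have hmem : ∀ q' ∈ U, germSource q' ∈ basicSet e G → q' ∈ germSet s (basicSet e G) := by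
        intro q' hq' h
        have hm : germ s (germSource q') (hdom h) ∈ germSet s (basicSet e G) :=
          ⟨_, hdom h, h, rfl⟩
        have : q' = germ s (germSource q') (hdom h) := hU.injOn_d hq' (hs hm).1 rfl
        rw [this]
        exact hm
      have hin : ∀ q' ∈ germSet s (basicSet e G), (germHom S b).1 q' = f q := by
        rintro _ ⟨x, hx, hxe, rfl⟩
        rw [hb, germHom_smul_coe, germHom_single]
        simp only [Pi.mul_apply, Function.comp_apply, germSource_germ, Pi.smul_apply]
        rw [Set.indicator_of_mem hxe, germIndicator_apply_of_mem ⟨x, hx, hx, rfl⟩]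
        simp
      have hout : ∀ q', q' ∉ germSet s (basicSet e G) → (germHom S b).1 q' = 0 := by
        intro q' hq'
        rw [hb, germHom_smul_coe, germHom_single]
        simp only [Pi.mul_apply, Function.comp_apply, Pi.smul_apply]
        by_cases hx : germSource q' ∈ basicSet e G
        · rw [germIndicator_apply_of_notMem, smul_zero, mul_zero]
          rintro ⟨x, hx', -, rfl⟩
          exact hq' ⟨x, hx', hx, rfl⟩
        · rw [Set.indicator_of_notMem hx, zero_mul]
      refine ⟨_, mem_nhdsWithin_of_mem_nhds ((isOpen_germSet s (isOpen_basicSet e G)).mem_nhds hqs),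
        _, b, hχ, ?_, ?_, ?_, ?_⟩
      · refine isCc_iff.2 ⟨?_, _, fun q' hq' => (hs hq').1, ?_, hout⟩
        · have hc : ContinuousOn (fun q' : (canonicalAction S).Germ =>
              Set.indicator (basicSet e G) 1 (germSource q') * f q) U :=
            ((hχ.continuous.comp continuous_germSource).mul continuous_const).continuousOn
          refine hc.congr fun q' hq' => ?_
          by_cases hx : germSource q' ∈ basicSet e G
          · simp [hin q' (hmem q' hq' hx), hx]
          · change _ = Set.indicator (basicSet e G) 1 (germSource q') * f q
            rw [hout, Set.indicator_of_notMem hx, zero_mul]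
            rintro ⟨x, hx', h, rfl⟩
            exact hx h
        · rw [germSet_eq_image]
          refine IsCompact.image ?_ (isOpenEmbedding_germSection s).continuous
          rw [Topology.IsEmbedding.subtypeVal.isCompact_iff, Subtype.image_preimage_coe,
            Set.inter_eq_right.2 hdom]
          exact isCompact_basicSet e G
      · rintro q' ⟨x, hx, h, rfl⟩ -
        rw [germSource_germ, Set.indicator_of_mem h, Pi.one_apply]
      · intro q' hq' h
        have hx : germSource q' ∈ basicSet e G := Set.mem_of_indicator_ne_zero (h ▸ one_ne_zero)
        rw [Pi.sub_apply, hin q' (hmem q' hq' hx), ← dist_eq_norm]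
        exact (Metric.mem_ball.1 (hs (hmem q' hq' hx)).2).le
      · intro q' hq' h
        refine hout q' ?_
        rintro ⟨x, hx', h', rfl⟩
        rw [germSource_germ, Set.indicator_of_mem h'] at h
        exact one_ne_zero h
  obtain ⟨χ, a, h1, h2, h3, h4, h5⟩ := key
  refine ⟨a, h2, fun q => ?_⟩
  by_cases hq : q ∈ U
  · rcases h1.zero_or_one (germSource q) with h | h
    · have hqK : q ∉ K := fun hqK => zero_ne_one (h.symm.trans (h3 q hqK hq))
      rw [Pi.sub_apply, hfK q hqK, h5 q hq h, sub_zero, norm_zero]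
      exact hε.le
    · exact h4 q hq h
  · rw [Pi.sub_apply, hf.2.2 q hq, h2.2.2 q hq, sub_zero, norm_zero]
    exact hε.le

end RestrictionSemigroup

/-! ### The extension of a representation to the convolution algebra -/

namespace EtaleCategory

/-- For functions supported in bisections a convolution value is either zero or a single product, so
the supremum norm is submultiplicative on them. -/
theorem norm_conv_le {X : Type u} {M : Type v} [TopologicalSpace X] [TopologicalSpace M]
    {C : EtaleCategory X M} {U V : Set M} (hU : C.IsBisection U) (hV : C.IsBisection V)
    {f g : M → ℂ} (hf : ∀ x, x ∉ U → f x = 0) (hg : ∀ x, x ∉ V → g x = 0) {a b : ℝ}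
    (ha : 0 ≤ a) (hb : 0 ≤ b) (hfa : ∀ x, ‖f x‖ ≤ a) (hgb : ∀ x, ‖g x‖ ≤ b) (z : M) :
    ‖C.conv f g z‖ ≤ a * b := by
  by_cases hz : z ∈ C.setMul U V
  · obtain ⟨x, hx, y, hy, h, rfl⟩ := hz
    rw [C.conv_comp hU.injOn_r hV.injOn_d hf hg hx hy h, norm_mul]
    exact mul_le_mul (hfa x) (hgb y) (norm_nonneg _) ha
  · rw [C.conv_eq_zero hf hg hz, norm_zero]
    exact mul_nonneg ha hb

end EtaleCategory

namespace RestrictionSemigroup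

open EtaleAction hiding map_mul

open Filter Topology

variable {S : Type u} [RestrictionSemigroup S]
  {H : Type w} [NormedAddCommGroup H] [InnerProductSpace ℂ H]
  {σ : S →ₙ* (H →L[ℂ] H)}

/-! ### Functions on the space of units -/

theorem eq_lam_of_principalGerm_mem_range_unit {t : S}
    (h : principalGerm t ∈ Set.range (canonicalAction S).germCategory.unit) : (lam t : S) = t := by
  obtain ⟨x, hx⟩ := h
  have hx : germUnit x = principalGerm t := hx
  obtain rfl : x = principalChar (lam t) := congrArg germSource hx
  have hm : principalChar (lam t) ∈ (canonicalAction S).dom (lam t : S) :=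
    mem_canonicalAction_dom_proj.2 (principalChar_self _)
  rw [germUnit_eq (lam t) hm] at hx
  have := (principalGerm_eq_germ hm).1 hx.symm
  rwa [← MulMemClass.coe_mul, proj_idem] at this

theorem fiberSum_of_units {f : (canonicalAction S).Germ → ℂ}
    (hf : ∀ q, q ∉ Set.range (canonicalAction S).germCategory.unit → f q = 0) (e : Proj S) :
    fiberSum σ f (e : WithOne (Proj S)) = f (principalGerm (e : S)) • projRep σ (ofProj e) := by
  rw [projRep_ofProj]
  refine fiberSum_eq_single (by rw [lam_proj]) fun t' ht' h => ?_
  have := eq_lam_of_principalGerm_mem_range_unit (not_imp_comm.1 (hf _) h)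
  rw [← this, WithOne.coe_inj.1 ht']

/-- The support is compact in `Θ_e`, but `map_conj` asks for continuity on the whole space of units.
There the function is the indicator of the clopen set `D_e`. -/
theorem germIndicator_proj_isCc (e : Proj S) :
    IsCc (Set.range (canonicalAction S).germCategory.unit) (germIndicator (e : S)).1 := by
  have hsub : germSet (e : S) ((canonicalAction S).dom (e : S)) ⊆
      Set.range (canonicalAction S).germCategory.unit := by
    rintro _ ⟨x, hx, -, rfl⟩
    exact ⟨x, germUnit_eq e hx⟩
  have : T2Space (Set.range (canonicalAction S).germCategory.unit) := by
    refine T2Space.of_injective_continuous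
      (f := fun q : Set.range (canonicalAction S).germCategory.unit => germSource q.1) ?_
      (continuous_germSource.comp continuous_subtype_val)
    rintro ⟨_, x, rfl⟩ ⟨_, y, rfl⟩ h
    obtain rfl : x = y := h
    rfl
  refine isCc_iff.2 ⟨?_, _, hsub, isCompact_germSet_dom (e : S),
    fun q hq => germIndicator_apply_of_notMem hq⟩
  refine ((isMultiplier_eval e).continuous.comp continuous_germSource).continuousOn.congr ?_
  rintro _ ⟨x, rfl⟩
  change (germIndicator (e : S)).1 (germUnit x) =
    Set.indicator {φ : SemilatticeSpectrum (Proj S) | φ e = true} 1 x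
  by_cases hx : x e = true
  · have hx' := mem_canonicalAction_dom_proj.2 hx
    rw [Set.indicator_of_mem (s := {φ : SemilatticeSpectrum (Proj S) | φ e = true}) hx,
      germIndicator_apply_of_mem ⟨x, hx', hx', germUnit_eq e hx'⟩, Pi.one_apply]
  · rw [Set.indicator_of_notMem (s := {φ : SemilatticeSpectrum (Proj S) | φ e = true}) hx,
      germIndicator_apply_of_notMem]
    rintro ⟨y, hy, -, h⟩
    obtain rfl : x = y := congrArg germSource h
    exact hx (mem_canonicalAction_dom_proj.1 hy)

/-! ### Convergence, multiplicativity and adjoints of the extension -/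

variable [CompleteSpace H]

/-- For `f` in `C_c(U)`, an approximant from `ℂ[S]` has an eventually constant net of values, and
the norm estimate keeps the net of `f` close to that constant. The net is therefore Cauchy;
linearity covers the span. -/
theorem exists_tendsto_valueOp (hσ : IsRepresentation σ) {f : (canonicalAction S).Germ → ℂ}
    (hf : f ∈ (canonicalAction S).germCategory.A0) :
    ∃ T, Tendsto (fun F => valueOp σ F f) atTop (𝓝 T) := by
  induction hf using EtaleCategory.A0_induction with
  | hb U f hU hf =>
    have hf0 := hU.isCc_mem_A0 hf
    refine cauchy_map_iff_exists_tendsto.1 (Metric.cauchy_iff.2 ⟨inferInstance, fun ε hε => ?_⟩)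
    obtain ⟨a, ha, haε⟩ := exists_norm_sub_germHom_le hU hf (ε := ε / 3) (by positivity)
    refine ⟨Metric.closedBall (MonoidAlgebra.liftMagma ℂ σ a) (ε / 3), ?_, fun x hx y hy => ?_⟩
    · rw [mem_map]
      filter_upwards [eventually_norm_valueOp_le hσ hU (hf.sub ha) (by positivity) haε,
        eventually_valueOp_germHom (σ := σ) a] with F h1 h2
      rw [valueOp_sub hf0 (germHom S a).2, h2] at h1
      rwa [Set.mem_preimage, mem_closedBall_iff_norm]
    · have := dist_triangle_right x y (MonoidAlgebra.liftMagma ℂ σ a)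
      rw [Metric.mem_closedBall] at hx hy
      linarith
  | h0 => exact ⟨0, by simp only [valueOp_zero, tendsto_const_nhds]⟩
  | hadd f g hf hg h1 h2 =>
    obtain ⟨T, hT⟩ := h1
    obtain ⟨T', hT'⟩ := h2
    exact ⟨T + T', by simpa only [valueOp_add hf hg] using hT.add hT'⟩
  | hsmul c f hf h1 =>
    obtain ⟨T, hT⟩ := h1
    exact ⟨c • T, by simpa only [valueOp_smul] using hT.const_smul c⟩

/-- The linear extension of a representation `σ` to the convolution algebra. -/
noncomputable def valueMap (hσ : IsRepresentation σ) :
    (canonicalAction S).germCategory.A0 →ₗ[ℂ] (H →L[ℂ] H) where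
  toFun f := (exists_tendsto_valueOp hσ f.2).choose
  map_add' f g := by
    refine tendsto_nhds_unique (exists_tendsto_valueOp hσ (f + g).2).choose_spec ?_
    have := (exists_tendsto_valueOp hσ f.2).choose_spec.add
      (exists_tendsto_valueOp hσ g.2).choose_spec
    simpa only [Submodule.coe_add, valueOp_add f.2 g.2] using this
  map_smul' c f := by
    refine tendsto_nhds_unique (exists_tendsto_valueOp hσ (c • f).2).choose_spec ?_
    have := (exists_tendsto_valueOp hσ f.2).choose_spec.const_smul c
    simpa only [Submodule.coe_smul, valueOp_smul, RingHom.id_apply] using this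

theorem tendsto_valueOp (hσ : IsRepresentation σ) (f : (canonicalAction S).germCategory.A0) :
    Tendsto (fun F => valueOp σ F f.1) atTop (𝓝 (valueMap hσ f)) :=
  (exists_tendsto_valueOp hσ f.2).choose_spec

theorem valueMap_germHom (hσ : IsRepresentation σ) (a : MonoidAlgebra ℂ S) :
    valueMap hσ (germHom S a) = MonoidAlgebra.liftMagma ℂ σ a :=
  tendsto_nhds_unique (tendsto_valueOp hσ _)
    (tendsto_const_nhds.congr' ((eventually_valueOp_germHom a).mono fun _ h => h.symm))

theorem norm_valueMap_le (hσ : IsRepresentation σ) {U : Set (canonicalAction S).Germ}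
    (hU : (canonicalAction S).germCategory.IsBisection U)
    {f : (canonicalAction S).germCategory.A0} (hf : IsCc U f.1) {M : ℝ} (hM : 0 ≤ M)
    (hfM : ∀ x, ‖f.1 x‖ ≤ M) : ‖valueMap hσ f‖ ≤ M :=
  le_of_tendsto (tendsto_valueOp hσ f).norm (eventually_norm_valueOp_le hσ hU hf hM hfM)

/-- The defect of multiplicativity is bilinear, bounded in the supremum norms on `C_c(U) × C_c(V)`,
and zero on pairs from `ℂ[S]`, where `valueMap` is the given homomorphism. Uniform approximation
makes it zero throughout. -/
theorem valueMap_mul_of_isCc (hσ : IsRepresentation σ) {U V : Set (canonicalAction S).Germ}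
    (hU : (canonicalAction S).germCategory.IsBisection U)
    (hV : (canonicalAction S).germCategory.IsBisection V)
    {f g : (canonicalAction S).germCategory.A0} (hf : IsCc U f.1) (hg : IsCc V g.1) :
    valueMap hσ (f * g) = valueMap hσ f * valueMap hσ g := by
  have bound : ∀ {f g : (canonicalAction S).germCategory.A0} {a b : ℝ}, IsCc U f.1 → IsCc V g.1 →
      0 ≤ a → 0 ≤ b → (∀ x, ‖f.1 x‖ ≤ a) → (∀ x, ‖g.1 x‖ ≤ b) →
      ‖valueMap hσ (f * g) - valueMap hσ f * valueMap hσ g‖ ≤ 2 * (a * b) := by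
    intro f g a b hf hg ha hb hfa hgb
    have hc := EtaleCategory.conv_isCc _ hU hV hf hg
    have h1 : ‖valueMap hσ (f * g)‖ ≤ a * b := norm_valueMap_le hσ hc.1 hc.2 (mul_nonneg ha hb)
      (EtaleCategory.norm_conv_le hU hV hf.2.2 hg.2.2 ha hb hfa hgb)
    have h2 : ‖valueMap hσ f * valueMap hσ g‖ ≤ a * b := (norm_mul_le _ _).trans
      (mul_le_mul (norm_valueMap_le hσ hU hf ha hfa) (norm_valueMap_le hσ hV hg hb hgb)
        (norm_nonneg _) ha)
    calc _ ≤ _ := norm_sub_le _ _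
      _ ≤ 2 * (a * b) := by linarith
  obtain ⟨a, ha⟩ : ∃ a, ∀ x, ‖f.1 x‖ ≤ a := ⟨_, hf.norm_le_iSup⟩
  obtain ⟨b, hb⟩ : ∃ b, ∀ x, ‖g.1 x‖ ≤ b := ⟨_, hg.norm_le_iSup⟩
  have ha0 : 0 ≤ max a 0 := le_max_right _ _
  have hb0 : 0 ≤ max b 0 := le_max_right _ _
  rw [← sub_eq_zero, ← norm_le_zero_iff]
  -- The two terms bound the defects at `(f - x, g)` and at `(x, g - y)`, where the approximants
  -- `x`, `y` are within `ε` of `f`, `g`.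
  have hlim : Tendsto (fun ε : ℝ => 2 * (ε * max b 0) + 2 * ((max a 0 + ε) * ε)) (𝓝[>] 0)
      (𝓝 0) := by
    have : Continuous fun ε : ℝ => 2 * (ε * max b 0) + 2 * ((max a 0 + ε) * ε) := by fun_prop
    have h := (this.tendsto 0).mono_left (nhdsWithin_le_nhds (s := Set.Ioi 0))
    simpa using h
  refine ge_of_tendsto hlim ?_
  filter_upwards [self_mem_nhdsWithin] with ε hε
  have hε : 0 < ε := hε
  obtain ⟨x, hx, hfx⟩ := exists_norm_sub_germHom_le hU hf hε
  obtain ⟨y, hy, hgy⟩ := exists_norm_sub_germHom_le hV hg hε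
  have hxa : ∀ z, ‖(germHom S x).1 z‖ ≤ max a 0 + ε := fun z => by
    have h1 := norm_sub_norm_le ((germHom S x).1 z) (f.1 z)
    rw [norm_sub_rev] at h1
    have h2 : ‖f.1 z - (germHom S x).1 z‖ ≤ ε := hfx z
    have := ha z
    have := le_max_left a 0
    linarith
  have h1 := bound (f := f - germHom S x) (g := g) (hf.sub hx) hg hε.le hb0 hfx
    fun z => (hb z).trans (le_max_left _ _)
  have h2 := bound (f := germHom S x) (g := g - germHom S y) hx (hg.sub hy) (by positivity) hε.le
    hxa hgy
  have h3 : valueMap hσ (germHom S x * germHom S y) =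
      valueMap hσ (germHom S x) * valueMap hσ (germHom S y) := by
    rw [← map_mul, valueMap_germHom, valueMap_germHom, valueMap_germHom, map_mul]
  -- Expanding the right side leaves the defect at `(f, g)` minus that at the two approximants,
  -- which is zero by `h3`.
  have h4 : valueMap hσ (f * g) - valueMap hσ f * valueMap hσ g =
      (valueMap hσ ((f - germHom S x) * g) - valueMap hσ (f - germHom S x) * valueMap hσ g) +
      (valueMap hσ (germHom S x * (g - germHom S y)) -
        valueMap hσ (germHom S x) * valueMap hσ (g - germHom S y)) := by
    simp only [sub_mul, mul_sub, map_sub, h3]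
    abel
  rw [h4]
  exact (norm_add_le _ _).trans (add_le_add h1 h2)

theorem valueMap_mul (hσ : IsRepresentation σ) (f g : (canonicalAction S).germCategory.A0) :
    valueMap hσ (f * g) = valueMap hσ f * valueMap hσ g := by
  obtain ⟨f, hf⟩ := f
  obtain ⟨g, hg⟩ := g
  induction hf using EtaleCategory.A0_induction with
  | hb U f hU hf =>
    induction hg using EtaleCategory.A0_induction with
    | hb V g hV hg => exact valueMap_mul_of_isCc hσ hU hV hf hg
    | h0 =>
      have : (⟨0, zero_mem _⟩ : (canonicalAction S).germCategory.A0) = 0 := rfl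
      rw [this, mul_zero, map_zero, mul_zero]
    | hadd g g' hg hg' h1 h2 =>
      have : (⟨g + g', add_mem hg hg'⟩ : (canonicalAction S).germCategory.A0) =
        ⟨g, hg⟩ + ⟨g', hg'⟩ := rfl
      rw [this, mul_add, map_add, map_add, mul_add, h1, h2]
    | hsmul c g hg h1 =>
      have : (⟨c • g, Submodule.smul_mem _ c hg⟩ : (canonicalAction S).germCategory.A0) =
        c • ⟨g, hg⟩ := rfl
      rw [this, mul_smul_comm, map_smul, map_smul, mul_smul_comm, h1]
  | h0 =>
    have : (⟨0, zero_mem _⟩ : (canonicalAction S).germCategory.A0) = 0 := rfl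
    rw [this, zero_mul, map_zero, zero_mul]
  | hadd f f' hf hf' h1 h2 =>
    have : (⟨f + f', add_mem hf hf'⟩ : (canonicalAction S).germCategory.A0) =
      ⟨f, hf⟩ + ⟨f', hf'⟩ := rfl
    rw [this, add_mul, map_add, map_add, add_mul, h1, h2]
  | hsmul c f hf h1 =>
    have : (⟨c • f, Submodule.smul_mem _ c hf⟩ : (canonicalAction S).germCategory.A0) =
      c • ⟨f, hf⟩ := rfl
    rw [this, smul_mul_assoc, map_smul, map_smul, smul_mul_assoc, h1]

/-- On units the only germ over the principal character of `e` that contributes is that of `e`.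
Every summand is then a scalar times a product of commuting self-adjoint operators, so the identity
already holds before the limit. -/
theorem star_valueOp (hσ : IsRepresentation σ) {f g : (canonicalAction S).Germ → ℂ}
    (hf : ∀ q, q ∉ Set.range (canonicalAction S).germCategory.unit → f q = 0)
    (hg : ∀ q, g q = starRingEnd ℂ (f q)) (F : Finset (Proj S)) :
    star (valueOp σ F f) = valueOp σ F g := by
  have hg' : ∀ q, q ∉ Set.range (canonicalAction S).germCategory.unit → g q = 0 := fun q hq => by
    rw [hg, hf q hq, map_zero]
  rw [valueOp, valueOp, star_sum]
  refine Finset.sum_congr rfl fun F' _ => ?_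
  rcases hm : meet F' with _ | e
  · have h1 : ∀ f : (canonicalAction S).Germ → ℂ, fiberSum σ f (1 : WithOne (Proj S)) = 0 :=
      fun f => fiberSum_eq_zero fun t ht => absurd ht WithOne.coe_ne_one
    change star (fiberSum σ f 1 * _) = fiberSum σ g 1 * _
    rw [h1, h1, zero_mul, star_zero]
  · change star (fiberSum σ f (e : WithOne (Proj S)) * _) = fiberSum σ g (e : WithOne (Proj S)) * _
    rw [fiberSum_of_units hf, fiberSum_of_units hg', smul_mul_assoc, smul_mul_assoc, ← map_mul,
      star_smul, (isSelfAdjoint_projRep_mul (isSelfAdjoint_projRep_ofProj hσ e)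
        (isSelfAdjoint_projRep_atom hσ F F')).star_eq, hg]
    rfl

/-- The extension of a representation `σ` to the convolution algebra. -/
noncomputable def valueHom (hσ : IsRepresentation σ) :
    (canonicalAction S).germCategory.A0 →ₙₐ[ℂ] (H →L[ℂ] H) :=
  { valueMap hσ with
    map_zero' := map_zero (valueMap hσ)
    map_mul' := valueMap_mul hσ }

theorem isRepresentation_valueHom (hσ : IsRepresentation σ) :
    (canonicalAction S).germCategory.IsRepresentation (valueHom hσ) where
  norm_le U hU f hf := norm_valueMap_le hσ hU hf
    (Real.iSup_nonneg fun x => norm_nonneg _) hf.norm_le_iSup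
  map_conj f g hf hg := by
    refine tendsto_nhds_unique (tendsto_valueOp hσ g) ?_
    have h := (continuous_star.tendsto _).comp (tendsto_valueOp hσ f)
    refine h.congr fun F => ?_
    exact star_valueOp hσ hf.2.2 hg F

theorem isRepresentation_comp_germIndicator
    {π : (canonicalAction S).germCategory.A0 →ₙₐ[ℂ] (H →L[ℂ] H)}
    (hπ : (canonicalAction S).germCategory.IsRepresentation π) :
    IsRepresentation (⟨fun s => π (germIndicator s), fun s t => by
      rw [germIndicator_mul, map_mul]⟩ : S →ₙ* (H →L[ℂ] H)) where
  norm_le_one s := by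
    refine (hπ.norm_le _ (isBisection_germSet (canonicalAction S) s
      (isOpen_dom (θ := canonicalAction S) s)) _ (germIndicator_isCc s)).trans
      (Real.iSup_le (fun q => ?_) zero_le_one)
    by_cases hq : q ∈ germSet s ((canonicalAction S).dom s)
    · rw [germIndicator_apply_of_mem hq, norm_one]
    · rw [germIndicator_apply_of_notMem hq, norm_zero]
      exact zero_le_one
  adjoint_eq e := by
    refine (hπ.map_conj _ _ ?_ fun q => ?_).symm
    · exact germIndicator_proj_isCc e
    · by_cases hq : q ∈ germSet (e : S) ((canonicalAction S).dom (e : S))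
      · rw [germIndicator_apply_of_mem hq, map_one]
      · rw [germIndicator_apply_of_notMem hq, map_zero]
  sq_eq e := by
    change π (germIndicator (e : S)) ^ 2 = π (germIndicator (e : S))
    rw [sq, ← map_mul, ← germIndicator_mul, ← MulMemClass.coe_mul, proj_idem]

end RestrictionSemigroup

/-! ### The isomorphism of operator algebras -/

namespace AlgSeminorm

variable {A : Type u} [NonUnitalRing A] [Module ℂ A] {B : Type v} [NonUnitalRing B] [Module ℂ B]

/-- A homomorphism which preserves the seminorms and has dense range extends to an isometric
isomorphism of the Hausdorff completions. -/
theorem exists_isometric_extension (p : AlgSeminorm A) (q : AlgSeminorm B) (ι : A →ₙₐ[ℂ] B)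
    (h : ∀ a, q.toSeminorm (ι a) = p.toSeminorm a)
    (hd : ∀ b, ∀ ε > 0, ∃ a, q.toSeminorm (b - ι a) ≤ ε) :
    ∃ Φ : p.HausdorffCompletion →ₙₐ[ℂ] q.HausdorffCompletion,
      Isometry Φ ∧ Function.Bijective Φ ∧ ∀ a, Φ (p.toCompletion a) = q.toCompletion (ι a) := by
  let j : p.Space →+ q.Space :=
    { toFun := fun a => ι a
      map_zero' := map_zero ι
      map_add' := map_add ι }
  have hj : Isometry j := AddMonoidHomClass.isometry_of_norm j h
  let Φ : p.HausdorffCompletion → q.HausdorffCompletion := UniformSpace.Completion.map j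
  have hΦ : Isometry Φ := hj.completion_map
  have hΦc : Continuous Φ := hΦ.continuous
  have hcoe : ∀ a, Φ (p.toCompletion a) = q.toCompletion (ι a) := fun a =>
    UniformSpace.Completion.map_coe hj.uniformContinuous a
  refine ⟨{ toFun := Φ, map_smul' := fun c x => ?_, map_zero' := ?_, map_add' := fun x y => ?_,
            map_mul' := fun x y => ?_ }, hΦ, ⟨hΦ.injective, ?_⟩, hcoe⟩
  · refine p.denseRange_toCompletion.induction_on (p := fun x => Φ (c • x) = c • Φ x) x
      (isClosed_eq (hΦc.comp (continuous_const_smul c)) (hΦc.const_smul c)) fun a => ?_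
    rw [← toCompletion_smul, hcoe, hcoe, map_smul, toCompletion_smul]
  · rw [← toCompletion_zero, hcoe, map_zero, toCompletion_zero]
  · refine p.denseRange_toCompletion.induction_on₂ (p := fun x y => Φ (x + y) = Φ x + Φ y)
      (isClosed_eq (hΦc.comp (continuous_fst.add continuous_snd))
        ((hΦc.comp continuous_fst).add (hΦc.comp continuous_snd))) (fun a b => ?_) x y
    rw [← toCompletion_add, hcoe, hcoe, hcoe, map_add, toCompletion_add]
  · refine p.denseRange_toCompletion.induction_on₂ (p := fun x y => Φ (x * y) = Φ x * Φ y)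
      (isClosed_eq (hΦc.comp (continuous_fst.mul continuous_snd))
        ((hΦc.comp continuous_fst).mul (hΦc.comp continuous_snd))) (fun a b => ?_) x y
    rw [← toCompletion_mul, hcoe, hcoe, hcoe, map_mul, toCompletion_mul]
  -- The range of an isometry from a complete space is closed, so density of the image gives
  -- surjectivity.
  · have hcl : IsClosed (Set.range Φ) := hΦ.isClosedEmbedding.isClosed_range
    have hB : ∀ b, q.toCompletion b ∈ Set.range Φ := fun b => by
      rw [← hcl.closure_eq, Metric.mem_closure_iff]
      intro ε hε
      obtain ⟨a, ha⟩ := hd b (ε / 2) (by positivity)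
      refine ⟨_, ⟨p.toCompletion a, rfl⟩, ?_⟩
      have hb : q.toCompletion b = q.toCompletion (b - ι a) + q.toCompletion (ι a) := by
        rw [← toCompletion_add, sub_add_cancel]
      rw [hcoe, hb, dist_eq_norm, add_sub_cancel_right, norm_toCompletion]
      linarith
    intro y
    exact q.denseRange_toCompletion.induction_on (p := fun y => y ∈ Set.range Φ) y hcl hB

end AlgSeminorm

/-! ### Equality of the seminorms and density of the image -/

namespace RestrictionSemigroup

open EtaleAction hiding map_mul

variable {S : Type u} [RestrictionSemigroup S]

/-- Restriction to the indicators and the extension `valueHom` carry representations of one algebra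
to the other on the same Hilbert space. The two sets of norms coincide, not only their suprema. -/
theorem seminorm_germHom (a : MonoidAlgebra ℂ S) :
    ((canonicalAction S).germCategory.repClass.seminorm
      (canonicalAction S).germCategory.repClass_bounded).toSeminorm (germHom S a) =
    ((repClass S).seminorm (repClass_bounded S)).toSeminorm a := by
  change sSup ((canonicalAction S).germCategory.repClass.norms (germHom S a)) =
    sSup ((repClass S).norms a)
  congr 1
  ext c
  constructor
  · rintro ⟨H, _, _, _, π, hπ, rfl⟩
    refine ⟨H, _, _, _, π.comp (germHom S), ⟨_, isRepresentation_comp_germIndicator hπ, ?_⟩, rfl⟩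
    refine MonoidAlgebra.nonUnitalAlgHom_ext ℂ fun s => ?_
    rw [NonUnitalAlgHom.comp_apply, germHom_single, liftMagma_single]
    rfl
  · rintro ⟨H, _, _, _, _, ⟨σ, hσ, rfl⟩, rfl⟩
    exact ⟨H, _, _, _, valueHom hσ, isRepresentation_valueHom hσ,
      congrArg norm (valueMap_germHom hσ a).symm⟩

/-- On a bisection the seminorm is at most the supremum norm, because representations are
contractive there. Uniform approximation within the same `C_c(U)` is therefore enough. -/
theorem exists_seminorm_sub_germHom_le (f : (canonicalAction S).germCategory.A0) {ε : ℝ}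
    (hε : 0 < ε) : ∃ a : MonoidAlgebra ℂ S,
      ((canonicalAction S).germCategory.repClass.seminorm
        (canonicalAction S).germCategory.repClass_bounded).toSeminorm (f - germHom S a) ≤ ε := by
  set p := ((canonicalAction S).germCategory.repClass.seminorm
    (canonicalAction S).germCategory.repClass_bounded).toSeminorm
  obtain ⟨f, hf⟩ := f
  induction hf using EtaleCategory.A0_induction generalizing ε with
  | hb U f hU hf =>
    obtain ⟨a, ha, haε⟩ := exists_norm_sub_germHom_le hU hf hε
    refine ⟨a, Real.sSup_le ?_ hε.le⟩
    rintro _ ⟨H, _, _, _, π, hπ, rfl⟩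
    exact (hπ.norm_le U hU _ (hf.sub ha)).trans (Real.iSup_le haε hε.le)
  | h0 =>
    refine ⟨0, ?_⟩
    have : (⟨0, zero_mem _⟩ : (canonicalAction S).germCategory.A0) = 0 := rfl
    rw [this, map_zero, sub_zero, map_zero]
    exact hε.le
  | hadd f g hf hg h1 h2 =>
    obtain ⟨a, ha⟩ := h1 (half_pos hε)
    obtain ⟨b, hb⟩ := h2 (half_pos hε)
    refine ⟨a + b, ?_⟩
    have : (⟨f + g, add_mem hf hg⟩ : (canonicalAction S).germCategory.A0) - germHom S (a + b) =
        (⟨f, hf⟩ - germHom S a) + (⟨g, hg⟩ - germHom S b) := by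
      rw [map_add, sub_add_sub_comm]
      rfl
    rw [this]
    exact (map_add_le_add p _ _).trans (by linarith)
  | hsmul c f hf h1 =>
    -- Adding `1` covers the scalar `c = 0` without a separate case.
    have hc : 0 < ‖c‖ + 1 := by positivity
    obtain ⟨a, ha⟩ := h1 (div_pos hε hc)
    refine ⟨c • a, ?_⟩
    have : (⟨c • f, Submodule.smul_mem _ c hf⟩ : (canonicalAction S).germCategory.A0) -
        germHom S (c • a) = c • (⟨f, hf⟩ - germHom S a) := by
      rw [map_smul, smul_sub]
      rfl
    rw [this, map_smul_eq_mul]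
    calc ‖c‖ * p (⟨f, hf⟩ - germHom S a) ≤ (‖c‖ + 1) * (ε / (‖c‖ + 1)) :=
          mul_le_mul (by linarith) ha (apply_nonneg _ _) hc.le
      _ = ε := mul_div_cancel₀ _ hc.ne'

end RestrictionSemigroup

theorem mainTheorem3 {S : Type u} [RestrictionSemigroup S]
    [SecondCountableTopology (SemilatticeSpectrum (RestrictionSemigroup.Proj S))] :
    ∃ Φ : RestrictionSemigroup.OperatorAlgebra S →ₙₐ[ℂ]
        (RestrictionSemigroup.canonicalAction S).germCategory.OperatorAlgebra,
      (Isometry Φ ∧ Function.Bijective Φ ∧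
        ∀ s : S, Φ (RestrictionSemigroup.toOperatorAlgebra (MonoidAlgebra.single s 1)) =
          EtaleCategory.toOperatorAlgebra _ (RestrictionSemigroup.germIndicator s)) ∧
      ∀ Ψ : RestrictionSemigroup.OperatorAlgebra S →ₙₐ[ℂ]
          (RestrictionSemigroup.canonicalAction S).germCategory.OperatorAlgebra,
        Continuous Ψ →
        (∀ s : S, Ψ (RestrictionSemigroup.toOperatorAlgebra (MonoidAlgebra.single s 1)) =
          EtaleCategory.toOperatorAlgebra _ (RestrictionSemigroup.germIndicator s)) →
        Ψ = Φ := by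
  obtain ⟨Φ, h1, h2, h3⟩ := AlgSeminorm.exists_isometric_extension
    ((RestrictionSemigroup.repClass S).seminorm (RestrictionSemigroup.repClass_bounded S))
    ((RestrictionSemigroup.canonicalAction S).germCategory.repClass.seminorm
      (RestrictionSemigroup.canonicalAction S).germCategory.repClass_bounded)
    (RestrictionSemigroup.germHom S) RestrictionSemigroup.seminorm_germHom
    fun f ε hε => RestrictionSemigroup.exists_seminorm_sub_germHom_le f hε
  have h4 : ∀ s : S, Φ (RestrictionSemigroup.toOperatorAlgebra (MonoidAlgebra.single s 1)) =
      EtaleCategory.toOperatorAlgebra _ (RestrictionSemigroup.germIndicator s) := fun s => by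
    rw [← RestrictionSemigroup.germHom_single]
    exact h3 _
  refine ⟨Φ, ⟨h1, h2, h4⟩, fun Ψ hΨ h5 => NonUnitalAlgHom.ext fun x => ?_⟩
  -- Two continuous homomorphisms that agree on the images of the `δ_s` agree on their span, which
  -- is dense.
  refine AlgSeminorm.denseRange_toCompletion _ |>.induction_on (p := fun x => Ψ x = Φ x) x
    (isClosed_eq hΨ h1.continuous) fun a => ?_
  induction a using MonoidAlgebra.induction_linear with
  | zero => rw [AlgSeminorm.toCompletion_zero, map_zero, map_zero]
  | add a b ha hb => rw [AlgSeminorm.toCompletion_add, map_add, map_add, ha, hb]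
  | single s c =>
    have h : MonoidAlgebra.single s c = c • MonoidAlgebra.single s (1 : ℂ) := by simp
    rw [h, AlgSeminorm.toCompletion_smul, map_smul, map_smul]
    exact congrArg (c • ·) ((h5 s).trans (h4 s).symm)
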